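/- **Setting.** Write $\mathbb T=\mathbb R/2\pi\mathbb Z$ and let $s\in(0,1)$. Let $$\|f\|_{C^s}=\|f\|_{L^\infty}+\sup_{\theta_1\ne\theta_2}\frac{|f(\theta_1)-f(\theta_2)|}{|\theta_1-\theta_2|^s},\qquad \|f\|_{C^{1,s}}=\|f\|_{L^\infty}+\|f'\|_{C^s}.$$ Let $\mathbb Y^s$ be the space of odd functions $\sum_{n\ge1}\alpha_n\sin(n\theta)$ of class $C^s(\mathbb T)$, and let $\mathbb X^{1,s}$ be the space of even mean-zero functions $\sum_{n\ge1}\alpha_n\cos(n\theta)$ of class $C^{1,s}(\mathbb T)$, all real-valued and with the norms above. Let $\mathbb X^{1,s}_{\ge2}\subset\mathbb X^{1,s}$ be the closed subspace of functions with vanishing first coefficient, i.e. of the form $\sum_{n\ge2}\alpha_n\cos(n\theta)$, and let $B(a)=\{r\in\mathbb X^{1,s}:\|r\|_{C^{1,s}}<a\}$. For $r\in\mathbb X^{1,s}$ put $R(\theta)=\sqrt{1+2\varepsilon q\,r(\theta)}$ and let $O$ be the domain enclosed by the curve $\theta\mapsto R(\theta)e^{i\theta}$. For $\varepsilon q\neq0$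 the contour functional of the vortex patch $\varepsilon^{-2}\mathbf 1_{D_t}$, $D_t=e^{i\Omega t}(\varepsilon O+q)$, rotating rigidly about the origin in the unit disc is $$\begin{aligned}\mathcal G(\varepsilon,q,\Omega,r)(\theta)=\;&\varepsilon^2\Omega\, r'(\theta)+\Omega\,\partial_\theta\big[R(\theta)\cos\theta\big]-\frac1{2\pi\varepsilon q}\,\partial_\theta\int_{O}\log\big|R(\theta)e^{i\theta}-\zeta\big|\,dA(\zeta)\\&+\frac1{2\pi\varepsilon q}\,\partial_\theta\int_{O}\log\big|1-(\varepsilon R(\theta)e^{-i\theta}+q)(\varepsilon\zeta+q)\big|\,dA(\zeta).\end{aligned}$$ The patch satisfies the vortex patch equation if and only if $\mathcal G(\varepsilon,q,\Omega,r)=0$. **Theorem.** Let $s\in(0,1)$ and $\delta\in(0,1)$. There exist $\varepsilon_0,a_0>0$ such that, with $I=(-\varepsilon_0,\varepsilon_0)$ and $J=(-1+\delta,1-\delta)$, the following hold. (i) For $(\varepsilon,q,r)\in I\times J\times B(a_0)$ one has $1+2\varepsilon q\,r>0$, and the closed set $\varepsilon\overline O+q$ lies in the open unit disc. For $\varepsilon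 q\ne0$ and $\Omega\in\mathbb R$ the integrals and derivatives above exist, and $\mathcal G(\varepsilon,q,\Omega,r)\in\mathbb Y^s$. The functional $\mathcal G$ extends (uniquely, by density) to $\varepsilon q=0$ as a map of class $C^1$ $$\mathcal G: I\times J\times\mathbb R\times B(a_0)\to\mathbb Y^s .$$ (ii) For all $q\in J$ and $\Omega\in\mathbb R$, $\ \mathcal G(0,q,\Omega,0)=0\iff\Omega=\Omega_0(q):=\dfrac1{2(1-q^2)}$. (iii) For every $q\in J$, the differential $d_{(\Omega,r)}\mathcal G(0,q,\Omega_0(q),0):\mathbb R\times\mathbb X^{1,s}\to\mathbb Y^s$ restricts to an isomorphism (a bounded linear bijection with bounded inverse) from $\mathbb R\times\mathbb X^{1,s}_{\ge2}$ onto $\mathbb Y^s$. Its kernel on $\mathbb R\times\mathbb X^{1,s}$ is the line spanned by $(0,\cos\theta)$. (iv) There exist $C^1$ functions $\Omega:I\times J\to\mathbb R$ and $r:I\times J\to\mathbb X^{1,s}_{\ge2}\cap B(a_0)$ with $\Omega(0,q)=\Omega_0(q)$ and $r(0,q)=0$ for all $q\in J$, such that $$\mathcal G\big(\varepsilon,q,\Omega(\varepsilon,q),r(\varepsilon,q)\big)=0\qquad\text{for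 all }(\varepsilon,q)\in I\times J.$$ -/

import Mathlib

open scoped NNReal

noncomputable section

namespace RotatingPatch

/-! ### Hölder spaces on the torus

Functions on the torus are `2π`-periodic functions on `ℝ`.  For such functions the supremum of
`|f θ₁ - f θ₂| / |θ₁ - θ₂| ^ s` over real `θ₁ ≠ θ₂` is the usual Hölder seminorm on the torus;
it is `nnHolderNorm s f`. -/

/-- The uniform norm `sup |f|`. -/
def supNorm (f : ℝ → ℝ) : ℝ := ⨆ θ : ℝ, |f θ|

/-- The norm `sup |f| + [f]_s` of `C^s`. -/
def holderNorm (s : ℝ≥0) (f : ℝ → ℝ) : ℝ := supNorm f + (nnHolderNorm s f : ℝ)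

/-- `f` is a `2π`-periodic function of class `C^s`. -/
def IsHolder (s : ℝ≥0) (f : ℝ → ℝ) : Prop :=
  Function.Periodic f (2 * Real.pi) ∧ MemHolder s f

theorem IsHolder.bddAbove {s : ℝ≥0} {f : ℝ → ℝ} (hf : IsHolder s f) :
    BddAbove (Set.range fun θ : ℝ => |f θ|) := by
  obtain ⟨hp, C, hC⟩ := hf
  refine ⟨|f 0| + C * (2 * Real.pi) ^ (s : ℝ), ?_⟩
  rintro _ ⟨θ, rfl⟩
  obtain ⟨y, hy, hfy⟩ := hp.exists_mem_Ico₀ (by positivity) θ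
  have h1 := hC.dist_le y 0
  have h2 : dist y 0 ^ (s : ℝ) ≤ (2 * Real.pi) ^ (s : ℝ) := by
    apply Real.rpow_le_rpow dist_nonneg _ s.2
    rw [Real.dist_eq, sub_zero, abs_of_nonneg hy.1]
    exact hy.2.le
  have h3 : (C : ℝ) * dist y 0 ^ (s : ℝ) ≤ C * (2 * Real.pi) ^ (s : ℝ) :=
    mul_le_mul_of_nonneg_left h2 C.2
  rw [Real.dist_eq] at h1
  have h4 : |f θ| ≤ |f y - f 0| + |f 0| := by
    rw [hfy]; simpa using abs_add_le (f y - f 0) (f 0)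
  linarith

theorem IsHolder.zero {s : ℝ≥0} : IsHolder s (0 : ℝ → ℝ) := ⟨fun _ => rfl, memHolder_zero⟩

theorem IsHolder.add {s : ℝ≥0} {f g : ℝ → ℝ} (hf : IsHolder s f) (hg : IsHolder s g) :
    IsHolder s (f + g) := ⟨hf.1.add hg.1, hf.2.add hg.2⟩

theorem IsHolder.smul {s : ℝ≥0} {f : ℝ → ℝ} (c : ℝ) (hf : IsHolder s f) :
    IsHolder s (c • f) := ⟨fun θ => by simp [hf.1 θ], hf.2.smul⟩

theorem supNorm_nonneg (f : ℝ → ℝ) : 0 ≤ supNorm f := Real.iSup_nonneg fun _ => abs_nonneg _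

theorem holderNorm_nonneg (s : ℝ≥0) (f : ℝ → ℝ) : 0 ≤ holderNorm s f :=
  add_nonneg (supNorm_nonneg f) (nnHolderNorm s f).2

theorem supNorm_smul (c : ℝ) (f : ℝ → ℝ) : supNorm (c • f) = ‖c‖ * supNorm f := by
  simp only [supNorm, Pi.smul_apply, smul_eq_mul, abs_mul, Real.norm_eq_abs]
  rw [Real.mul_iSup_of_nonneg (abs_nonneg c)]

theorem supNorm_add_le {f g : ℝ → ℝ} (hf : BddAbove (Set.range fun θ : ℝ => |f θ|))
    (hg : BddAbove (Set.range fun θ : ℝ => |g θ|)) :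
    supNorm (f + g) ≤ supNorm f + supNorm g :=
  ciSup_le fun θ => (abs_add_le (f θ) (g θ)).trans (add_le_add (le_ciSup hf θ) (le_ciSup hg θ))

theorem eq_zero_of_supNorm {f : ℝ → ℝ} (hf : BddAbove (Set.range fun θ : ℝ => |f θ|))
    (h : supNorm f = 0) : f = 0 := by
  funext θ
  have := le_ciSup hf θ
  exact abs_eq_zero.1 (le_antisymm (this.trans h.le) (abs_nonneg _))

theorem supNorm_zero : supNorm 0 = 0 := by simp [supNorm]

theorem holderNorm_smul {s : ℝ≥0} {f : ℝ → ℝ} (c : ℝ) (hf : IsHolder s f) :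
    holderNorm s (c • f) = ‖c‖ * holderNorm s f := by
  rw [holderNorm, holderNorm, supNorm_smul, hf.2.nnHolderNorm_smul c]
  push_cast
  ring

theorem holderNorm_add_le {s : ℝ≥0} {f g : ℝ → ℝ} (hf : IsHolder s f) (hg : IsHolder s g) :
    holderNorm s (f + g) ≤ holderNorm s f + holderNorm s g := by
  have h1 := supNorm_add_le hf.bddAbove hg.bddAbove
  have h2 : (nnHolderNorm s (f + g) : ℝ) ≤ nnHolderNorm s f + nnHolderNorm s g := by
    exact_mod_cast hf.2.nnHolderNorm_add_le hg.2
  unfold holderNorm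
  linarith

theorem holderNorm_zero (s : ℝ≥0) : holderNorm s 0 = 0 := by
  simp [holderNorm, supNorm_zero]

/-- Odd functions of class `C^s` on the torus (those whose Fourier series is a sine series). -/
def holderOddSubmodule (s : ℝ≥0) : Submodule ℝ (ℝ → ℝ) where
  carrier := {f | IsHolder s f ∧ ∀ θ, f (-θ) = -f θ}
  zero_mem' := ⟨IsHolder.zero, fun _ => by simp⟩
  add_mem' := fun hf hg => ⟨hf.1.add hg.1, fun θ => by simp [hf.2 θ, hg.2 θ]; ring⟩
  smul_mem' := fun c f hf => ⟨hf.1.smul c, fun θ => by simp [hf.2 θ]⟩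

/-- The space `Y^s` of odd functions of class `C^s` on the torus, with the `C^s` norm. -/
def HolderOdd (s : ℝ≥0) : Type := ↥(holderOddSubmodule s)

namespace HolderOdd

variable {s : ℝ≥0}

instance : AddCommGroup (HolderOdd s) := inferInstanceAs (AddCommGroup ↥(holderOddSubmodule s))
instance : Module ℝ (HolderOdd s) := inferInstanceAs (Module ℝ ↥(holderOddSubmodule s))

/-- The inclusion of `HolderOdd s` into the functions on `ℝ`. -/
def toFun : HolderOdd s →ₗ[ℝ] (ℝ → ℝ) := (holderOddSubmodule s).subtype

instance : CoeFun (HolderOdd s) (fun _ => ℝ → ℝ) := ⟨fun f => toFun f⟩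

theorem toFun_mem (f : HolderOdd s) : toFun f ∈ holderOddSubmodule s := Subtype.property (p := (· ∈ holderOddSubmodule s)) f

theorem toFun_injective : Function.Injective (toFun : HolderOdd s →ₗ[ℝ] (ℝ → ℝ)) :=
  (holderOddSubmodule s).subtype_injective

theorem exists_toFun_eq {f : ℝ → ℝ} (hf : f ∈ holderOddSubmodule s) : ∃ g : HolderOdd s, toFun g = f := ⟨⟨f, hf⟩, rfl⟩

instance : Norm (HolderOdd s) := ⟨fun f => holderNorm s f⟩

theorem norm_def (f : HolderOdd s) : ‖f‖ = holderNorm s f := rfl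

theorem core : NormedSpace.Core ℝ (HolderOdd s) where
  norm_nonneg f := holderNorm_nonneg s _
  norm_smul c f := by
    rw [norm_def, norm_def, map_smul, holderNorm_smul c (toFun_mem f).1]
  norm_triangle f g := by
    simp only [norm_def, map_add]
    exact holderNorm_add_le (toFun_mem f).1 (toFun_mem g).1
  norm_eq_zero_iff f := by
    refine ⟨fun h => toFun_injective ?_, fun h => ?_⟩
    · rw [norm_def, holderNorm] at h
      have h1 := supNorm_nonneg f
      have h2 : (0 : ℝ) ≤ nnHolderNorm s f := NNReal.coe_nonneg _
      rw [map_zero]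
      exact eq_zero_of_supNorm (toFun_mem f).1.bddAbove (by linarith)
    · rw [h, norm_def, map_zero, holderNorm_zero]

instance : NormedAddCommGroup (HolderOdd s) := NormedAddCommGroup.ofCore core
instance : NormedSpace ℝ (HolderOdd s) := NormedSpace.ofCore core

end HolderOdd

/-- Even functions of class `C^{1,s}` and mean zero on the torus (those whose Fourier series is a
cosine series `∑_{n ≥ 1} αₙ cos (n θ)`). -/
def holderEvenSubmodule (s : ℝ≥0) : Submodule ℝ (ℝ → ℝ) where
  carrier := {f | Function.Periodic f (2 * Real.pi) ∧ (∀ θ, f (-θ) = f θ) ∧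
    Differentiable ℝ f ∧ MemHolder s (deriv f) ∧ ∫ θ in (0 : ℝ)..(2 * Real.pi), f θ = 0}
  zero_mem' := ⟨fun _ => rfl, fun _ => rfl, differentiable_const 0, by simp, by simp⟩
  add_mem' := by
    rintro f g ⟨f1, f2, f3, f4, f5⟩ ⟨g1, g2, g3, g4, g5⟩
    refine ⟨f1.add g1, fun θ => by simp [f2 θ, g2 θ], f3.add g3, ?_, ?_⟩
    · rw [show deriv (f + g) = deriv f + deriv g from funext fun θ => deriv_add (f3 θ) (g3 θ)]
      exact f4.add g4
    · simp only [Pi.add_apply]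
      rw [intervalIntegral.integral_add (f3.continuous.intervalIntegrable _ _)
        (g3.continuous.intervalIntegrable _ _), f5, g5, add_zero]
  smul_mem' := by
    rintro c f ⟨f1, f2, f3, f4, f5⟩
    refine ⟨fun θ => by simp [f1 θ], fun θ => by simp [f2 θ], f3.const_smul c, ?_, ?_⟩
    · rw [show deriv (c • f) = c • deriv f from funext fun θ => deriv_const_smul c (f3 θ)]
      exact f4.smul
    · simp [f5]

theorem isHolder_deriv {s : ℝ≥0} {f : ℝ → ℝ} (hf : f ∈ holderEvenSubmodule s) :
    IsHolder s (deriv f) := by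
  obtain ⟨f1, -, -, f4, -⟩ := hf
  refine ⟨fun θ => ?_, f4⟩
  rw [← deriv_comp_add_const]
  congr 1
  exact funext f1

theorem bddAbove_of_mem {s : ℝ≥0} {f : ℝ → ℝ} (hf : f ∈ holderEvenSubmodule s) :
    BddAbove (Set.range fun θ : ℝ => |f θ|) := by
  obtain ⟨f1, -, f3, -, -⟩ := hf
  obtain ⟨C, hC⟩ := (isCompact_Icc (a := (0 : ℝ)) (b := 2 * Real.pi)).bddAbove_image
    (f := fun θ => |f θ|) f3.continuous.abs.continuousOn
  refine ⟨C, ?_⟩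
  rintro _ ⟨θ, rfl⟩
  obtain ⟨y, hy, hfy⟩ := f1.exists_mem_Ico₀ (by positivity) θ
  exact hC ⟨y, ⟨hy.1, hy.2.le⟩, by simp [hfy]⟩

/-- The space `X^{1,s}` of even, mean-zero functions of class `C^{1,s}` on the torus, with the norm
`sup |f| + ‖f'‖_{C^s}`. -/
def HolderEven (s : ℝ≥0) : Type := ↥(holderEvenSubmodule s)

namespace HolderEven

variable {s : ℝ≥0}

instance : AddCommGroup (HolderEven s) := inferInstanceAs (AddCommGroup ↥(holderEvenSubmodule s))
instance : Module ℝ (HolderEven s) := inferInstanceAs (Module ℝ ↥(holderEvenSubmodule s))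

/-- The inclusion of `HolderEven s` into the functions on `ℝ`. -/
def toFun : HolderEven s →ₗ[ℝ] (ℝ → ℝ) := (holderEvenSubmodule s).subtype

instance : CoeFun (HolderEven s) (fun _ => ℝ → ℝ) := ⟨fun f => toFun f⟩

theorem toFun_mem (f : HolderEven s) : toFun f ∈ holderEvenSubmodule s := Subtype.property (p := (· ∈ holderEvenSubmodule s)) f

theorem toFun_injective : Function.Injective (toFun : HolderEven s →ₗ[ℝ] (ℝ → ℝ)) :=
  (holderEvenSubmodule s).subtype_injective

theorem exists_toFun_eq {f : ℝ → ℝ} (hf : f ∈ holderEvenSubmodule s) : ∃ g : HolderEven s, toFun g = f := ⟨⟨f, hf⟩, rfl⟩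

instance : Norm (HolderEven s) := ⟨fun f => supNorm f + holderNorm s (deriv f)⟩

theorem norm_def (f : HolderEven s) : ‖f‖ = supNorm f + holderNorm s (deriv f) := rfl

theorem differentiable (f : HolderEven s) : Differentiable ℝ f := (toFun_mem f).2.2.1

theorem core : NormedSpace.Core ℝ (HolderEven s) where
  norm_nonneg f := add_nonneg (supNorm_nonneg _) (holderNorm_nonneg s _)
  norm_smul c f := by
    have h : deriv (c • toFun f) = c • deriv (toFun f) :=
      funext fun θ => deriv_const_smul c (differentiable f θ)
    rw [norm_def, norm_def, map_smul, h, supNorm_smul,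
      holderNorm_smul c (isHolder_deriv (toFun_mem f))]
    ring
  norm_triangle f g := by
    have h : deriv (toFun f + toFun g) = deriv (toFun f) + deriv (toFun g) :=
      funext fun θ => deriv_add (differentiable f θ) (differentiable g θ)
    rw [norm_def, norm_def, norm_def, map_add, h]
    have h1 := supNorm_add_le (bddAbove_of_mem (toFun_mem f)) (bddAbove_of_mem (toFun_mem g))
    have h2 := holderNorm_add_le (isHolder_deriv (toFun_mem f)) (isHolder_deriv (toFun_mem g))
    linarith
  norm_eq_zero_iff f := by
    refine ⟨fun h => toFun_injective ?_, fun h => ?_⟩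
    · rw [norm_def] at h
      have h1 := supNorm_nonneg f
      have h2 := holderNorm_nonneg s (deriv f)
      rw [map_zero]
      exact eq_zero_of_supNorm (bddAbove_of_mem (toFun_mem f)) (by linarith)
    · rw [h, norm_def, map_zero, deriv_zero, supNorm_zero, holderNorm_zero, add_zero]

instance : NormedAddCommGroup (HolderEven s) := NormedAddCommGroup.ofCore core
instance : NormedSpace ℝ (HolderEven s) := NormedSpace.ofCore core

end HolderEven

/-- The closed subspace of `X^{1,s}` of functions with vanishing first cosine coefficient, i.e. of
the functions with Fourier series `∑_{n ≥ 2} αₙ cos (n θ)`; it carries the norm of `X^{1,s}`. -/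
def noFirstMode (s : ℝ≥0) : Submodule ℝ (HolderEven s) where
  carrier := {f | ∫ θ in (0 : ℝ)..(2 * Real.pi), f θ * Real.cos θ = 0}
  zero_mem' := by simp
  add_mem' := by
    intro f g hf hg
    simp only [Set.mem_ofPred_eq] at hf hg
    simp only [Set.mem_ofPred_eq, map_add, Pi.add_apply, add_mul]
    have h (u : HolderEven s) : IntervalIntegrable (fun θ => u θ * Real.cos θ)
        MeasureTheory.volume 0 (2 * Real.pi) :=
      (u.differentiable.continuous.mul Real.continuous_cos).intervalIntegrable _ _
    rw [intervalIntegral.integral_add (h f) (h g), hf, hg, add_zero]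
  smul_mem' := by
    intro c f hf
    simp only [Set.mem_ofPred_eq] at hf
    simp only [Set.mem_ofPred_eq, map_smul, Pi.smul_apply, smul_eq_mul, mul_assoc]
    rw [intervalIntegral.integral_const_mul, hf, mul_zero]

/-! ### The contour functional -/

/-- `R(θ) = √(1 + 2 ε q r(θ))`. -/
def radius (ε q : ℝ) (r : ℝ → ℝ) (θ : ℝ) : ℝ := Real.sqrt (1 + 2 * ε * q * r θ)

/-- The boundary point `γ₀(θ) = R(θ) e^{iθ}`. -/
def boundary (ε q : ℝ) (r : ℝ → ℝ) (θ : ℝ) : ℂ :=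
  (radius ε q r θ : ℂ) * Complex.exp (θ * Complex.I)

/-- The star-shaped domain `O` enclosed by the curve `θ ↦ R(θ) e^{iθ}`. -/
def patch (ε q : ℝ) (r : ℝ → ℝ) : Set ℂ := {z | ‖z‖ < radius ε q r z.arg}

/-- The integrand `ζ ↦ log |R(θ) e^{iθ} - ζ|`. -/
def logKernel (ε q : ℝ) (r : ℝ → ℝ) (θ : ℝ) (ζ : ℂ) : ℝ :=
  Real.log ‖boundary ε q r θ - ζ‖

/-- The integrand `ζ ↦ log |1 - (ε R(θ) e^{-iθ} + q) (ε ζ + q)|`. -/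
def imageKernel (ε q : ℝ) (r : ℝ → ℝ) (θ : ℝ) (ζ : ℂ) : ℝ :=
  Real.log ‖1 - ((ε : ℂ) * (starRingEnd ℂ) (boundary ε q r θ) + q) * ((ε : ℂ) * ζ + q)‖

/-- The function of `θ` whose derivative is the contour functional, for `ε q ≠ 0`:
`ε² Ω r(θ) + Ω R(θ) cos θ - (2π ε q)⁻¹ ∫_O log |R(θ) e^{iθ} - ζ| dA(ζ)
  + (2π ε q)⁻¹ ∫_O log |1 - (ε R(θ) e^{-iθ} + q) (ε ζ + q)| dA(ζ)`. -/
def contourPotential (ε q Ω : ℝ) (r : ℝ → ℝ) (θ : ℝ) : ℝ :=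
  ε ^ 2 * Ω * r θ + Ω * (radius ε q r θ * Real.cos θ)
    - 1 / (2 * Real.pi * (ε * q)) * (∫ ζ in patch ε q r, logKernel ε q r θ ζ)
    + 1 / (2 * Real.pi * (ε * q)) * (∫ ζ in patch ε q r, imageKernel ε q r θ ζ)

end RotatingPatch

end

noncomputable section

namespace RotatingPatch

/-! ### The Banach algebra of Hölder kernels on the circle times an arc. -/

section

open scoped BoundedContinuousFunction

/-! Put ρ = 2εq r, so that the patch is the star-shaped domain bounded by γ = √(1 + ρ) e^{iθ}.
Green's formula turns the θ-derivatives of the two area integrals into contour integrals: the first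
is `selfMap` at ρ, the second is ε times `imageMap` at (ε, q, ρ) (`IsGood.hasDerivAt_integral_log`,
`IsGood.hasDerivAt_integral_image`). What remains is analysis of these two operators on Hölder
spaces.

Their smoothness comes from a Banach algebra. Writing φ = θ - α, the integrands are functions of (θ,
α) that are C^s in θ uniformly in α, and such functions form the commutative Banach algebra `Kernel
s`. The boundary data (values, derivatives, chord quotients) are bounded linear functions of ρ with
values in this algebra, and roots, logarithms and inverses are smooth operations near the values
taken at the disc. The singularity splits off: |γ(θ) - γ(θ - α)| is the chord 2 sin(α/2) of the unit
circle times the square root of a kernel close to 1, so its logarithm is a fixed integrable weight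
plus a smooth term. The angle α runs over an open arc, so nothing has to be extended to α = 0. The
symmetry k(-θ)(2π - α) = conj k(θ)(α) carries the parity: even data are real kernels, odd data are
multiplied by i, and integrating the imaginary part against a symmetric weight gives an odd function
of θ.

The singular factor 1/(εq) is harmless because, by symmetry, `selfMap` vanishes at the disc and
`imageMap` vanishes at q = 0, where ρ = 0. Hadamard's lemma (`exists_eq_smul_of_eq_zero`) divides by
εq and by q at the cost of one derivative, which is why the operators are kept of class C² and the
functional is C¹. At ε = 0 the result is explicit (`exists_contourMap`): G(0, q, Ω, r) = (Ω₀(q) - Ω)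
sin θ - ½ Λ r', with Λ sin nθ = (1 - 1/n) sin nθ. This is affine in (Ω, r), so the trivial solutions
and the linearization can be read off. Λ annihilates exactly sin θ and its range misses sin θ; that
direction is supplied by Ω. On the modes n ≥ 2 the inverse of Λ has multiplier 1 + 1/(n - 1): it is
the identity plus convolution with an explicit integrable function (`resolventWeight`), hence
bounded on C^s with no multiplier theorem.

The branch comes from the implicit function theorem at each point (0, q). Compactness of [-1 + δ, 1
- δ] makes the interval of ε uniform in q, and uniform local uniqueness glues the local branches
(`exists_branch`). -/

theorem holderWith_of_norm_sub_le {E : Type*} [NormedAddCommGroup E] {s C : ℝ≥0} {f : ℝ → E}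
    (h : ∀ x y, ‖f x - f y‖ ≤ C * |x - y| ^ (s : ℝ)) : HolderWith C s f := by
  intro x y
  rw [edist_nndist, edist_nndist, ← ENNReal.coe_rpow_of_nonneg _ (NNReal.coe_nonneg s), ← ENNReal.coe_mul,
    ENNReal.coe_le_coe, ← NNReal.coe_le_coe]
  push_cast
  simpa [dist_eq_norm] using h x y

theorem norm_sub_le_nnHolderNorm {E : Type*} [NormedAddCommGroup E] {s : ℝ≥0} {f : ℝ → E}
    (h : MemHolder s f) (x y : ℝ) : ‖f x - f y‖ ≤ nnHolderNorm s f * |x - y| ^ (s : ℝ) := by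
  simpa [dist_eq_norm] using h.holderWith.dist_le x y

/-- The open arc `(0, 2π)`, a circle without a point. -/
abbrev Arc : Type := Set.Ioo (0 : ℝ) (2 * Real.pi)

/-- The reflection `α ↦ 2π - α` of the arc. -/
def Arc.reflect (α : Arc) : Arc :=
  ⟨2 * Real.pi - α, by have := α.2.2; linarith, by have := α.2.1; linarith⟩

@[simp] theorem Arc.coe_reflect (α : Arc) : (α.reflect : ℝ) = 2 * Real.pi - α := rfl

/-- The midpoint of the arc. -/
def Arc.mid : Arc := ⟨Real.pi, Real.pi_pos, by linarith [Real.pi_pos]⟩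

@[simp] theorem Arc.reflect_mid : Arc.mid.reflect = Arc.mid := by
  apply Subtype.ext
  simp [Arc.mid]
  ring

theorem bddAbove_norm_of_periodic {E : Type*} [NormedAddCommGroup E] {s : ℝ≥0} {f : ℝ → E}
    (hp : Function.Periodic f (2 * Real.pi)) (hf : MemHolder s f) :
    BddAbove (Set.range fun θ : ℝ => ‖f θ‖) := by
  obtain ⟨C, hC⟩ := hf
  refine ⟨‖f 0‖ + C * (2 * Real.pi) ^ (s : ℝ), ?_⟩
  rintro _ ⟨θ, rfl⟩
  obtain ⟨y, hy, hfy⟩ := hp.exists_mem_Ico₀ (by positivity) θ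
  have h1 := hC.dist_le y 0
  have h2 : dist y 0 ^ (s : ℝ) ≤ (2 * Real.pi) ^ (s : ℝ) := by
    apply Real.rpow_le_rpow dist_nonneg _ s.2
    rw [Real.dist_eq, sub_zero, abs_of_nonneg hy.1]
    exact hy.2.le
  have h3 : (C : ℝ) * dist y 0 ^ (s : ℝ) ≤ C * (2 * Real.pi) ^ (s : ℝ) :=
    mul_le_mul_of_nonneg_left h2 C.2
  rw [dist_eq_norm] at h1
  have h4 : ‖f θ‖ ≤ ‖f y - f 0‖ + ‖f 0‖ := by
    rw [hfy]; simpa using norm_add_le (f y - f 0) (f 0)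
  linarith

theorem holder_mul {A : Type*} [NormedRing A] {s : ℝ≥0} {f g : ℝ → A} {a b c d : ℝ}
    (ha : ∀ x, ‖f x‖ ≤ a) (hb : ∀ x y, ‖f x - f y‖ ≤ b * |x - y| ^ (s : ℝ))
    (hc : ∀ x, ‖g x‖ ≤ c) (hd : ∀ x y, ‖g x - g y‖ ≤ d * |x - y| ^ (s : ℝ)) (x y : ℝ) :
    ‖f x * g x - f y * g y‖ ≤ (a * d + b * c) * |x - y| ^ (s : ℝ) := by
  have h1 : f x * g x - f y * g y = f x * (g x - g y) + (f x - f y) * g y := by noncomm_ring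
  have h2 : 0 ≤ |x - y| ^ (s : ℝ) := by positivity
  calc _ ≤ ‖f x‖ * ‖g x - g y‖ + ‖f x - f y‖ * ‖g y‖ := by
        rw [h1]; exact (norm_add_le _ _).trans (add_le_add (norm_mul_le _ _) (norm_mul_le _ _))
    _ ≤ a * (d * |x - y| ^ (s : ℝ)) + b * |x - y| ^ (s : ℝ) * c :=
        add_le_add (mul_le_mul (ha x) (hd x y) (norm_nonneg _) ((norm_nonneg _).trans (ha x)))
          (mul_le_mul (hb x y) (hc y) (norm_nonneg _) ((norm_nonneg _).trans (hb x y)))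
    _ = _ := by ring

/-- A global Hölder bound alone does not bound a function; periodicity supplies the uniform bounds
needed in the product estimate. -/
theorem MemHolder.mul_of_periodic {A : Type*} [NormedRing A] {s : ℝ≥0} {f g : ℝ → A}
    (hpf : Function.Periodic f (2 * Real.pi)) (hf : MemHolder s f)
    (hpg : Function.Periodic g (2 * Real.pi)) (hg : MemHolder s g) : MemHolder s (f * g) := by
  obtain ⟨a, ha⟩ := bddAbove_norm_of_periodic hpf hf
  obtain ⟨c, hc⟩ := bddAbove_norm_of_periodic hpg hg
  have h := holder_mul (fun x => ha ⟨x, rfl⟩) (norm_sub_le_nnHolderNorm hf) (fun x => hc ⟨x, rfl⟩)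
    (norm_sub_le_nnHolderNorm hg)
  have ha0 : 0 ≤ a := (norm_nonneg _).trans (ha ⟨0, rfl⟩)
  have hc0 : 0 ≤ c := (norm_nonneg _).trans (hc ⟨0, rfl⟩)
  exact ⟨⟨a * nnHolderNorm s g + nnHolderNorm s f * c, by positivity⟩,
    holderWith_of_norm_sub_le h⟩

/-- The algebra of `2π`-periodic kernels `k θ α` of class `C^s` in `θ`, uniformly in `α`, and
continuous in `α`, that satisfy `k (-θ) (2π - α) = conj (k θ α)`. -/
def kernelSubalgebra (s : ℝ≥0) : Subalgebra ℝ (ℝ → (Arc →ᵇ ℂ)) where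
  carrier := {f | Function.Periodic f (2 * Real.pi) ∧ MemHolder s f ∧
    ∀ θ α, f (-θ) (Arc.reflect α) = (starRingEnd ℂ) (f θ α)}
  mul_mem' := by
    rintro f g ⟨f1, f2, f3⟩ ⟨g1, g2, g3⟩
    exact ⟨f1.mul g1, MemHolder.mul_of_periodic f1 f2 g1 g2, fun θ α => by simp [f3, g3]⟩
  add_mem' := by
    rintro f g ⟨f1, f2, f3⟩ ⟨g1, g2, g3⟩
    exact ⟨f1.add g1, f2.add g2, fun θ α => by simp [f3, g3]⟩
  algebraMap_mem' := by
    intro r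
    refine ⟨fun _ => rfl, ?_, fun θ α => ?_⟩
    · exact memHolder_const (c := algebraMap ℝ (Arc →ᵇ ℂ) r)
    · simp only [Pi.algebraMap_apply]
      exact (Complex.conj_ofReal r).symm

/-- The Banach algebra of `2π`-periodic kernels of class `C^s` with the symmetry
`k (-θ) (2π - α) = conj (k θ α)`. -/
def Kernel (s : ℝ≥0) : Type := ↥(kernelSubalgebra s)

namespace Kernel

variable {s : ℝ≥0}

instance : CommRing (Kernel s) := inferInstanceAs (CommRing ↥(kernelSubalgebra s))
instance : Algebra ℝ (Kernel s) := inferInstanceAs (Algebra ℝ ↥(kernelSubalgebra s))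

/-- The inclusion of the kernels into the functions. -/
def toFun : Kernel s →ₐ[ℝ] (ℝ → (Arc →ᵇ ℂ)) := (kernelSubalgebra s).val

instance : CoeFun (Kernel s) (fun _ => ℝ → (Arc →ᵇ ℂ)) := ⟨fun f => toFun f⟩

theorem toFun_mem (f : Kernel s) : toFun f ∈ kernelSubalgebra s :=
  Subtype.property (p := (· ∈ kernelSubalgebra s)) f

theorem periodic (f : Kernel s) : Function.Periodic (f : ℝ → Arc →ᵇ ℂ) (2 * Real.pi) :=
  (toFun_mem f).1

theorem memHolder (f : Kernel s) : MemHolder s (f : ℝ → Arc →ᵇ ℂ) := (toFun_mem f).2.1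

theorem symm_apply (f : Kernel s) (θ : ℝ) (α : Arc) :
    f (-θ) α.reflect = (starRingEnd ℂ) (f θ α) := (toFun_mem f).2.2 θ α

theorem toFun_injective : Function.Injective (toFun : Kernel s →ₐ[ℝ] (ℝ → (Arc →ᵇ ℂ))) :=
  Subtype.val_injective

theorem ext {f g : Kernel s} (h : ∀ θ α, f θ α = g θ α) : f = g :=
  toFun_injective (funext fun θ => BoundedContinuousFunction.ext (h θ))

/-- The kernel with a given function. -/
def mk (f : ℝ → (Arc →ᵇ ℂ)) (h : f ∈ kernelSubalgebra s) : Kernel s := ⟨f, h⟩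

@[simp] theorem toFun_mk (f : ℝ → (Arc →ᵇ ℂ)) (h : f ∈ kernelSubalgebra s) :
    toFun (mk f h) = f := rfl

/-- The uniform norm of a kernel. -/
def supNorm (f : Kernel s) : ℝ := ⨆ θ : ℝ, ‖f θ‖

theorem norm_apply_le_supNorm (f : Kernel s) (θ : ℝ) : ‖f θ‖ ≤ supNorm f :=
  le_ciSup (bddAbove_norm_of_periodic f.periodic f.memHolder) θ

theorem supNorm_nonneg (f : Kernel s) : 0 ≤ supNorm f :=
  (norm_nonneg _).trans (norm_apply_le_supNorm f 0)

instance : Norm (Kernel s) := ⟨fun f => supNorm f + nnHolderNorm s f⟩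

theorem norm_def (f : Kernel s) : ‖f‖ = supNorm f + nnHolderNorm s f := rfl

theorem norm_le_add {f : Kernel s} {a b : ℝ} (ha : ∀ θ, ‖f θ‖ ≤ a)
    (hb : ∀ x y, ‖f x - f y‖ ≤ b * |x - y| ^ (s : ℝ)) : ‖f‖ ≤ a + b := by
  have hb0 : 0 ≤ b := by
    have := (norm_nonneg _).trans (hb 1 0)
    simpa using this
  rw [norm_def]
  refine add_le_add (ciSup_le ha) ?_
  have := (holderWith_of_norm_sub_le (C := ⟨b, hb0⟩) hb).nnholderNorm_le
  exact_mod_cast this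

theorem core : NormedSpace.Core ℝ (Kernel s) where
  norm_nonneg f := add_nonneg (supNorm_nonneg _) (NNReal.coe_nonneg _)
  norm_smul c f := by
    rw [norm_def, norm_def, map_smul, f.memHolder.nnHolderNorm_smul c, mul_add, supNorm, supNorm,
      Real.mul_iSup_of_nonneg (norm_nonneg c)]
    simp [norm_smul]
  norm_triangle f g := by
    refine (norm_le_add (a := supNorm f + supNorm g) (b := nnHolderNorm s f + nnHolderNorm s g)
      (fun θ => ?_) fun x y => ?_).trans (by rw [norm_def, norm_def]; linarith)
    · simp only [map_add, Pi.add_apply]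
      exact (norm_add_le _ _).trans
        (add_le_add (norm_apply_le_supNorm f θ) (norm_apply_le_supNorm g θ))
    · simp only [map_add, Pi.add_apply, add_mul, add_sub_add_comm]
      exact (norm_add_le _ _).trans (add_le_add (norm_sub_le_nnHolderNorm f.memHolder x y)
        (norm_sub_le_nnHolderNorm g.memHolder x y))
  norm_eq_zero_iff f := by
    refine ⟨fun h => ?_, fun h => ?_⟩
    · refine toFun_injective (funext fun θ => ?_)
      have h1 := norm_apply_le_supNorm f θ
      have h2 : (0 : ℝ) ≤ nnHolderNorm s f := NNReal.coe_nonneg _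
      rw [norm_def] at h
      have h3 : ‖f θ‖ = 0 := le_antisymm (by linarith) (norm_nonneg _)
      simpa using h3
    · subst h
      simp [norm_def, supNorm]

instance : NormedAddCommGroup (Kernel s) := NormedAddCommGroup.ofCore core

/-- Expanding the product of the two norms gives four nonnegative terms. The sup bound and the two
terms of the Hölder product estimate use three of them; the product of the seminorms is slack. -/
theorem norm_mul_le' (f g : Kernel s) : ‖f * g‖ ≤ ‖f‖ * ‖g‖ := by
  have h := holder_mul (norm_apply_le_supNorm f) (norm_sub_le_nnHolderNorm f.memHolder)
    (norm_apply_le_supNorm g) (norm_sub_le_nnHolderNorm g.memHolder)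
  refine (norm_le_add (a := supNorm f * supNorm g)
    (b := supNorm f * nnHolderNorm s g + nnHolderNorm s f * supNorm g)
    (fun θ => ?_) fun x y => ?_).trans ?_
  · simp only [map_mul, Pi.mul_apply]
    exact (norm_mul_le _ _).trans (mul_le_mul (norm_apply_le_supNorm f θ)
      (norm_apply_le_supNorm g θ) (norm_nonneg _) (supNorm_nonneg f))
  · simpa only [map_mul, Pi.mul_apply] using h x y
  · rw [norm_def, norm_def]
    nlinarith [mul_nonneg (NNReal.coe_nonneg (nnHolderNorm s f)) (NNReal.coe_nonneg (nnHolderNorm s g))]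

instance : NormedCommRing (Kernel s) where
  __ := (inferInstance : CommRing (Kernel s))
  __ := (inferInstance : NormedAddCommGroup (Kernel s))
  norm_mul_le := norm_mul_le'

instance : NormedAlgebra ℝ (Kernel s) where
  norm_smul_le c f := (core.norm_smul c f).le

theorem norm_apply_le (f : Kernel s) (θ : ℝ) : ‖f θ‖ ≤ ‖f‖ := by
  have h2 : (0 : ℝ) ≤ nnHolderNorm s f := NNReal.coe_nonneg _
  have := norm_apply_le_supNorm f θ
  rw [norm_def]
  linarith

theorem norm_sub_apply_le (f : Kernel s) (x y : ℝ) :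
    ‖f x - f y‖ ≤ ‖f‖ * |x - y| ^ (s : ℝ) := by
  have h2 := supNorm_nonneg f
  refine (norm_sub_le_nnHolderNorm f.memHolder x y).trans ?_
  rw [norm_def]
  gcongr
  linarith

/-- For each θ the values form a Cauchy sequence of bounded continuous functions on the arc.
Periodicity, symmetry and the sup and Hölder bounds all pass to pointwise limits, and the same
passage to the limit in m of the bounds for `u n - u m` gives convergence in norm. -/
instance : CompleteSpace (Kernel s) := by
  refine Metric.complete_of_cauchySeq_tendsto fun u hu => ?_
  have hc : ∀ θ, CauchySeq fun n => (u n) θ := by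
    intro θ
    rw [Metric.cauchySeq_iff'] at hu ⊢
    intro ε hε
    obtain ⟨N, hN⟩ := hu ε hε
    refine ⟨N, fun n hn => ?_⟩
    have h := hN n hn
    rw [dist_eq_norm] at h ⊢
    have h1 := norm_apply_le (u n - u N) θ
    simp only [map_sub, Pi.sub_apply] at h1
    linarith
  choose f hf using fun θ => cauchySeq_tendsto_of_complete (hc θ)
  obtain ⟨C, hC⟩ := hu.norm_bddAbove
  have hC0 : 0 ≤ C := (norm_nonneg _).trans (hC ⟨0, rfl⟩)
  have hmem : f ∈ kernelSubalgebra s := by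
    refine ⟨fun θ => ?_, ⟨⟨C, hC0⟩, holderWith_of_norm_sub_le fun x y => ?_⟩, fun θ α => ?_⟩
    · refine tendsto_nhds_unique (hf _) ?_
      simpa only [(u _).periodic θ] using hf θ
    · refine le_of_tendsto ((hf x).sub (hf y)).norm (Filter.Eventually.of_forall fun n => ?_)
      refine (norm_sub_apply_le (u n) x y).trans ?_
      exact mul_le_mul_of_nonneg_right (hC ⟨n, rfl⟩) (by positivity)
    · have he : ∀ (α : Arc) θ, Filter.Tendsto (fun n => (u n) θ α) Filter.atTop (nhds (f θ α)) :=
        fun α θ => ((BoundedContinuousFunction.lipschitz_eval_const α).continuous.tendsto _).comp (hf θ)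
      refine tendsto_nhds_unique (he α.reflect (-θ)) ?_
      simp only [symm_apply]
      exact (Complex.continuous_conj.tendsto _).comp (he α θ)
  refine ⟨mk f hmem, ?_⟩
  rw [Metric.tendsto_atTop]
  intro ε hε
  rw [Metric.cauchySeq_iff'] at hu
  obtain ⟨N, hN⟩ := Metric.cauchySeq_iff.1 (Metric.cauchySeq_iff'.2 hu) (ε / 4) (by positivity)
  refine ⟨N, fun n hn => ?_⟩
  rw [dist_eq_norm]
  have hb : ∀ m ≥ N, ‖u n - u m‖ ≤ ε / 4 := fun m hm => by
    rw [← dist_eq_norm]; exact (hN n hn m hm).le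
  refine (norm_le_add (a := ε / 4) (b := ε / 4) (fun θ => ?_) fun x y => ?_).trans_lt (by linarith)
  · simp only [map_sub, Pi.sub_apply, toFun_mk]
    refine le_of_tendsto ((tendsto_const_nhds (x := u n θ)).sub (hf θ)).norm ?_
    filter_upwards [Filter.eventually_ge_atTop N] with m hm
    simpa using (norm_apply_le (u n - u m) θ).trans (hb m hm)
  · simp only [map_sub, Pi.sub_apply, toFun_mk]
    refine le_of_tendsto (((tendsto_const_nhds (x := u n x)).sub (hf x)).sub
      ((tendsto_const_nhds (x := u n y)).sub (hf y))).norm ?_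
    filter_upwards [Filter.eventually_ge_atTop N] with m hm
    have := norm_sub_apply_le (u n - u m) x y
    simp only [map_sub, Pi.sub_apply] at this
    exact this.trans (mul_le_mul_of_nonneg_right (hb m hm) (by positivity))

/-- Evaluation of kernels at a point. -/
def eval (θ : ℝ) (α : Arc) : Kernel s →A[ℝ] ℂ where
  toFun f := f θ α
  map_one' := by simp
  map_mul' f g := by simp
  map_zero' := by simp
  map_add' f g := by simp
  commutes' r := by
    simp only [AlgHom.commutes, Pi.algebraMap_apply]
    rfl
  cont := by
    refine AddMonoidHomClass.continuous_of_bound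
      (⟨⟨fun f : Kernel s => f θ α, by simp⟩, by simp⟩ : Kernel s →+ ℂ) 1 fun f => ?_
    rw [one_mul]
    exact ((f θ).norm_coe_le_norm α).trans (norm_apply_le f θ)

@[simp] theorem eval_apply (θ : ℝ) (α : Arc) (f : Kernel s) : eval θ α f = f θ α := rfl

theorem norm_apply_apply_le (f : Kernel s) (θ : ℝ) (α : Arc) : ‖f θ α‖ ≤ ‖f‖ :=
  ((f θ).norm_coe_le_norm α).trans (norm_apply_le f θ)

end Kernel

end

/-! ### Functional calculus in the algebra of kernels, and integration over the arc. -/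

section

open scoped BoundedContinuousFunction Topology
open MeasureTheory

namespace Kernel

variable {s : ℝ≥0}

theorem contDiff_exp {n : WithTop ℕ∞} :
    ContDiff ℝ n (NormedSpace.exp : Kernel s → Kernel s) :=
  contDiff_iff_contDiffAt.2 fun k => (NormedSpace.exp_analytic (𝕂 := ℝ) k).contDiffAt

/-- Evaluation at a point is a continuous algebra homomorphism, so it commutes with the exponential
series. -/
theorem exp_apply (k : Kernel s) (θ : ℝ) (α : Arc) :
    (NormedSpace.exp k) θ α = Complex.exp (k θ α) := by
  let _ := NormedAlgebra.restrictScalars ℚ ℝ (Kernel s)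
  rw [Complex.exp_eq_exp_ℂ]
  exact NormedSpace.map_exp (eval θ α) (eval θ α).cont k

@[simp] theorem one_apply (θ : ℝ) (α : Arc) : (1 : Kernel s) θ α = 1 := by simp

@[simp] theorem mul_apply (f g : Kernel s) (θ : ℝ) (α : Arc) : (f * g) θ α = f θ α * g θ α := by
  simp

@[simp] theorem add_apply (f g : Kernel s) (θ : ℝ) (α : Arc) : (f + g) θ α = f θ α + g θ α := by
  simp

@[simp] theorem sub_apply (f g : Kernel s) (θ : ℝ) (α : Arc) : (f - g) θ α = f θ α - g θ α := by
  simp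

@[simp] theorem neg_apply (f : Kernel s) (θ : ℝ) (α : Arc) : (-f) θ α = -f θ α := by
  simp

@[simp] theorem smul_apply (c : ℝ) (f : Kernel s) (θ : ℝ) (α : Arc) : (c • f) θ α = c * f θ α := by
  simp

/-- The Banach algebra of kernels has a smooth logarithm near `1`, which is computed pointwise. -/
theorem exists_log (s : ℝ≥0) (n : WithTop ℕ∞) : ∃ L : Kernel s → Kernel s, ContDiffAt ℝ n L 1 ∧
    ∀ᶠ k in 𝓝 (1 : Kernel s), ∀ θ α, L k θ α = Complex.log (k θ α) := by
  have hd : HasStrictFDerivAt (NormedSpace.exp : Kernel s → Kernel s)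
      ((ContinuousLinearEquiv.refl ℝ (Kernel s) : Kernel s ≃L[ℝ] Kernel s) :
        Kernel s →L[ℝ] Kernel s) 0 := hasStrictFDerivAt_exp_zero
  -- The logarithm is the local inverse of the exponential at 0, where the derivative is the
  -- identity. The inverse function theorem needs order at least one, hence the maximum.
  have hc : ContDiffAt ℝ (max n 1) (NormedSpace.exp : Kernel s → Kernel s) 0 :=
    contDiff_exp.contDiffAt
  have hn : max n 1 ≠ 0 := by
    intro h
    have : (1 : WithTop ℕ∞) ≤ 0 := h ▸ le_max_right n 1
    exact absurd this (by simp)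
  have h0 : (NormedSpace.exp (0 : Kernel s)) = 1 := NormedSpace.exp_zero
  have hcd := hc.to_localInverse hd.hasFDerivAt hn
  rw [h0] at hcd
  refine ⟨hc.localInverse hd.hasFDerivAt hn, hcd.of_le (le_max_left _ _), ?_⟩
  have h1 := hd.eventually_right_inverse
  rw [h0] at h1
  -- A logarithm of norm less than 1 has values with imaginary part in (-π, π), so pointwise it is
  -- the principal branch.
  have h2 : ∀ᶠ k in 𝓝 (1 : Kernel s), ‖hc.localInverse hd.hasFDerivAt hn k‖ < 1 := by
    have := hcd.continuousAt.norm
    refine this.eventually_lt_const ?_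
    have h3 := hc.localInverse_apply_image hd.hasFDerivAt hn
    rw [h0] at h3
    simp [h3]
  filter_upwards [h1, h2] with k hk1 hk2 θ α
  set l := hc.localInverse hd.hasFDerivAt hn k
  have h4 : NormedSpace.exp l = k := hk1
  have h5 : ‖l θ α‖ < 1 := (norm_apply_apply_le l θ α).trans_lt hk2
  have h6 := abs_lt.1 ((Complex.abs_im_le_norm _).trans_lt h5)
  rw [← h4, exp_apply, Complex.log_exp]
  · linarith [Real.pi_gt_three]
  · linarith [Real.pi_gt_three]

theorem inverse_apply {k : Kernel s} (hk : IsUnit k) (θ : ℝ) (α : Arc) :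
    (Ring.inverse k) θ α = (k θ α)⁻¹ := by
  refine eq_inv_of_mul_eq_one_left ?_
  rw [← mul_apply, Ring.inverse_mul_cancel k hk, one_apply]

end Kernel

namespace HolderOdd

variable {s : ℝ≥0}

/-- The element of `HolderOdd s` with a given function. -/
def mk (f : ℝ → ℝ) (h : f ∈ holderOddSubmodule s) : HolderOdd s :=
  (⟨f, h⟩ : ↥(holderOddSubmodule s))

@[simp] theorem toFun_mk (f : ℝ → ℝ) (h : f ∈ holderOddSubmodule s) : toFun (mk f h) = f := rfl

theorem ext {f g : HolderOdd s} (h : ∀ θ, f θ = g θ) : f = g := toFun_injective (funext h)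

theorem odd (f : HolderOdd s) (θ : ℝ) : f (-θ) = -f θ := (toFun_mem f).2 θ

theorem periodic (f : HolderOdd s) : Function.Periodic (f : ℝ → ℝ) (2 * Real.pi) := (toFun_mem f).1.1

theorem memHolder (f : HolderOdd s) : MemHolder s (f : ℝ → ℝ) := (toFun_mem f).1.2

theorem norm_le_add {f : HolderOdd s} {a b : ℝ} (ha : ∀ θ, |f θ| ≤ a)
    (hb : ∀ x y, |f x - f y| ≤ b * |x - y| ^ (s : ℝ)) : ‖f‖ ≤ a + b := by
  have hb0 : 0 ≤ b := by
    have := (abs_nonneg _).trans (hb 1 0)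
    simpa using this
  rw [norm_def]
  refine add_le_add (ciSup_le ha) ?_
  have := (holderWith_of_norm_sub_le (f := toFun f) (C := ⟨b, hb0⟩) hb).nnholderNorm_le
  exact_mod_cast this

theorem abs_apply_le (f : HolderOdd s) (θ : ℝ) : |f θ| ≤ ‖f‖ := by
  have h1 : |f θ| ≤ supNorm f := le_ciSup (toFun_mem f).1.bddAbove θ
  have h2 : (0 : ℝ) ≤ nnHolderNorm s f := NNReal.coe_nonneg _
  rw [norm_def, holderNorm]
  linarith

theorem abs_sub_apply_le (f : HolderOdd s) (x y : ℝ) :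
    |f x - f y| ≤ ‖f‖ * |x - y| ^ (s : ℝ) := by
  refine (norm_sub_le_nnHolderNorm f.memHolder x y).trans ?_
  rw [norm_def, holderNorm]
  gcongr
  linarith [supNorm_nonneg f]

/-- Evaluation at a point. -/
def eval (θ : ℝ) : HolderOdd s →L[ℝ] ℝ :=
  LinearMap.mkContinuous ⟨⟨fun f => f θ, fun f g => by simp⟩, fun c f => by simp⟩ 1
    fun f => by simpa using abs_apply_le f θ

@[simp] theorem eval_apply (θ : ℝ) (f : HolderOdd s) : eval θ f = f θ := rfl

end HolderOdd

/-- A functional on the functions on the arc that changes sign under the symmetry of `Kernel`. -/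
def IsOddFunctional (J : (Arc →ᵇ ℂ) →L[ℝ] ℝ) : Prop :=
  ∀ b b' : Arc →ᵇ ℂ, (∀ α : Arc, b' α.reflect = (starRingEnd ℂ) (b α)) → J b' = -J b

namespace Kernel

variable {s : ℝ≥0}

/-- Applying an odd functional in the variable `α` of a kernel. -/
def push (J : (Arc →ᵇ ℂ) →L[ℝ] ℝ) (hJ : IsOddFunctional J) : Kernel s →L[ℝ] HolderOdd s :=
  have hbound : ∀ (k : Kernel s) (x y : ℝ), ‖J (k x) - J (k y)‖ ≤
      ‖J‖ * ‖k‖ * |x - y| ^ (s : ℝ) := fun k x y => by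
    rw [← map_sub, mul_assoc]
    exact (J.le_opNorm _).trans
      (mul_le_mul_of_nonneg_left (norm_sub_apply_le k x y) (norm_nonneg _))
  LinearMap.mkContinuous
    { toFun := fun k => HolderOdd.mk (fun θ => J (k θ))
        ⟨⟨fun θ => by simp only [k.periodic θ], ⟨⟨‖J‖ * ‖k‖, by positivity⟩,
          holderWith_of_norm_sub_le (hbound k)⟩⟩, fun θ => hJ _ _ (k.symm_apply θ)⟩
      map_add' := fun k l => HolderOdd.ext fun θ => by simp; rfl
      map_smul' := fun c k => HolderOdd.ext fun θ => by simp; exact Or.inl rfl } (‖J‖ + ‖J‖) fun k => by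
    rw [add_mul]
    refine HolderOdd.norm_le_add (fun θ => ?_) (hbound k)
    exact (J.le_opNorm _).trans
      (mul_le_mul_of_nonneg_left (norm_apply_le k θ) (norm_nonneg _))

@[simp] theorem push_apply (J : (Arc →ᵇ ℂ) →L[ℝ] ℝ) (hJ : IsOddFunctional J) (k : Kernel s)
    (θ : ℝ) : push J hJ k θ = J (k θ) := rfl

end Kernel

/-- The imaginary part of the value at the midpoint of the arc. -/
def midIm : (Arc →ᵇ ℂ) →L[ℝ] ℝ :=
  Complex.imCLM.comp (BoundedContinuousFunction.evalCLM ℝ Arc.mid)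

theorem midIm_apply (b : Arc →ᵇ ℂ) : midIm b = (b Arc.mid).im := rfl

/-- The midpoint is fixed by the reflection, so there the symmetry of kernels is plain conjugation.
This functional recovers an odd function f from a kernel i f(θ) that does not depend on α. -/
theorem isOddFunctional_midIm : IsOddFunctional midIm := by
  intro b b' h
  have := h Arc.mid
  rw [Arc.reflect_mid] at this
  rw [midIm_apply, midIm_apply, this, Complex.conj_im]

instance : MeasureSpace Arc := Measure.Subtype.measureSpace

theorem volume_arc : (volume : Measure Arc) = Measure.comap Subtype.val volume := rfl

theorem integral_arc_eq {E : Type*} [NormedAddCommGroup E] [NormedSpace ℝ E] (g : ℝ → E) :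
    ∫ α : Arc, g α = ∫ x in (0 : ℝ)..(2 * Real.pi), g x := by
  rw [volume_arc, integral_subtype_comap measurableSet_Ioo,
    intervalIntegral.integral_of_le (by positivity), integral_Ioc_eq_integral_Ioo]

theorem integral_arc_reflect {E : Type*} [NormedAddCommGroup E] [NormedSpace ℝ E] (F : Arc → E) :
    ∫ α : Arc, F α.reflect = ∫ α : Arc, F α := by
  classical
  set f : ℝ → E := fun x => if h : x ∈ Set.Ioo 0 (2 * Real.pi) then F ⟨x, h⟩ else 0 with hf
  have h1 : ∀ α : Arc, F α = f α := fun α => by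
    rw [hf]
    simp only [dif_pos α.2]
  simp only [h1, Arc.coe_reflect]
  rw [integral_arc_eq f, integral_arc_eq fun x => f (2 * Real.pi - x), intervalIntegral.integral_comp_sub_left]
  simp

theorem integrable_mul_im {w : Arc → ℝ} (hw : Integrable w) (b : Arc →ᵇ ℂ) :
    Integrable fun α : Arc => w α * (b α).im := by
  refine hw.mul_bdd (c := ‖b‖) ?_ (Filter.Eventually.of_forall fun α => ?_)
  · exact (Complex.continuous_im.comp b.continuous).aestronglyMeasurable
  · exact (Complex.abs_im_le_norm _).trans (b.norm_coe_le_norm α)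

/-- The functional `b ↦ ∫ w Im b`. -/
def integralIm (w : Arc → ℝ) (hw : Integrable w) : (Arc →ᵇ ℂ) →L[ℝ] ℝ :=
  LinearMap.mkContinuous
    { toFun := fun b => ∫ α : Arc, w α * (b α).im
      map_add' := fun b c => by
        rw [← integral_add (integrable_mul_im hw b) (integrable_mul_im hw c)]
        simp [mul_add]
      map_smul' := fun c b => by
        rw [RingHom.id_apply, smul_eq_mul, ← integral_const_mul]
        refine integral_congr_ae (Filter.Eventually.of_forall fun α => ?_)
        simp
        ring } (∫ α : Arc, |w α|) fun b => by
    refine (norm_integral_le_integral_norm _).trans ?_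
    rw [← integral_mul_const]
    refine integral_mono (integrable_mul_im hw b).norm (hw.abs.mul_const _) fun α => ?_
    simp only [norm_mul, Real.norm_eq_abs]
    gcongr
    exact (Complex.abs_im_le_norm _).trans (b.norm_coe_le_norm α)

theorem integralIm_apply (w : Arc → ℝ) (hw : Integrable w) (b : Arc →ᵇ ℂ) :
    integralIm w hw b = ∫ α : Arc, w α * (b α).im := rfl

/-- Substitute α ↦ 2π - α: the weight is unchanged and the imaginary part changes sign. -/
theorem isOddFunctional_integralIm {w : Arc → ℝ} (hw : Integrable w)
    (hsymm : ∀ α : Arc, w α.reflect = w α) : IsOddFunctional (integralIm w hw) := by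
  intro b b' h
  rw [integralIm_apply, integralIm_apply, ← integral_arc_reflect, ← integral_neg]
  refine integral_congr_ae (Filter.Eventually.of_forall fun α => ?_)
  simp only [h, hsymm, Complex.conj_im]
  ring

/-- The kernel `i f(θ)` of an odd function `f`. -/
def HolderOdd.toKernel {s : ℝ≥0} (f : HolderOdd s) : Kernel s :=
  have hbound : ∀ x y : ℝ, ‖BoundedContinuousFunction.const Arc (Complex.I * f x) -
      BoundedContinuousFunction.const Arc (Complex.I * f y)‖ ≤ ‖f‖ * |x - y| ^ (s : ℝ) := by
    intro x y
    rw [BoundedContinuousFunction.norm_le (by positivity)]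
    intro α
    rw [BoundedContinuousFunction.sub_apply, BoundedContinuousFunction.const_apply,
      BoundedContinuousFunction.const_apply, ← mul_sub, ← Complex.ofReal_sub, norm_mul, Complex.norm_I, one_mul, Complex.norm_real]
    exact f.abs_sub_apply_le x y
  Kernel.mk (fun θ => BoundedContinuousFunction.const Arc (Complex.I * f θ))
    ⟨fun θ => by simp only [f.periodic θ], ⟨⟨‖f‖, norm_nonneg f⟩, holderWith_of_norm_sub_le hbound⟩,
      fun θ α => by simp [f.odd]⟩

theorem HolderOdd.toKernel_apply {s : ℝ≥0} (f : HolderOdd s) (θ : ℝ) (α : Arc) :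
    f.toKernel θ α = Complex.I * f θ := rfl

theorem HolderOdd.norm_toKernel_le {s : ℝ≥0} (f : HolderOdd s) : ‖f.toKernel‖ ≤ 2 * ‖f‖ := by
  rw [two_mul]
  refine Kernel.norm_le_add (fun θ => ?_) fun x y => ?_
  · rw [BoundedContinuousFunction.norm_le (by positivity)]
    intro α
    rw [toKernel_apply, norm_mul, Complex.norm_I, one_mul, Complex.norm_real]
    exact f.abs_apply_le θ
  · rw [BoundedContinuousFunction.norm_le (by positivity)]
    intro α
    rw [BoundedContinuousFunction.sub_apply, toKernel_apply, toKernel_apply,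
      ← mul_sub, ← Complex.ofReal_sub, norm_mul, Complex.norm_I, one_mul, Complex.norm_real]
    exact f.abs_sub_apply_le x y

/-- The embedding `f ↦ i f` of the odd functions into the kernels. -/
def HolderOdd.kernelCLM (s : ℝ≥0) : HolderOdd s →L[ℝ] Kernel s :=
  LinearMap.mkContinuous
    { toFun := toKernel
      map_add' := fun f g => Kernel.ext fun θ α => by
        rw [Kernel.add_apply, toKernel_apply, toKernel_apply, toKernel_apply]
        simp [mul_add]
      map_smul' := fun c f => Kernel.ext fun θ α => by
        rw [RingHom.id_apply, Kernel.smul_apply, toKernel_apply, toKernel_apply]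
        simp
        ring } 2 norm_toKernel_le

@[simp] theorem HolderOdd.kernelCLM_apply {s : ℝ≥0} (f : HolderOdd s) (θ : ℝ) (α : Arc) :
    HolderOdd.kernelCLM s f θ α = Complex.I * f θ := rfl

/-- The embedding f ↦ i f into the complete algebra of kernels has a continuous left inverse,
evaluation of the imaginary part at the midpoint. A limit taken in the algebra can therefore be
pushed back. -/
instance {s : ℝ≥0} : CompleteSpace (HolderOdd s) := by
  refine Metric.complete_of_cauchySeq_tendsto fun u hu => ?_
  obtain ⟨k, hk⟩ := cauchySeq_tendsto_of_complete
    ((HolderOdd.kernelCLM s).uniformContinuous.comp_cauchySeq hu)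
  refine ⟨Kernel.push midIm isOddFunctional_midIm k, ?_⟩
  have h := ((Kernel.push (s := s) midIm isOddFunctional_midIm).continuous.tendsto k).comp hk
  refine h.congr fun n => HolderOdd.ext fun θ => ?_
  simp [midIm_apply]

end

/-! ### Kernels depending linearly on the boundary perturbation. -/

section

open scoped BoundedContinuousFunction Topology
open MeasureTheory

namespace Kernel

variable {s : ℝ≥0}

/-- A kernel given by a function of two variables with explicit bounds. -/
def ofBound (f : ℝ → Arc → ℂ) (a b : ℝ) (hc : ∀ θ, Continuous (f θ)) (ha : ∀ θ α, ‖f θ α‖ ≤ a)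
    (hb : ∀ x y α, ‖f x α - f y α‖ ≤ b * |x - y| ^ (s : ℝ))
    (hp : ∀ θ α, f (θ + 2 * Real.pi) α = f θ α)
    (hsymm : ∀ θ α, f (-θ) (Arc.reflect α) = (starRingEnd ℂ) (f θ α)) : Kernel s :=
  Kernel.mk (fun θ => BoundedContinuousFunction.ofNormedAddCommGroup (f θ) (hc θ) a (ha θ))
    ⟨fun θ => BoundedContinuousFunction.ext (hp θ),
      ⟨⟨b, by simpa using (norm_nonneg _).trans (hb 1 0 Arc.mid)⟩, holderWith_of_norm_sub_le
        fun x y => (BoundedContinuousFunction.norm_le ((norm_nonneg _).trans (hb x y Arc.mid))).2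
          fun α => hb x y α⟩, hsymm⟩

@[simp] theorem ofBound_apply (f : ℝ → Arc → ℂ) (a b : ℝ) (hc : ∀ θ, Continuous (f θ))
    (ha : ∀ θ α, ‖f θ α‖ ≤ a) (hb : ∀ x y α, ‖f x α - f y α‖ ≤ b * |x - y| ^ (s : ℝ))
    (hp : ∀ θ α, f (θ + 2 * Real.pi) α = f θ α)
    (hsymm : ∀ θ α, f (-θ) (Arc.reflect α) = (starRingEnd ℂ) (f θ α)) (θ : ℝ) (α : Arc) :
    ofBound (s := s) f a b hc ha hb hp hsymm θ α = f θ α := rfl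

theorem norm_le_of_apply {k : Kernel s} {a b : ℝ} (ha : ∀ θ α, ‖k θ α‖ ≤ a)
    (hb : ∀ x y α, ‖k x α - k y α‖ ≤ b * |x - y| ^ (s : ℝ)) : ‖k‖ ≤ a + b :=
  norm_le_add
    (fun θ => (BoundedContinuousFunction.norm_le ((norm_nonneg _).trans (ha 0 Arc.mid))).2 (ha θ))
    fun x y => (BoundedContinuousFunction.norm_le ((norm_nonneg _).trans (hb x y Arc.mid))).2
      (hb x y)

/-- A bounded linear map into the kernels given by a formula. -/
def clmOfBound {X : Type*} [NormedAddCommGroup X] [NormedSpace ℝ X] (T : X → ℝ → Arc → ℂ) (C : ℝ)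
    (hc : ∀ x θ, Continuous (T x θ)) (ha : ∀ x θ α, ‖T x θ α‖ ≤ C * ‖x‖)
    (hb : ∀ u x y α, ‖T u x α - T u y α‖ ≤ C * ‖u‖ * |x - y| ^ (s : ℝ))
    (hp : ∀ x θ α, T x (θ + 2 * Real.pi) α = T x θ α)
    (hsymm : ∀ x θ α, T x (-θ) (Arc.reflect α) = (starRingEnd ℂ) (T x θ α))
    (hadd : ∀ x y θ α, T (x + y) θ α = T x θ α + T y θ α)
    (hsmul : ∀ (c : ℝ) x θ α, T (c • x) θ α = c * T x θ α) : X →L[ℝ] Kernel s :=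
  LinearMap.mkContinuous
    { toFun := fun x => ofBound (T x) _ _ (hc x) (ha x) (hb x) (hp x) (hsymm x)
      map_add' := fun x y => ext fun θ α => by
        rw [add_apply]; exact hadd x y θ α
      map_smul' := fun c x => ext fun θ α => by
        rw [RingHom.id_apply, smul_apply]; exact hsmul c x θ α } (C + C) fun x => by
    rw [add_mul]
    exact norm_le_of_apply (ha x) (hb x)

@[simp] theorem clmOfBound_apply {X : Type*} [NormedAddCommGroup X] [NormedSpace ℝ X]
    (T : X → ℝ → Arc → ℂ) (C : ℝ)
    (hc : ∀ x θ, Continuous (T x θ)) (ha : ∀ x θ α, ‖T x θ α‖ ≤ C * ‖x‖)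
    (hb : ∀ u x y α, ‖T u x α - T u y α‖ ≤ C * ‖u‖ * |x - y| ^ (s : ℝ))
    (hp : ∀ x θ α, T x (θ + 2 * Real.pi) α = T x θ α)
    (hsymm : ∀ x θ α, T x (-θ) (Arc.reflect α) = (starRingEnd ℂ) (T x θ α))
    (hadd : ∀ x y θ α, T (x + y) θ α = T x θ α + T y θ α)
    (hsmul : ∀ (c : ℝ) x θ α, T (c • x) θ α = c * T x θ α) (x : X) (θ : ℝ) (α : Arc) :
    clmOfBound (s := s) T C hc ha hb hp hsymm hadd hsmul x θ α = T x θ α := rfl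

end Kernel

namespace HolderEven

variable {s : ℝ≥0}

theorem periodic (f : HolderEven s) : Function.Periodic (f : ℝ → ℝ) (2 * Real.pi) :=
  (toFun_mem f).1

theorem even (f : HolderEven s) (θ : ℝ) : f (-θ) = f θ := (toFun_mem f).2.1 θ

theorem deriv_periodic (f : HolderEven s) : Function.Periodic (deriv f) (2 * Real.pi) :=
  (isHolder_deriv (toFun_mem f)).1

theorem memHolder_deriv (f : HolderEven s) : MemHolder s (deriv f) := (toFun_mem f).2.2.2.1

theorem deriv_odd (f : HolderEven s) (θ : ℝ) : deriv f (-θ) = -deriv f θ := by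
  have h : (fun x => f (-x)) = f := funext f.even
  have h1 := deriv_comp_neg (f := f) θ
  rw [h] at h1
  linarith

theorem hasDerivAt (f : HolderEven s) (θ : ℝ) : HasDerivAt f (deriv f θ) θ :=
  (differentiable f θ).hasDerivAt

theorem deriv_add (f g : HolderEven s) : deriv (f + g : HolderEven s) = deriv f + deriv g := by
  rw [map_add]
  exact funext fun θ => _root_.deriv_add (differentiable f θ) (differentiable g θ)

theorem deriv_smul (c : ℝ) (f : HolderEven s) : deriv (c • f : HolderEven s) = c • deriv f := by
  rw [map_smul]
  exact funext fun θ => deriv_const_smul c (differentiable f θ)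

theorem abs_apply_le (f : HolderEven s) (θ : ℝ) : |f θ| ≤ ‖f‖ := by
  have h1 : |f θ| ≤ supNorm f := le_ciSup (bddAbove_of_mem (toFun_mem f)) θ
  rw [norm_def]
  linarith [holderNorm_nonneg s (deriv f)]

theorem abs_deriv_le (f : HolderEven s) (θ : ℝ) : |deriv f θ| ≤ ‖f‖ := by
  have h1 : |deriv f θ| ≤ supNorm (deriv f) := le_ciSup (isHolder_deriv (toFun_mem f)).bddAbove θ
  have h2 : (0 : ℝ) ≤ nnHolderNorm s (deriv f) := NNReal.coe_nonneg _
  rw [norm_def, holderNorm]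
  linarith [supNorm_nonneg f]

theorem abs_deriv_sub_le (f : HolderEven s) (x y : ℝ) :
    |deriv f x - deriv f y| ≤ ‖f‖ * |x - y| ^ (s : ℝ) := by
  refine (norm_sub_le_nnHolderNorm f.memHolder_deriv x y).trans ?_
  rw [norm_def, holderNorm]
  gcongr
  linarith [supNorm_nonneg f, supNorm_nonneg (deriv f)]

theorem continuous_deriv (hs0 : 0 < s) (f : HolderEven s) : Continuous (deriv f) :=
  f.memHolder_deriv.holderWith.continuous hs0

theorem abs_sub_le (f : HolderEven s) (x y : ℝ) : |f x - f y| ≤ ‖f‖ * |x - y| :=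
  Convex.norm_image_sub_le_of_norm_deriv_le (fun z _ => differentiable f z)
    (fun z _ => abs_deriv_le f z) convex_univ (Set.mem_univ y) (Set.mem_univ x)

/-- For |x - y| ≤ 1 the Lipschitz bound suffices, because |x - y| ≤ |x - y|^s. For larger distances
the sup norm does, and this is where the factor 2 arises. -/
theorem abs_sub_le_rpow (hs1 : s ≤ 1) (f : HolderEven s) (x y : ℝ) :
    |f x - f y| ≤ 2 * ‖f‖ * |x - y| ^ (s : ℝ) := by
  rcases le_total |x - y| 1 with h | h
  · refine (f.abs_sub_le x y).trans ?_
    have h1 : |x - y| ≤ |x - y| ^ (s : ℝ) := by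
      have := Real.rpow_le_rpow_of_exponent_ge_of_imp (x := |x - y|) (y := 1) (z := s)
        (abs_nonneg _) h (by exact_mod_cast hs1) (by simp)
      simpa using this
    have : ‖f‖ * |x - y| ≤ ‖f‖ * |x - y| ^ (s : ℝ) := by gcongr
    nlinarith [norm_nonneg f, abs_nonneg (x - y)]
  · have h1 : 1 ≤ |x - y| ^ (s : ℝ) := Real.one_le_rpow h s.2
    have h2 : |f x - f y| ≤ 2 * ‖f‖ := by
      refine (abs_sub _ _).trans ?_
      linarith [f.abs_apply_le x, f.abs_apply_le y]
    nlinarith [norm_nonneg f]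

end HolderEven

theorem sin_half_pos (α : Arc) : 0 < Real.sin (α / 2) :=
  Real.sin_pos_of_pos_of_lt_pi (by linarith [α.2.1]) (by linarith [α.2.2])

/-- A periodic function with bounded derivative has chord quotients bounded on the circle. -/
theorem abs_sub_le_mul_sin {g : ℝ → ℝ} {M : ℝ} (hp : Function.Periodic g (2 * Real.pi))
    (hd : Differentiable ℝ g) (hM : ∀ x, |deriv g x| ≤ M) (θ : ℝ) (α : Arc) :
    |g θ - g (θ - α)| ≤ Real.pi * M * Real.sin (α / 2) := by
  have hM0 : 0 ≤ M := (abs_nonneg _).trans (hM 0)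
  have hlip : ∀ x y, |g x - g y| ≤ M * |x - y| := fun x y =>
    Convex.norm_image_sub_le_of_norm_deriv_le (fun z _ => hd z)
      (fun z _ => hM z) convex_univ (Set.mem_univ y) (Set.mem_univ x)
  have hπ := Real.pi_pos
  -- Jordan's inequality sin u ≥ 2u/π on [0, π/2].
  have key : ∀ x, 0 ≤ x → x ≤ Real.pi → x ≤ Real.pi * Real.sin (x / 2) := by
    intro x h0 h1
    have := Real.mul_le_sin (x := x / 2) (by linarith) (by linarith)
    calc x = Real.pi * (2 / Real.pi * (x / 2)) := by field_simp
      _ ≤ _ := by gcongr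
  obtain ⟨α, h0, h1⟩ := α
  simp only
  rcases le_total α Real.pi with h | h
  · have := hlip θ (θ - α)
    rw [sub_sub_cancel, abs_of_pos h0] at this
    nlinarith [key α h0.le h]
  -- For α ≥ π the short way round the circle has length 2π - α, which has the same half-angle sine.
  · have := hlip θ (θ - α + 2 * Real.pi)
    rw [hp (θ - α), show θ - (θ - α + 2 * Real.pi) = -(2 * Real.pi - α) by ring,
      abs_neg, abs_of_pos (show 0 < 2 * Real.pi - α by linarith)] at this
    have h2 := key (2 * Real.pi - α) (by linarith) (by linarith)
    rw [show (2 * Real.pi - α) / 2 = Real.pi - α / 2 by ring, Real.sin_pi_sub] at h2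
    nlinarith

namespace HolderEven

variable {s : ℝ≥0}

/-- The kernel `ρ(θ)`. -/
def valueK (hs1 : s ≤ 1) : HolderEven s →L[ℝ] Kernel s :=
  Kernel.clmOfBound (fun ρ θ _ => (ρ θ : ℂ)) 2 (fun ρ θ => continuous_const)
    (fun ρ θ α => by
      rw [Complex.norm_real, Real.norm_eq_abs]
      linarith [ρ.abs_apply_le θ, norm_nonneg ρ])
    (fun ρ x y α => by
      rw [← Complex.ofReal_sub, Complex.norm_real]
      exact ρ.abs_sub_le_rpow hs1 x y)
    (fun ρ θ α => by simp only [ρ.periodic θ]) (fun ρ θ α => by simp [ρ.even])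
    (fun f g θ α => by simp) (fun c f θ α => by simp)

/-- The kernel `ρ(θ - α)`. -/
def shiftK (hs1 : s ≤ 1) : HolderEven s →L[ℝ] Kernel s :=
  Kernel.clmOfBound (fun ρ θ α => (ρ (θ - α) : ℂ)) 2
    (fun ρ θ => by
      have := (differentiable ρ).continuous
      fun_prop)
    (fun ρ θ α => by
      rw [Complex.norm_real, Real.norm_eq_abs]
      linarith [ρ.abs_apply_le (θ - α), norm_nonneg ρ])
    (fun ρ x y α => by
      rw [← Complex.ofReal_sub, Complex.norm_real]
      simpa using ρ.abs_sub_le_rpow hs1 (x - α) (y - α))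
    (fun ρ θ α => by rw [add_sub_right_comm, ρ.periodic])
    (fun ρ θ α => by
      rw [Arc.coe_reflect, show -θ - (2 * Real.pi - α) = -(θ - α) - 2 * Real.pi by ring,
        ρ.periodic.sub_eq, ρ.even, Complex.conj_ofReal])
    (fun f g θ α => by simp) (fun c f θ α => by simp)

/-- The kernel `i ρ'(θ)`. -/
def derivK : HolderEven s →L[ℝ] Kernel s :=
  Kernel.clmOfBound (fun ρ θ _ => Complex.I * ((deriv ρ θ : ℝ) : ℂ)) 1 (fun ρ θ => continuous_const)
    (fun ρ θ α => by
      rw [norm_mul, Complex.norm_I, Complex.norm_real, Real.norm_eq_abs, one_mul, one_mul]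
      exact ρ.abs_deriv_le θ)
    (fun ρ x y α => by
      rw [← mul_sub, ← Complex.ofReal_sub, norm_mul, Complex.norm_I, Complex.norm_real, one_mul,
        one_mul]
      exact ρ.abs_deriv_sub_le x y)
    (fun ρ θ α => by simp only [ρ.deriv_periodic θ]) (fun ρ θ α => by simp [ρ.deriv_odd])
    (fun f g θ α => by rw [deriv_add]; simp [mul_add])
    (fun c f θ α => by rw [deriv_smul]; simp; ring)

/-- The kernel `i ρ'(θ - α)`. -/
def derivShiftK (hs0 : 0 < s) : HolderEven s →L[ℝ] Kernel s :=
  Kernel.clmOfBound (fun ρ θ α => Complex.I * ((deriv ρ (θ - α) : ℝ) : ℂ)) 1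
    (fun ρ θ => by
      have := ρ.continuous_deriv hs0
      fun_prop)
    (fun ρ θ α => by
      rw [norm_mul, Complex.norm_I, Complex.norm_real, Real.norm_eq_abs, one_mul, one_mul]
      exact ρ.abs_deriv_le _)
    (fun ρ x y α => by
      rw [← mul_sub, ← Complex.ofReal_sub, norm_mul, Complex.norm_I, Complex.norm_real, one_mul,
        one_mul]
      simpa using ρ.abs_deriv_sub_le (x - α) (y - α))
    (fun ρ θ α => by rw [add_sub_right_comm, ρ.deriv_periodic])
    (fun ρ θ α => by
      rw [Arc.coe_reflect, show -θ - (2 * Real.pi - α) = -(θ - α) - 2 * Real.pi by ring,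
        ρ.deriv_periodic.sub_eq, ρ.deriv_odd]
      simp)
    (fun f g θ α => by rw [deriv_add]; simp [mul_add])
    (fun c f θ α => by rw [deriv_smul]; simp; ring)

theorem abs_chord_le (ρ : HolderEven s) (θ : ℝ) (α : Arc) :
    |(ρ θ - ρ (θ - α)) / (2 * Real.sin (α / 2))| ≤ 2 * ‖ρ‖ := by
  have h := sin_half_pos α
  rw [abs_div, abs_of_pos (by positivity : 0 < 2 * Real.sin (α / 2)), div_le_iff₀ (by positivity)]
  refine (abs_sub_le_mul_sin ρ.periodic (differentiable ρ) ρ.abs_deriv_le θ α).trans ?_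
  have : 0 ≤ ‖ρ‖ * Real.sin (α / 2) := by positivity
  nlinarith [Real.pi_le_four]

/-- The difference of the chord quotients at x and y is the chord quotient at x of the increment z ↦
ρ(z) - ρ(z + (y - x)). Its derivative is at most ‖ρ‖ |x - y|^s, so the chord bound for periodic
functions applies to it. This is where the C^{1,s} regularity of ρ becomes C^s regularity uniform in
α. -/
theorem abs_chord_sub_le (ρ : HolderEven s) (x y : ℝ) (α : Arc) :
    |(ρ x - ρ (x - α)) / (2 * Real.sin (α / 2)) - (ρ y - ρ (y - α)) / (2 * Real.sin (α / 2))| ≤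
      2 * ‖ρ‖ * |x - y| ^ (s : ℝ) := by
  have h := sin_half_pos α
  have hd : ∀ z, HasDerivAt (fun z => ρ z - ρ (z + (y - x)))
      (deriv ρ z - deriv ρ (z + (y - x))) z := fun z =>
    (ρ.hasDerivAt z).sub ((ρ.hasDerivAt (z + (y - x))).comp_add_const z (y - x))
  have hb := abs_sub_le_mul_sin (g := fun z => ρ z - ρ (z + (y - x)))
    (M := ‖ρ‖ * |x - y| ^ (s : ℝ))
    (fun z => by simp only [ρ.periodic z, add_right_comm z, ρ.periodic (z + (y - x))])
    (fun z => (hd z).differentiableAt) (fun z => by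
      rw [(hd z).deriv]
      refine (ρ.abs_deriv_sub_le _ _).trans (le_of_eq ?_)
      congr 2
      rw [show z - (z + (y - x)) = x - y by ring]) x α
  rw [← sub_div, abs_div, abs_of_pos (by positivity : 0 < 2 * Real.sin (α / 2)),
    div_le_iff₀ (by positivity)]
  have e : ρ x - ρ (x - α) - (ρ y - ρ (y - α)) =
      ρ x - ρ (x + (y - x)) - (ρ (x - α) - ρ (x - α + (y - x))) := by
    rw [show x + (y - x) = y by ring, show x - α + (y - x) = y - α by ring]; ring
  rw [e]
  refine hb.trans ?_
  have : 0 ≤ ‖ρ‖ * |x - y| ^ (s : ℝ) * Real.sin (α / 2) := by positivity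
  nlinarith [Real.pi_le_four]

/-- The kernel `(ρ(θ) - ρ(θ - α)) / (2 sin (α / 2))`. -/
def chordK : HolderEven s →L[ℝ] Kernel s :=
  Kernel.clmOfBound
    (fun ρ θ α => (((ρ θ - ρ (θ - α)) / (2 * Real.sin (α / 2)) : ℝ) : ℂ)) 2
    (fun ρ θ => by
      have := (differentiable ρ).continuous
      have h2 : Continuous fun α : Arc => (ρ θ - ρ (θ - α)) / (2 * Real.sin (α / 2)) :=
        Continuous.div (by fun_prop) (by fun_prop) fun α =>
          (mul_pos two_pos (sin_half_pos α)).ne'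
      fun_prop)
    (fun ρ θ α => by
      rw [Complex.norm_real, Real.norm_eq_abs]
      exact ρ.abs_chord_le θ α)
    (fun ρ x y α => by
      rw [← Complex.ofReal_sub, Complex.norm_real]
      exact ρ.abs_chord_sub_le x y α)
    (fun ρ θ α => by rw [add_sub_right_comm, ρ.periodic, ρ.periodic])
    (fun ρ θ α => by
      rw [Arc.coe_reflect, show -θ - (2 * Real.pi - α) = -(θ - α) - 2 * Real.pi by ring,
        ρ.periodic.sub_eq, ρ.even, ρ.even, show (2 * Real.pi - α) / 2 = Real.pi - α / 2 by ring,
        Real.sin_pi_sub, Complex.conj_ofReal])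
    (fun f g θ α => by
      rw [map_add, ← Complex.ofReal_add]
      congr 1
      simp only [Pi.add_apply]
      ring)
    (fun c f θ α => by
      rw [map_smul]
      simp
      ring)

end HolderEven

namespace Kernel

variable {s : ℝ≥0}

theorem norm_exp_sub_le (hs1 : s ≤ 1) (x y : ℝ) :
    ‖Complex.exp (x * Complex.I) - Complex.exp (y * Complex.I)‖ ≤ 2 * |x - y| ^ (s : ℝ) := by
  have h1 : ‖Complex.exp (x * Complex.I) - Complex.exp (y * Complex.I)‖ ≤ |x - y| := by
    have e : Complex.exp (x * Complex.I) - Complex.exp (y * Complex.I) =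
        Complex.exp (y * Complex.I) * (Complex.exp (Complex.I * ((x - y : ℝ) : ℂ)) - 1) := by
      rw [mul_sub, ← Complex.exp_add, mul_one]
      congr 2
      push_cast
      ring
    rw [e, norm_mul, Complex.norm_exp_ofReal_mul_I, one_mul]
    exact Real.norm_exp_I_mul_ofReal_sub_one_le
  have h2 : ‖Complex.exp (x * Complex.I) - Complex.exp (y * Complex.I)‖ ≤ 2 := by
    refine (norm_sub_le _ _).trans ?_
    rw [Complex.norm_exp_ofReal_mul_I, Complex.norm_exp_ofReal_mul_I]
    norm_num
  rcases le_total |x - y| 1 with h | h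
  · have h3 : |x - y| ≤ |x - y| ^ (s : ℝ) := by
      have := Real.rpow_le_rpow_of_exponent_ge_of_imp (x := |x - y|) (y := 1) (z := s)
        (abs_nonneg _) h (by exact_mod_cast hs1) (by simp)
      simpa using this
    linarith [abs_nonneg (x - y)]
  · have h3 : 1 ≤ |x - y| ^ (s : ℝ) := Real.one_le_rpow h s.2
    linarith

/-- The kernel `e^{iθ}`. -/
def expK (hs1 : s ≤ 1) : Kernel s :=
  ofBound (fun θ _ => Complex.exp (θ * Complex.I)) 1 2 (fun θ => continuous_const)
    (fun θ α => (Complex.norm_exp_ofReal_mul_I θ).le) (fun x y α => norm_exp_sub_le hs1 x y)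
    (fun θ α => by
      push_cast
      rw [add_mul, Complex.exp_add, Complex.exp_two_pi_mul_I, mul_one])
    (fun θ α => by rw [← Complex.exp_conj]; simp)

/-- The kernel `e^{-iθ}`. -/
def expNegK (hs1 : s ≤ 1) : Kernel s :=
  ofBound (fun θ _ => Complex.exp (-(θ * Complex.I))) 1 2 (fun θ => continuous_const)
    (fun θ α => by
      have := Complex.norm_exp_ofReal_mul_I (-θ)
      simp only [Complex.ofReal_neg, neg_mul] at this
      exact this.le)
    (fun x y α => by
      have := norm_exp_sub_le hs1 (-x) (-y)
      rw [show -x - -y = -(x - y) by ring, abs_neg] at this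
      simpa using this)
    (fun θ α => by
      push_cast
      rw [add_mul, neg_add, Complex.exp_add, Complex.exp_neg (2 * _ * _), Complex.exp_two_pi_mul_I,
        inv_one, mul_one])
    (fun θ α => by rw [← Complex.exp_conj]; simp)

/-- The kernel given by a function of `α` alone. -/
def ofArc (w : Arc → ℂ) (a : ℝ) (hc : Continuous w) (ha : ∀ α, ‖w α‖ ≤ a)
    (hsymm : ∀ α, w (Arc.reflect α) = (starRingEnd ℂ) (w α)) : Kernel s :=
  ofBound (fun _ α => w α) a 0 (fun _ => hc) (fun _ => ha) (fun x y α => by simp) (fun _ _ => rfl)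
    (fun _ => hsymm)

/-- The kernel `e^{-iα}`. -/
def arcExpNegK : Kernel s :=
  ofArc (fun α => Complex.exp (-(α * Complex.I))) 1 (by fun_prop)
    (fun α => by
      have := Complex.norm_exp_ofReal_mul_I (-α)
      simp only [Complex.ofReal_neg, neg_mul] at this
      exact this.le)
    (fun α => by
      rw [← Complex.exp_conj, Arc.coe_reflect]
      push_cast
      rw [sub_mul, neg_sub, Complex.exp_sub, Complex.exp_two_pi_mul_I, div_one]
      simp)

/-- The kernel `cos α`. -/
def arcCosK : Kernel s :=
  ofArc (fun α => (Real.cos α : ℂ)) 1 (by fun_prop)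
    (fun α => by
      rw [Complex.norm_real]; exact Real.abs_cos_le_one α)
    (fun α => by simp [Real.cos_two_pi_sub, -Complex.ofReal_cos])

/-- The kernel `i sin α`. -/
def arcSinK : Kernel s :=
  ofArc (fun α => Complex.I * (Real.sin α : ℂ)) 1 (by fun_prop)
    (fun α => by
      rw [norm_mul, Complex.norm_I, Complex.norm_real, one_mul]; exact Real.abs_sin_le_one α)
    (fun α => by simp [Real.sin_two_pi_sub, -Complex.ofReal_sin])

/-- The kernel `cos θ`. -/
def cosK (hs1 : s ≤ 1) : Kernel s := (2⁻¹ : ℝ) • (expK hs1 + expNegK hs1)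

/-- The kernel `i sin θ`. -/
def sinK (hs1 : s ≤ 1) : Kernel s := (2⁻¹ : ℝ) • (expK hs1 - expNegK hs1)

end Kernel

end

section

open scoped BoundedContinuousFunction Topology
open MeasureTheory

/-! ### The curve `√(1 + ρ(θ)) e^{iθ}` -/

/-- The curve `√(1 + ρ(θ)) e^{iθ}`. -/
def curve (ρ : ℝ → ℝ) (θ : ℝ) : ℂ := (Real.sqrt (1 + ρ θ) : ℂ) * Complex.exp (θ * Complex.I)

/-- The derivative of `√(1 + ρ(θ))`. -/
def radiusDeriv (ρ : ℝ → ℝ) (θ : ℝ) : ℝ := deriv ρ θ / (2 * Real.sqrt (1 + ρ θ))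

/-- The tangent vector of the curve `√(1 + ρ(θ)) e^{iθ}`. -/
def tangent (ρ : ℝ → ℝ) (θ : ℝ) : ℂ :=
  ((radiusDeriv ρ θ : ℂ) + (Real.sqrt (1 + ρ θ) : ℂ) * Complex.I) * Complex.exp (θ * Complex.I)

/-- The cross product of two plane vectors. -/
def cross (v w : ℂ) : ℝ := v.re * w.im - v.im * w.re

/-- The logarithm of the chord of the unit circle that subtends the angle `α`. -/
def logChord (α : ℝ) : ℝ := Real.log (2 * Real.sin (α / 2))

/-- Rescale the integrability of log sin on (0, π) by a factor 2 and add the constant log 2. -/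
theorem intervalIntegrable_logChord : IntervalIntegrable logChord volume 0 (2 * Real.pi) := by
  have h1 : IntervalIntegrable (Real.log ∘ Real.sin) volume 0 Real.pi := intervalIntegrable_log_sin
  have h2 := h1.comp_mul_left (c := 1 / 2)
  rw [show (0 : ℝ) / (1 / 2) = 0 by simp, show Real.pi / (1 / 2) = 2 * Real.pi by ring] at h2
  refine ((intervalIntegrable_const (c := Real.log 2)).add h2).congr_ae ?_
  rw [Set.uIoc_of_le (by positivity), Filter.EventuallyEq, ae_restrict_iff' measurableSet_Ioc]
  -- At the endpoint the sine vanishes, and the default value log 0 = 0 breaks the splitting of the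
  -- logarithm of the product.
  have h3 : ∀ᵐ x : ℝ, x ≠ 2 * Real.pi := by simp [ae_iff]
  filter_upwards [h3] with x hx hx2
  have h4 : 0 < Real.sin (x / 2) := sin_half_pos ⟨x, hx2.1, lt_of_le_of_ne hx2.2 hx⟩
  simp only [Function.comp_apply, logChord]
  rw [Real.log_mul two_ne_zero h4.ne', show 1 / 2 * x = x / 2 by ring]

theorem integrable_arc {f : ℝ → ℝ} (hf : IntervalIntegrable f volume 0 (2 * Real.pi)) :
    Integrable fun α : Arc => f α := by
  rw [volume_arc]
  refine (integrableOn_iff_comap_subtypeVal measurableSet_Ioo).1 ?_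
  exact ((intervalIntegrable_iff_integrableOn_Ioo_of_le (by positivity)).1 hf)

theorem integrable_logChord : Integrable fun α : Arc => logChord α :=
  integrable_arc intervalIntegrable_logChord

theorem integrable_one_arc : Integrable fun _ : Arc => (1 : ℝ) :=
  integrable_arc (f := fun _ => 1) intervalIntegrable_const

theorem logChord_reflect (α : Arc) : logChord α.reflect = logChord α := by
  rw [logChord, logChord, Arc.coe_reflect,
    show (2 * Real.pi - (α : ℝ)) / 2 = Real.pi - α / 2 by ring, Real.sin_pi_sub]

namespace Kernel

variable {s : ℝ≥0}

/-- Integration of the imaginary part of a kernel against `log (2 sin (α / 2))`. -/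
def pushLog : Kernel s →L[ℝ] HolderOdd s :=
  push (integralIm _ integrable_logChord) (isOddFunctional_integralIm _ logChord_reflect)

/-- Integration of the imaginary part of a kernel. -/
def pushOne : Kernel s →L[ℝ] HolderOdd s :=
  push (integralIm _ integrable_one_arc) (isOddFunctional_integralIm _ fun _ => rfl)

/-- The imaginary part of a kernel at `α = π`. -/
def pushMid : Kernel s →L[ℝ] HolderOdd s := push midIm isOddFunctional_midIm

theorem pushLog_apply (k : Kernel s) (θ : ℝ) :
    pushLog k θ = ∫ α : Arc, logChord α * (k θ α).im := rfl

theorem pushOne_apply (k : Kernel s) (θ : ℝ) :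
    pushOne k θ = ∫ α : Arc, (k θ α).im := by
  change ∫ α : Arc, 1 * (k θ α).im = _
  simp

theorem pushMid_apply (k : Kernel s) (θ : ℝ) : pushMid k θ = (k θ Arc.mid).im := rfl

/-- A logarithm on the kernels close to `1`. -/
def log (s : ℝ≥0) : Kernel s → Kernel s := (exists_log s 2).choose

/-- Order two is chosen because the later division by εq costs one derivative and the functional has
to be C¹. -/
theorem contDiffAt_log : ContDiffAt ℝ 2 (log s) 1 := (exists_log s 2).choose_spec.1

theorem eventually_log_apply :
    ∀ᶠ k in 𝓝 (1 : Kernel s), ∀ θ α, log s k θ α = Complex.log (k θ α) :=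
  (exists_log s 2).choose_spec.2

theorem log_one : log s 1 = 0 := by
  refine ext fun θ α => ?_
  rw [eventually_log_apply.self_of_nhds θ α, one_apply, Complex.log_one]
  simp

/-- The power `k ^ c`, for kernels close to `1`. -/
def rpow (c : ℝ) (k : Kernel s) : Kernel s := NormedSpace.exp (c • log s k)

theorem contDiffAt_rpow (c : ℝ) : ContDiffAt ℝ 2 (rpow (s := s) c) 1 :=
  contDiff_exp.contDiffAt.comp _ (contDiffAt_log.const_smul c)

theorem rpow_one (c : ℝ) : rpow c (1 : Kernel s) = 1 := by
  rw [rpow, log_one, smul_zero, NormedSpace.exp_zero]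

theorem rpow_apply {k : Kernel s} {θ : ℝ} {α : Arc} {x c : ℝ}
    (hk : log s k θ α = Complex.log (k θ α)) (hx : k θ α = x) (h0 : 0 < x) :
    rpow c k θ α = ((x ^ c : ℝ) : ℂ) := by
  rw [rpow, exp_apply, smul_apply, hk, hx, ← Complex.ofReal_log h0.le, ← Complex.ofReal_mul,
    ← Complex.ofReal_exp, Real.rpow_def_of_pos h0, mul_comm]

end Kernel

open Kernel

/-! ### The translation and self-interaction operators as smooth maps. -/

section

variable {s : ℝ≥0} (hs0 : 0 < s) (hs1 : s ≤ 1)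

/-- The kernel `√(1 + ρ(θ))`. -/
def radiusK (ρ : HolderEven s) : Kernel s := rpow (1 / 2) (1 + ρ.valueK hs1)

/-- The kernel `√(1 + ρ(θ - α))`. -/
def radiusShiftK (ρ : HolderEven s) : Kernel s := rpow (1 / 2) (1 + ρ.shiftK hs1)

/-- The kernel `i ∂θ √(1 + ρ(θ))`. -/
def radiusDerivK (ρ : HolderEven s) : Kernel s :=
  (1 / 2 : ℝ) • (ρ.derivK * rpow (-(1 / 2)) (1 + ρ.valueK hs1))

/-- The kernel `i ∂θ √(1 + ρ(θ - α))`. -/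
def radiusDerivShiftK (ρ : HolderEven s) : Kernel s :=
  (1 / 2 : ℝ) • (ρ.derivShiftK hs0 * rpow (-(1 / 2)) (1 + ρ.shiftK hs1))

/-- The kernel `|γ(θ) - γ(θ - α)|² / (4 sin² (α / 2))`, where `γ = √(1 + ρ(θ)) e^{iθ}`. -/
def chordRatioK (ρ : HolderEven s) : Kernel s :=
  radiusK hs1 ρ * radiusShiftK hs1 ρ +
    (ρ.chordK * Ring.inverse (radiusK hs1 ρ + radiusShiftK hs1 ρ)) ^ 2

/-- The kernel `i γ'(θ) × γ'(θ - α)`, where `γ = √(1 + ρ(θ)) e^{iθ}`. -/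
def crossK (ρ : HolderEven s) : Kernel s :=
  (radiusDerivK hs1 ρ * radiusShiftK hs1 ρ - radiusK hs1 ρ * radiusDerivShiftK hs0 hs1 ρ) * arcCosK +
    (radiusDerivK hs1 ρ * radiusDerivShiftK hs0 hs1 ρ - radiusK hs1 ρ * radiusShiftK hs1 ρ) * arcSinK

/-- The map `ρ ↦ ∂θ (√(1 + ρ(θ)) cos θ)`. -/
def translationMap (ρ : HolderEven s) : HolderOdd s :=
  pushMid (radiusDerivK hs1 ρ * cosK hs1 - radiusK hs1 ρ * sinK hs1)

/-- The map `ρ ↦ -∫ log |γ(θ) - γ(φ)| γ'(θ) × γ'(φ) dφ`, where `γ = √(1 + ρ(θ)) e^{iθ}`. -/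
def selfMap (ρ : HolderEven s) : HolderOdd s :=
  -(pushLog (crossK hs0 hs1 ρ) +
    pushOne ((1 / 2 : ℝ) • (log s (chordRatioK hs1 ρ) * crossK hs0 hs1 ρ)))

theorem contDiffAt_rpow_comp (c : ℝ) (T : HolderEven s →L[ℝ] Kernel s) :
    ContDiffAt ℝ 2 (fun ρ => rpow c (1 + T ρ)) 0 := by
  refine ContDiffAt.comp (g := rpow c) (f := fun ρ : HolderEven s => 1 + T ρ) 0 ?_
    (contDiff_const.add T.contDiff).contDiffAt
  simpa using contDiffAt_rpow _

theorem contDiffAt_radiusK : ContDiffAt ℝ 2 (radiusK hs1) 0 := contDiffAt_rpow_comp _ _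

theorem contDiffAt_radiusShiftK : ContDiffAt ℝ 2 (radiusShiftK hs1) 0 := contDiffAt_rpow_comp _ _

theorem contDiffAt_radiusDerivK : ContDiffAt ℝ 2 (radiusDerivK hs1) 0 :=
  ((HolderEven.derivK (s := s)).contDiff.contDiffAt.mul (contDiffAt_rpow_comp _ _)).const_smul _

theorem contDiffAt_radiusDerivShiftK : ContDiffAt ℝ 2 (radiusDerivShiftK hs0 hs1) 0 :=
  ((HolderEven.derivShiftK hs0).contDiff.contDiffAt.mul (contDiffAt_rpow_comp _ _)).const_smul _

theorem radiusK_zero : radiusK hs1 (0 : HolderEven s) = 1 := by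
  rw [radiusK, map_zero, add_zero, rpow_one]

theorem radiusShiftK_zero : radiusShiftK hs1 (0 : HolderEven s) = 1 := by
  rw [radiusShiftK, map_zero, add_zero, rpow_one]

theorem isUnit_two_kernel : IsUnit (1 + 1 : Kernel s) := by
  have := (IsUnit.mk0 (2 : ℝ) two_ne_zero).map (algebraMap ℝ (Kernel s))
  rwa [map_ofNat, ← one_add_one_eq_two] at this

theorem contDiffAt_chordRatioK : ContDiffAt ℝ 2 (chordRatioK hs1) 0 := by
  have h1 := contDiffAt_radiusK hs1
  have h2 := contDiffAt_radiusShiftK hs1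
  suffices h3 : ContDiffAt ℝ 2 (fun ρ => Ring.inverse (radiusK hs1 ρ + radiusShiftK hs1 ρ)) 0 from
    (h1.mul h2).add (((HolderEven.chordK (s := s)).contDiff.contDiffAt.mul h3).pow 2)
  refine ContDiffAt.comp (g := Ring.inverse) (f := fun ρ => radiusK hs1 ρ + radiusShiftK hs1 ρ) 0 ?_ (h1.add h2)
  -- At the disc both radii are the unit of the algebra, so the sum to be inverted is 2, and
  -- inversion is smooth near a unit.
  have hu : IsUnit (radiusK hs1 0 + radiusShiftK hs1 0) := by
    rw [radiusK_zero, radiusShiftK_zero]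
    exact isUnit_two_kernel
  obtain ⟨u, hu⟩ := hu
  rw [← hu]
  exact contDiffAt_ringInverse ℝ u

theorem chordRatioK_zero : chordRatioK hs1 (0 : HolderEven s) = 1 := by
  rw [chordRatioK, radiusK_zero, radiusShiftK_zero]
  simp

theorem contDiffAt_crossK : ContDiffAt ℝ 2 (crossK hs0 hs1) 0 := by
  have h1 := contDiffAt_radiusK hs1
  have h2 := contDiffAt_radiusShiftK hs1
  have h3 := contDiffAt_radiusDerivK hs1
  have h4 := contDiffAt_radiusDerivShiftK hs0 hs1
  exact (((h3.mul h2).sub (h1.mul h4)).mul contDiffAt_const).add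
    (((h3.mul h4).sub (h1.mul h2)).mul contDiffAt_const)

theorem contDiffAt_log_chordRatioK : ContDiffAt ℝ 2 (fun ρ => log s (chordRatioK hs1 ρ)) 0 := by
  refine ContDiffAt.comp (f := chordRatioK hs1) 0 ?_ (contDiffAt_chordRatioK hs1)
  rw [chordRatioK_zero]
  exact contDiffAt_log

theorem contDiffAt_translationMap : ContDiffAt ℝ 2 (translationMap hs1) 0 :=
  pushMid.contDiff.contDiffAt.comp _ (((contDiffAt_radiusDerivK hs1).mul contDiffAt_const).sub
    ((contDiffAt_radiusK hs1).mul contDiffAt_const))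

theorem contDiffAt_selfMap : ContDiffAt ℝ 2 (selfMap hs0 hs1) 0 :=
  ((pushLog.contDiff.contDiffAt.comp _ (contDiffAt_crossK hs0 hs1)).add
    (pushOne.contDiff.contDiffAt.comp _
      (((contDiffAt_log_chordRatioK hs1).mul (contDiffAt_crossK hs0 hs1)).const_smul _))).neg

/-- The conditions on `ρ` under which the kernels above are given by the expected formulas. -/
structure IsGood (ρ : HolderEven s) : Prop where
  norm_le : ‖ρ‖ ≤ 1 / 2
  log_value : ∀ θ α, log s (1 + ρ.valueK hs1) θ α = Complex.log ((1 + ρ.valueK hs1) θ α)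
  log_shift : ∀ θ α, log s (1 + ρ.shiftK hs1) θ α = Complex.log ((1 + ρ.shiftK hs1) θ α)
  log_ratio : ∀ θ α, log s (chordRatioK hs1 ρ) θ α = Complex.log (chordRatioK hs1 ρ θ α)
  isUnit : IsUnit (radiusK hs1 ρ + radiusShiftK hs1 ρ)
  ratio_near : ‖chordRatioK hs1 ρ - 1‖ ≤ 1 / 2

/-- Every condition holds in a neighbourhood of its value at ρ = 0, where the kernels are the
constants 1 or 2, and all the kernels involved are continuous there. -/
theorem eventually_isGood : ∀ᶠ ρ in 𝓝 (0 : HolderEven s), IsGood hs1 ρ := by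
  have h1 : ∀ᶠ ρ in 𝓝 (0 : HolderEven s), ‖ρ‖ ≤ 1 / 2 := by
    filter_upwards [Metric.closedBall_mem_nhds (0 : HolderEven s) (by norm_num : (0 : ℝ) < 1 / 2)]
      with ρ h
    simpa using h
  have c1 : Filter.Tendsto (fun ρ : HolderEven s => 1 + ρ.valueK hs1) (𝓝 0) (𝓝 1) := by
    have : Continuous (fun ρ : HolderEven s => 1 + ρ.valueK hs1) := by fun_prop
    simpa using this.tendsto 0
  have c2 : Filter.Tendsto (fun ρ : HolderEven s => 1 + ρ.shiftK hs1) (𝓝 0) (𝓝 1) := by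
    have : Continuous (fun ρ : HolderEven s => 1 + ρ.shiftK hs1) := by fun_prop
    simpa using this.tendsto 0
  have c3 : Filter.Tendsto (chordRatioK hs1) (𝓝 (0 : HolderEven s)) (𝓝 1) := by
    have := (contDiffAt_chordRatioK hs1).continuousAt.tendsto
    rwa [chordRatioK_zero] at this
  have c4 : Filter.Tendsto (fun ρ => radiusK hs1 ρ + radiusShiftK hs1 ρ)
      (𝓝 (0 : HolderEven s)) (𝓝 (1 + 1)) := by
    have h3 := (contDiffAt_radiusK hs1).continuousAt.tendsto
    have h4 := (contDiffAt_radiusShiftK hs1).continuousAt.tendsto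
    rw [radiusK_zero] at h3
    rw [radiusShiftK_zero] at h4
    exact h3.add h4
  have c5 : ∀ᶠ k in 𝓝 (1 : Kernel s), ‖k - 1‖ ≤ 1 / 2 := by
    filter_upwards [Metric.closedBall_mem_nhds (1 : Kernel s) (by norm_num : (0 : ℝ) < 1 / 2)]
      with k h
    rwa [mem_closedBall_iff_norm] at h
  have c6 : ∀ᶠ k in 𝓝 (1 + 1 : Kernel s), IsUnit k :=
    Units.isOpen.mem_nhds isUnit_two_kernel
  filter_upwards [h1, c1.eventually eventually_log_apply, c2.eventually eventually_log_apply,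
    c3.eventually eventually_log_apply, c4.eventually c6, c3.eventually c5]
    with ρ a1 a2 a3 a4 a5 a6
  exact ⟨a1, a2, a3, a4, a5, a6⟩

variable {hs1} {ρ : HolderEven s}

theorem IsGood.half_le (h : IsGood hs1 ρ) (θ : ℝ) : 1 / 2 ≤ 1 + ρ θ := by
  have := abs_le.1 (ρ.abs_apply_le θ)
  linarith [h.norm_le]

theorem IsGood.pos (h : IsGood hs1 ρ) (θ : ℝ) : 0 < 1 + ρ θ := by linarith [h.half_le θ]

theorem IsGood.radiusK_apply (h : IsGood hs1 ρ) (θ : ℝ) (α : Arc) : radiusK hs1 ρ θ α = Real.sqrt (1 + ρ θ) := by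
  rw [radiusK, rpow_apply (x := 1 + ρ θ) (h.log_value θ α) _ (h.pos θ), Real.sqrt_eq_rpow]
  rw [add_apply, one_apply]
  push_cast
  rfl

theorem IsGood.radiusShiftK_apply (h : IsGood hs1 ρ) (θ : ℝ) (α : Arc) :
    radiusShiftK hs1 ρ θ α = Real.sqrt (1 + ρ (θ - α)) := by
  rw [radiusShiftK, rpow_apply (x := 1 + ρ (θ - α)) (h.log_shift θ α) _ (h.pos _),
    Real.sqrt_eq_rpow]
  rw [add_apply, one_apply]
  push_cast
  rfl

theorem IsGood.radiusDerivK_apply (h : IsGood hs1 ρ) (θ : ℝ) (α : Arc) :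
    radiusDerivK hs1 ρ θ α = Complex.I * radiusDeriv ρ θ := by
  rw [radiusDerivK, smul_apply, mul_apply,
    rpow_apply (x := 1 + ρ θ) (h.log_value θ α) _ (h.pos θ), Real.rpow_neg (h.pos θ).le,
    ← Real.sqrt_eq_rpow, radiusDeriv]
  · change ((1 / 2 : ℝ) : ℂ) * (Complex.I * (deriv ρ θ : ℝ) * _) = _
    push_cast
    field_simp
  · rw [add_apply, one_apply]
    push_cast
    rfl

theorem IsGood.radiusDerivShiftK_apply (h : IsGood hs1 ρ) (θ : ℝ) (α : Arc) :
    radiusDerivShiftK hs0 hs1 ρ θ α = Complex.I * radiusDeriv ρ (θ - α) := by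
  rw [radiusDerivShiftK, smul_apply, mul_apply,
    rpow_apply (x := 1 + ρ (θ - α)) (h.log_shift θ α) _ (h.pos _), Real.rpow_neg (h.pos _).le,
    ← Real.sqrt_eq_rpow, radiusDeriv]
  · change ((1 / 2 : ℝ) : ℂ) * (Complex.I * (deriv ρ (θ - α) : ℝ) * _) = _
    push_cast
    field_simp
  · rw [add_apply, one_apply]
    push_cast
    rfl

theorem IsGood.translationMap_apply (h : IsGood hs1 ρ) (θ : ℝ) :
    translationMap hs1 ρ θ =
      radiusDeriv ρ θ * Real.cos θ - Real.sqrt (1 + ρ θ) * Real.sin θ := by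
  have hc : cosK hs1 θ Arc.mid = (Real.cos θ : ℂ) := by
    rw [cosK, smul_apply, add_apply]
    change ((2⁻¹ : ℝ) : ℂ) * (Complex.exp (θ * Complex.I) + Complex.exp (-(θ * Complex.I))) = _
    rw [Complex.ofReal_cos, Complex.cos]
    push_cast
    ring_nf
  have hsn : sinK hs1 θ Arc.mid = Complex.I * (Real.sin θ : ℂ) := by
    rw [sinK, smul_apply, Kernel.sub_apply]
    change ((2⁻¹ : ℝ) : ℂ) * (Complex.exp (θ * Complex.I) - Complex.exp (-(θ * Complex.I))) = _
    rw [Complex.ofReal_sin, Complex.sin]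
    push_cast
    rw [neg_mul]
    linear_combination (-(Complex.exp (-(θ * Complex.I)) - Complex.exp (θ * Complex.I)) / 2) *
      Complex.I_sq
  rw [translationMap, pushMid_apply, Kernel.sub_apply, mul_apply, mul_apply, h.radiusDerivK_apply,
    h.radiusK_apply, hc, hsn]
  simp [-Complex.ofReal_cos, -Complex.ofReal_sin]

theorem IsGood.crossK_apply (h : IsGood hs1 ρ) (θ : ℝ) (α : Arc) :
    crossK hs0 hs1 ρ θ α = Complex.I * cross (tangent ρ θ) (tangent ρ (θ - α)) := by
  have hc : (arcCosK : Kernel s) θ α = (Real.cos α : ℂ) := rfl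
  have hsn : (arcSinK : Kernel s) θ α = Complex.I * (Real.sin α : ℂ) := rfl
  rw [crossK, add_apply, mul_apply, mul_apply, Kernel.sub_apply, Kernel.sub_apply, mul_apply, mul_apply,
    mul_apply, mul_apply, h.radiusDerivK_apply, h.radiusDerivShiftK_apply, h.radiusK_apply,
    h.radiusShiftK_apply, hc, hsn]
  have e : cross (tangent ρ θ) (tangent ρ (θ - α)) =
      (radiusDeriv ρ θ * Real.sqrt (1 + ρ (θ - α)) -
        Real.sqrt (1 + ρ θ) * radiusDeriv ρ (θ - α)) * Real.cos α -
      (radiusDeriv ρ θ * radiusDeriv ρ (θ - α) +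
        Real.sqrt (1 + ρ θ) * Real.sqrt (1 + ρ (θ - α))) * Real.sin α := by
    have e1 : ∀ x : ℝ, Complex.exp (x * Complex.I) = ⟨Real.cos x, Real.sin x⟩ := fun x => by
      rw [Complex.exp_mul_I, ← Complex.ofReal_cos, ← Complex.ofReal_sin, Complex.mk_eq_add_mul_I]
    have e2 : Real.cos α = Real.cos θ * Real.cos (θ - α) + Real.sin θ * Real.sin (θ - α) := by
      rw [← Real.cos_sub]; congr 1; ring
    have e3 : Real.sin α = Real.sin θ * Real.cos (θ - α) - Real.cos θ * Real.sin (θ - α) := by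
      rw [← Real.sin_sub]; congr 1; ring
    rw [e2, e3, cross, tangent, tangent, e1, e1]
    simp
    ring
  rw [e]
  push_cast
  -- The kernels of the radial derivatives each carry a factor i. Their product contributes i² = -1,
  -- the sign by which `crossK` differs from the real formula.
  linear_combination (Complex.I * (radiusDeriv ρ θ : ℂ) * radiusDeriv ρ (θ - α) *
    Complex.sin α) * Complex.I_sq

/-- Law of cosines: for radii a and b at angular distance α the squared distance is (a - b)² + 4ab
sin²(α/2). Since a² - b² is the difference of the values of ρ, a - b equals that difference divided
by a + b. Factoring out 4 sin²(α/2) leaves a regular quantity close to 1. -/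
theorem norm_sq_curve_sub (hpos : ∀ θ, 0 < 1 + ρ θ) (θ : ℝ) (α : Arc) :
    ‖curve ρ θ - curve ρ (θ - α)‖ ^ 2 = (2 * Real.sin (α / 2)) ^ 2 *
      (Real.sqrt (1 + ρ θ) * Real.sqrt (1 + ρ (θ - α)) +
        ((ρ θ - ρ (θ - α)) / (2 * Real.sin (α / 2)) *
          (Real.sqrt (1 + ρ θ) + Real.sqrt (1 + ρ (θ - α)))⁻¹) ^ 2) := by
  have h1 := Real.sqrt_pos.2 (hpos θ)
  have h2 := Real.sqrt_pos.2 (hpos (θ - α))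
  have h3 : ρ θ - ρ (θ - α) = Real.sqrt (1 + ρ θ) ^ 2 - Real.sqrt (1 + ρ (θ - α)) ^ 2 := by
    rw [Real.sq_sqrt (hpos _).le, Real.sq_sqrt (hpos _).le]; ring
  have h4 := sin_half_pos α
  have e1 : ∀ x : ℝ, Complex.exp (x * Complex.I) = ⟨Real.cos x, Real.sin x⟩ := fun x => by
    rw [Complex.exp_mul_I, ← Complex.ofReal_cos, ← Complex.ofReal_sin, Complex.mk_eq_add_mul_I]
  have e2 : Real.cos θ * Real.cos (θ - α) + Real.sin θ * Real.sin (θ - α) =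
      1 - 2 * Real.sin (α / 2) ^ 2 := by
    rw [← Real.cos_sub, sub_sub_cancel]
    have e := Real.cos_two_mul (α / 2 : ℝ)
    rw [mul_div_cancel₀ _ two_ne_zero, Real.cos_sq'] at e
    linarith
  set a := Real.sqrt (1 + ρ θ)
  set b := Real.sqrt (1 + ρ (θ - α))
  have e3 : (a ^ 2 - b ^ 2) / (2 * Real.sin (α / 2)) * (a + b)⁻¹ =
      (a - b) / (2 * Real.sin (α / 2)) := by
    field_simp
    ring
  have e4 : curve ρ θ = a * Complex.exp (θ * Complex.I) := rfl
  have e5 : curve ρ (θ - α) = b * Complex.exp ((θ - α : ℝ) * Complex.I) := rfl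
  rw [h3, e3, mul_add, ← mul_pow, mul_div_cancel₀ _ (by positivity), e4, e5, e1, e1,
    ← Complex.normSq_eq_norm_sq, Complex.normSq_apply]
  simp
  have s1 := Real.sin_sq_add_cos_sq θ
  have s2 := Real.sin_sq_add_cos_sq (θ - α)
  linear_combination a ^ 2 * s1 + b ^ 2 * s2 - 2 * a * b * e2

end

end

/-! ### The contour formula for the self-interaction and its derivative at the disc. -/

section

open scoped BoundedContinuousFunction Topology
open MeasureTheory Kernel

section

variable {s : ℝ≥0} {hs0 : 0 < s} {hs1 : s ≤ 1} {ρ : HolderEven s}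

/-- The number `|γ(θ) - γ(θ - α)|² / (4 sin² (α / 2))`, where `γ = √(1 + ρ(θ)) e^{iθ}`. -/
def chordRatio (ρ : ℝ → ℝ) (θ α : ℝ) : ℝ :=
  Real.sqrt (1 + ρ θ) * Real.sqrt (1 + ρ (θ - α)) +
    ((ρ θ - ρ (θ - α)) / (2 * Real.sin (α / 2)) *
      (Real.sqrt (1 + ρ θ) + Real.sqrt (1 + ρ (θ - α)))⁻¹) ^ 2

theorem IsGood.chordRatioK_apply (h : IsGood hs1 ρ) (θ : ℝ) (α : Arc) :
    chordRatioK hs1 ρ θ α = chordRatio ρ θ α := by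
  rw [chordRatioK, sq, add_apply, mul_apply, mul_apply, mul_apply, inverse_apply h.isUnit,
    add_apply, h.radiusK_apply, h.radiusShiftK_apply, chordRatio]
  change _ + ((((ρ θ - ρ (θ - α)) / (2 * Real.sin (α / 2)) : ℝ) : ℂ) * _) *
    ((((ρ θ - ρ (θ - α)) / (2 * Real.sin (α / 2)) : ℝ) : ℂ) * _) = _
  push_cast
  ring

theorem IsGood.half_le_chordRatio (h : IsGood hs1 ρ) (θ : ℝ) (α : Arc) :
    1 / 2 ≤ chordRatio ρ θ α := by
  have h1 := (norm_apply_apply_le (chordRatioK hs1 ρ - 1) θ α).trans h.ratio_near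
  rw [Kernel.sub_apply, one_apply, h.chordRatioK_apply, ← Complex.ofReal_one, ← Complex.ofReal_sub,
    Complex.norm_real, Real.norm_eq_abs] at h1
  linarith [(abs_le.1 h1).1]

/-- The singular part does not depend on ρ; the dependence on ρ is confined to the logarithm of a
function that stays above 1/2. -/
theorem IsGood.log_norm_curve_sub (h : IsGood hs1 ρ) (θ : ℝ) (α : Arc) :
    Real.log ‖curve ρ θ - curve ρ (θ - α)‖ =
      logChord α + 1 / 2 * Real.log (chordRatio ρ θ α) := by
  have h1 := h.half_le_chordRatio θ α
  have h2 := sin_half_pos α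
  have h3 := congrArg Real.log (norm_sq_curve_sub h.pos θ α)
  rw [Real.log_pow] at h3
  change _ = Real.log ((2 * Real.sin (α / 2)) ^ 2 * chordRatio ρ θ α) at h3
  rw [Real.log_mul (by positivity) (by linarith), Real.log_pow] at h3
  rw [logChord]
  push_cast at h3
  linarith

/-- A lower bound for chords, uniform in θ. It controls the error made when the logarithm is
regularized. -/
theorem IsGood.sin_le_norm_curve_sub (h : IsGood hs1 ρ) (θ : ℝ) (α : Arc) :
    Real.sin (α / 2) ≤ ‖curve ρ θ - curve ρ (θ - α)‖ := by
  have h0 := sin_half_pos α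
  refine (sq_le_sq₀ h0.le (norm_nonneg _)).1 ?_
  rw [norm_sq_curve_sub h.pos θ α]
  change _ ≤ (2 * Real.sin (α / 2)) ^ 2 * chordRatio ρ θ α
  nlinarith [h.half_le_chordRatio θ α, sq_nonneg (Real.sin (α / 2))]

theorem IsGood.selfMap_apply (h : IsGood hs1 ρ) (θ : ℝ) :
    selfMap hs0 hs1 ρ θ = -∫ α in (0 : ℝ)..(2 * Real.pi),
      Real.log ‖curve ρ θ - curve ρ (θ - α)‖ * cross (tangent ρ θ) (tangent ρ (θ - α)) := by
  rw [← integral_arc_eq fun α => Real.log ‖curve ρ θ - curve ρ (θ - α)‖ *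
    cross (tangent ρ θ) (tangent ρ (θ - α)), selfMap, map_neg, map_add, Pi.neg_apply,
    Pi.add_apply, pushLog_apply, pushOne_apply, ← integral_add]
  · congr 1
    refine integral_congr_ae (Filter.Eventually.of_forall fun α => ?_)
    have h1 := h.half_le_chordRatio θ α
    simp only
    rw [h.log_norm_curve_sub, smul_apply, mul_apply, h.crossK_apply, h.log_ratio,
      h.chordRatioK_apply, ← Complex.ofReal_log (by linarith)]
    simp
    ring
  · exact integrable_mul_im integrable_logChord _
  · simpa using integrable_mul_im integrable_one_arc
      (toFun ((1 / 2 : ℝ) • (log s (chordRatioK hs1 ρ) * crossK hs0 hs1 ρ)) θ)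

theorem cross_tangent (ρ : ℝ → ℝ) (θ α : ℝ) : cross (tangent ρ θ) (tangent ρ (θ - α)) =
    (radiusDeriv ρ θ * Real.sqrt (1 + ρ (θ - α)) -
      Real.sqrt (1 + ρ θ) * radiusDeriv ρ (θ - α)) * Real.cos α -
    (radiusDeriv ρ θ * radiusDeriv ρ (θ - α) +
      Real.sqrt (1 + ρ θ) * Real.sqrt (1 + ρ (θ - α))) * Real.sin α := by
  have e1 : ∀ x : ℝ, Complex.exp (x * Complex.I) = ⟨Real.cos x, Real.sin x⟩ := fun x => by
    rw [Complex.exp_mul_I, ← Complex.ofReal_cos, ← Complex.ofReal_sin, Complex.mk_eq_add_mul_I]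
  have e2 : Real.cos α = Real.cos θ * Real.cos (θ - α) + Real.sin θ * Real.sin (θ - α) := by
    rw [← Real.cos_sub]; congr 1; ring
  have e3 : Real.sin α = Real.sin θ * Real.cos (θ - α) - Real.cos θ * Real.sin (θ - α) := by
    rw [← Real.sin_sub]; congr 1; ring
  rw [e2, e3, cross, tangent, tangent, e1, e1]
  simp
  ring

theorem deriv_toFun_smul (t : ℝ) (r : HolderEven s) (x : ℝ) :
    deriv (t • r : HolderEven s) x = t * deriv r x := by
  rw [HolderEven.deriv_smul]; rfl

theorem hasDerivAt_sqrt_smul (a : ℝ) :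
    HasDerivAt (fun t : ℝ => Real.sqrt (1 + t * a)) (a / 2) 0 := by
  have h1 : HasDerivAt (fun t : ℝ => 1 + t * a) a 0 := by
    simpa using ((hasDerivAt_id (0 : ℝ)).mul_const a).const_add 1
  simpa using h1.sqrt (by simp)

theorem hasDerivAt_radiusDeriv_smul (a b : ℝ) :
    HasDerivAt (fun t : ℝ => t * b / (2 * Real.sqrt (1 + t * a))) (b / 2) 0 := by
  have h1 : HasDerivAt (fun t : ℝ => t * b) b 0 := by
    simpa using (hasDerivAt_id (0 : ℝ)).mul_const b
  have := h1.div ((hasDerivAt_sqrt_smul a).const_mul 2) (by simp)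
  convert! this using 1
  simp
  field_simp

theorem hasDerivAt_cross_smul (r : HolderEven s) (θ α : ℝ) :
    HasDerivAt (fun t : ℝ => cross (tangent (t • r : HolderEven s) θ)
        (tangent (t • r : HolderEven s) (θ - α)))
      ((deriv r θ - deriv r (θ - α)) / 2 * Real.cos α - (r θ + r (θ - α)) / 2 * Real.sin α) 0 := by
  simp only [cross_tangent, radiusDeriv, deriv_toFun_smul]
  simp only [map_smul, Pi.smul_apply, smul_eq_mul]
  have h1 := hasDerivAt_sqrt_smul (r θ)
  have h2 := hasDerivAt_sqrt_smul (r (θ - α))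
  have h3 := hasDerivAt_radiusDeriv_smul (r θ) (deriv r θ)
  have h4 := hasDerivAt_radiusDeriv_smul (r (θ - α)) (deriv r (θ - α))
  have := (((h3.mul h2).sub (h1.mul h4)).mul_const (Real.cos α)).sub
    (((h3.mul h4).add (h1.mul h2)).mul_const (Real.sin α))
  refine HasDerivAt.congr_deriv this ?_
  simp
  ring

/-- The squared chord quotient is of second order in t, so only the product of the two radii
contributes. -/
theorem hasDerivAt_chordRatio_smul (r : HolderEven s) (θ α : ℝ) :
    HasDerivAt (fun t : ℝ => chordRatio (t • r : HolderEven s) θ α)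
      ((r θ + r (θ - α)) / 2) 0 := by
  simp only [chordRatio, map_smul, Pi.smul_apply, smul_eq_mul]
  have h1 := hasDerivAt_sqrt_smul (r θ)
  have h2 := hasDerivAt_sqrt_smul (r (θ - α))
  have h3 : HasDerivAt (fun t : ℝ => (t * r θ - t * r (θ - α)) / (2 * Real.sin (α / 2)))
      ((r θ - r (θ - α)) / (2 * Real.sin (α / 2))) 0 := by
    have : HasDerivAt (fun t : ℝ => t * r θ - t * r (θ - α)) (r θ - r (θ - α)) 0 := by
      have := ((hasDerivAt_id (0 : ℝ)).mul_const (r θ)).sub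
        ((hasDerivAt_id (0 : ℝ)).mul_const (r (θ - α)))
      exact this.congr_deriv (by simp)
    exact this.div_const _
  have := (h1.mul h2).add ((h3.mul ((h1.add h2).inv (by simp))).pow 2)
  refine HasDerivAt.congr_deriv this ?_
  simp
  ring

/-- The derivative at `0` of the self-interaction. -/
theorem hasDerivAt_selfMap_smul (r : HolderEven s) (θ : ℝ) :
    HasDerivAt (fun t : ℝ => selfMap hs0 hs1 (t • r) θ)
      (-((∫ α : Arc, logChord α * ((deriv r θ - deriv r (θ - α)) / 2 * Real.cos α -
            (r θ + r (θ - α)) / 2 * Real.sin α)) -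
        ∫ α : Arc, (r θ + r (θ - α)) / 4 * Real.sin α)) 0 := by
  have hline : HasDerivAt (fun t : ℝ => t • r) r 0 := by
    simpa using (hasDerivAt_id (0 : ℝ)).smul_const r
  have hgood : ∀ᶠ t : ℝ in 𝓝 0, IsGood hs1 (t • r) := by
    have : Filter.Tendsto (fun t : ℝ => t • r) (𝓝 0) (𝓝 0) := by
      simpa using hline.continuousAt.tendsto
    exact this.eventually (eventually_isGood hs1)
  -- Smoothness gives a derivative inside the algebra, and evaluation, being continuous and linear,
  -- identifies its values with the pointwise derivatives. Since the pushes are bounded linear maps,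
  -- no differentiation under the integral sign is needed.
  have hcomp : ∀ {W : HolderEven s → Kernel s}, ContDiffAt ℝ 2 W 0 →
      ∃ w, HasDerivAt (fun t : ℝ => W (t • r)) w 0 := by
    intro W hW
    have h1 := (hW.differentiableAt (by norm_num)).hasFDerivAt
    rw [← zero_smul ℝ r] at h1
    exact ⟨_, h1.comp_hasDerivAt (0 : ℝ) hline⟩
  have heval : ∀ {W : HolderEven s → Kernel s} {w : Kernel s} (θ : ℝ) (α : Arc),
      HasDerivAt (fun t : ℝ => W (t • r)) w 0 →
      HasDerivAt (fun t : ℝ => (W (t • r) θ α).im) (w θ α).im 0 := by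
    intro W w θ α hw
    exact (Complex.imCLM.comp (Kernel.eval (s := s) θ α).toContinuousLinearMap).hasFDerivAt.comp_hasDerivAt
      (0 : ℝ) hw
  obtain ⟨c, hc⟩ := hcomp (contDiffAt_crossK hs0 hs1)
  obtain ⟨l, hl⟩ := hcomp
    (((contDiffAt_log_chordRatioK hs1).mul (contDiffAt_crossK hs0 hs1)).const_smul (1 / 2 : ℝ))
  have hcv : ∀ α : Arc, (c θ α).im =
      (deriv r θ - deriv r (θ - α)) / 2 * Real.cos α - (r θ + r (θ - α)) / 2 * Real.sin α := by
    intro α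
    refine (heval θ α hc).unique ((hasDerivAt_cross_smul r θ α).congr_of_eventuallyEq ?_)
    filter_upwards [hgood] with t ht
    rw [ht.crossK_apply]
    simp
  -- At the disc the chord ratio is 1 and its logarithm vanishes, so only the derivative of the
  -- logarithm times the cross product -sin α survives.
  have hlv : ∀ α : Arc, (l θ α).im = -((r θ + r (θ - α)) / 4 * Real.sin α) := by
    intro α
    have h1 := ((hasDerivAt_chordRatio_smul r θ α).log (by simp [chordRatio])).mul
      (hasDerivAt_cross_smul r θ α)
    refine (heval (W := fun ρ => (1 / 2 : ℝ) •
      (log s (chordRatioK hs1 ρ) * crossK hs0 hs1 ρ)) θ α hl).unique (((h1.const_mul (1 / 2)).congr_of_eventuallyEq ?_).congr_deriv ?_)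
    · filter_upwards [hgood] with t ht
      simp only [Pi.mul_apply]
      have h1 := ht.half_le_chordRatio θ α
      rw [smul_apply, mul_apply, ht.crossK_apply, ht.log_ratio,
        ht.chordRatioK_apply, ← Complex.ofReal_log (by linarith)]
      simp
    · simp [chordRatio, cross_tangent, radiusDeriv]
      ring
  have h1 := ((pushLog (s := s)).hasFDerivAt.comp_hasDerivAt (0 : ℝ) hc).add
    ((pushOne (s := s)).hasFDerivAt.comp_hasDerivAt (0 : ℝ) hl)
  have h2 := (HolderOdd.eval θ).hasFDerivAt.comp_hasDerivAt (0 : ℝ) h1.neg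
  refine h2.congr_deriv ?_
  rw [HolderOdd.eval_apply, map_neg, map_add, Pi.neg_apply, Pi.add_apply, pushLog_apply,
    pushOne_apply]
  simp only [hcv, hlv, integral_neg, sub_eq_add_neg]

theorem cross_tangent_zero (θ α : ℝ) :
    cross (tangent (0 : HolderEven s) θ) (tangent (0 : HolderEven s) (θ - α)) = -Real.sin α := by
  rw [cross_tangent]
  simp [radiusDeriv]

/-- At the disc the logarithm of the chord ratio vanishes, and the remaining integrand is the
symmetric weight times -sin α, which is odd under the reflection. This vanishing permits the
division by εq. -/
theorem selfMap_zero : selfMap hs0 hs1 (0 : HolderEven s) = 0 := by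
  have h : IsGood hs1 (0 : HolderEven s) := (eventually_isGood hs1).self_of_nhds
  refine HolderOdd.ext fun θ => ?_
  rw [selfMap, map_neg, map_add, Pi.neg_apply, Pi.add_apply, pushLog_apply, pushOne_apply]
  rw [chordRatioK_zero, log_one, zero_mul, smul_zero]
  have h1 : ∫ α : Arc, logChord α * (crossK hs0 hs1 (0 : HolderEven s) θ α).im = 0 := by
    have h2 := integral_arc_reflect
      fun α : Arc => logChord α * (crossK hs0 hs1 (0 : HolderEven s) θ α).im
    have h3 : ∀ α : Arc, (crossK hs0 hs1 (0 : HolderEven s) θ α).im = -Real.sin α := fun α => by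
      rw [h.crossK_apply, cross_tangent_zero]
      simp [-Complex.ofReal_sin]
    simp only [h3, logChord_reflect] at h2 ⊢
    simp only [Arc.coe_reflect, Real.sin_two_pi_sub] at h2
    simp only [neg_neg, mul_neg, integral_neg] at h2 ⊢
    linarith
  rw [h1]
  simp

end

end

/-! ### The image interaction. -/

section

open scoped BoundedContinuousFunction Topology
open MeasureTheory Kernel

/-- The quotient `(ε w + q) / (1 - (ε z̄ + q) (ε w + q))`. -/
def imageQuotient (ε q : ℝ) (z w : ℂ) : ℂ :=
  ((ε : ℂ) * w + q) / (1 - ((ε : ℂ) * (starRingEnd ℂ) z + q) * ((ε : ℂ) * w + q))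

section

variable {s : ℝ≥0} (hs0 : 0 < s) (hs1 : s ≤ 1)

/-- The kernel `ε γ̄(θ) + q`. -/
def conjCurveK (p : ℝ × ℝ × HolderEven s) : Kernel s :=
  p.1 • (radiusK hs1 p.2.2 * expNegK hs1) + p.2.1 • 1

/-- The kernel `ε γ(θ - α) + q`. -/
def curveShiftK (p : ℝ × ℝ × HolderEven s) : Kernel s :=
  p.1 • (radiusShiftK hs1 p.2.2 * (expK hs1 * arcExpNegK)) + p.2.1 • 1

/-- The kernel `1 - (ε γ̄(θ) + q) (ε γ(θ - α) + q)`. -/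
def imageDenomK (p : ℝ × ℝ × HolderEven s) : Kernel s :=
  1 - conjCurveK hs1 p * curveShiftK hs1 p

/-- The contour kernel of the derivative of the image potential. -/
def imageContourK (p : ℝ × ℝ × HolderEven s) : Kernel s :=
  (radiusDerivK hs1 p.2.2 + radiusK hs1 p.2.2) * expNegK hs1 *
    (curveShiftK hs1 p * Ring.inverse (imageDenomK hs1 p)) *
    (radiusShiftK hs1 p.2.2 *
      (radiusDerivShiftK hs0 hs1 p.2.2 - radiusShiftK hs1 p.2.2))

/-- The map `-½ ∫ Im (γ̄'(θ) (εγ(φ) + q) / (1 - (εγ̄(θ) + q) (εγ(φ) + q)) γ̄(φ) γ'(φ)) dφ`. -/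
def imageMap (p : ℝ × ℝ × HolderEven s) : HolderOdd s :=
  (1 / 2 : ℝ) • pushOne (imageContourK hs0 hs1 p)

theorem contDiffAt_conjCurveK (ε q : ℝ) : ContDiffAt ℝ 2 (conjCurveK (s := s) hs1) (ε, q, 0) := by
  have h1 : ContDiffAt ℝ 2 (fun p : ℝ × ℝ × HolderEven s => radiusK hs1 p.2.2) (ε, q, 0) :=
    ContDiffAt.comp (g := radiusK hs1) (ε, q, 0) (contDiffAt_radiusK hs1) contDiffAt_snd.snd
  exact (contDiffAt_fst.smul (h1.mul contDiffAt_const)).add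
    (contDiffAt_snd.fst.smul contDiffAt_const)

theorem contDiffAt_curveShiftK (ε q : ℝ) :
    ContDiffAt ℝ 2 (curveShiftK (s := s) hs1) (ε, q, 0) := by
  have h1 : ContDiffAt ℝ 2 (fun p : ℝ × ℝ × HolderEven s => radiusShiftK hs1 p.2.2) (ε, q, 0) :=
    ContDiffAt.comp (g := radiusShiftK hs1) (ε, q, 0) (contDiffAt_radiusShiftK hs1)
      contDiffAt_snd.snd
  exact (contDiffAt_fst.smul (h1.mul contDiffAt_const)).add
    (contDiffAt_snd.fst.smul contDiffAt_const)

theorem contDiffAt_imageDenomK (ε q : ℝ) :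
    ContDiffAt ℝ 2 (imageDenomK (s := s) hs1) (ε, q, 0) :=
  contDiffAt_const.sub ((contDiffAt_conjCurveK hs1 ε q).mul (contDiffAt_curveShiftK hs1 ε q))

/-- At ε = 0 the denominator is the constant 1 - q². -/
theorem isUnit_imageDenomK {q : ℝ} (hq : 1 - q ^ 2 ≠ 0) :
    IsUnit (imageDenomK (s := s) hs1 (0, q, 0)) := by
  have e : imageDenomK (s := s) hs1 (0, q, 0) = algebraMap ℝ (Kernel s) (1 - q ^ 2) := by
    simp only [imageDenomK, conjCurveK, curveShiftK, zero_smul, zero_add]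
    rw [Algebra.smul_def, mul_one, map_sub, map_one, map_pow]
    ring
  rw [e]
  exact (IsUnit.mk0 _ hq).map _

theorem contDiffAt_imageMap {q : ℝ} (hq : 1 - q ^ 2 ≠ 0) :
    ContDiffAt ℝ 2 (imageMap (s := s) hs0 hs1) (0, q, 0) := by
  have h1 : ContDiffAt ℝ 2 (fun p : ℝ × ℝ × HolderEven s => radiusShiftK hs1 p.2.2) (0, q, 0) :=
    ContDiffAt.comp (g := radiusShiftK hs1) (0, q, 0) (contDiffAt_radiusShiftK hs1)
      contDiffAt_snd.snd
  have h2 : ContDiffAt ℝ 2 (fun p : ℝ × ℝ × HolderEven s => radiusK hs1 p.2.2) (0, q, 0) :=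
    ContDiffAt.comp (g := radiusK hs1) (0, q, 0) (contDiffAt_radiusK hs1) contDiffAt_snd.snd
  have h3 : ContDiffAt ℝ 2 (fun p : ℝ × ℝ × HolderEven s => radiusDerivK hs1 p.2.2) (0, q, 0) :=
    ContDiffAt.comp (g := radiusDerivK hs1) (0, q, 0) (contDiffAt_radiusDerivK hs1)
      contDiffAt_snd.snd
  have h4 : ContDiffAt ℝ 2 (fun p : ℝ × ℝ × HolderEven s => radiusDerivShiftK hs0 hs1 p.2.2)
      (0, q, 0) :=
    ContDiffAt.comp (g := radiusDerivShiftK hs0 hs1) (0, q, 0)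
      (contDiffAt_radiusDerivShiftK hs0 hs1) contDiffAt_snd.snd
  have h5 : ContDiffAt ℝ 2 (fun p : ℝ × ℝ × HolderEven s => Ring.inverse (imageDenomK hs1 p))
      (0, q, 0) := by
    refine ContDiffAt.comp (g := Ring.inverse) (0, q, 0) ?_ (contDiffAt_imageDenomK hs1 0 q)
    obtain ⟨u, hu⟩ := isUnit_imageDenomK (s := s) hs1 hq
    rw [← hu]
    exact contDiffAt_ringInverse ℝ u
  exact (pushOne.contDiff.contDiffAt.comp _ ((((h3.add h2).mul contDiffAt_const).mul
    ((contDiffAt_curveShiftK hs1 0 q).mul h5)).mul (h1.mul (h4.sub h1)))).const_smul _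

theorem eventually_isUnit_imageDenomK {q : ℝ} (hq : 1 - q ^ 2 ≠ 0) :
    ∀ᶠ p in 𝓝 ((0, q, 0) : ℝ × ℝ × HolderEven s), IsUnit (imageDenomK hs1 p) :=
  (contDiffAt_imageDenomK hs1 0 q).continuousAt.eventually
    (Units.isOpen.mem_nhds (isUnit_imageDenomK hs1 hq))

variable {hs0 hs1}

theorem IsGood.conjCurveK_apply {ρ : HolderEven s} (h : IsGood hs1 ρ) (ε q θ : ℝ) (α : Arc) :
    conjCurveK hs1 (ε, q, ρ) θ α = ε * (starRingEnd ℂ) (curve ρ θ) + q := by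
  have he : expNegK hs1 θ α = Complex.exp (-(θ * Complex.I)) := rfl
  simp only [conjCurveK]
  rw [add_apply, smul_apply, smul_apply, one_apply, mul_apply, h.radiusK_apply, he, curve,
    map_mul, Complex.conj_ofReal, ← Complex.exp_conj]
  simp

theorem curve_sub (ρ : ℝ → ℝ) (θ α : ℝ) : curve ρ (θ - α) = (Real.sqrt (1 + ρ (θ - α)) : ℂ) *
    (Complex.exp (θ * Complex.I) * Complex.exp (-(α * Complex.I))) := by
  rw [curve, ← Complex.exp_add]
  push_cast
  ring_nf

theorem IsGood.curveShiftK_apply {ρ : HolderEven s} (h : IsGood hs1 ρ) (ε q θ : ℝ) (α : Arc) :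
    curveShiftK hs1 (ε, q, ρ) θ α = ε * curve ρ (θ - α) + q := by
  have he : expK hs1 θ α = Complex.exp (θ * Complex.I) := rfl
  have he' : (arcExpNegK : Kernel s) θ α = Complex.exp (-(α * Complex.I)) := rfl
  simp only [curveShiftK]
  rw [add_apply, smul_apply, smul_apply, one_apply, mul_apply, mul_apply, h.radiusShiftK_apply,
    he, he', mul_one, curve_sub]

theorem IsGood.imageDenomK_apply {ρ : HolderEven s} (h : IsGood hs1 ρ) (ε q θ : ℝ) (α : Arc) :
    imageDenomK hs1 (ε, q, ρ) θ α =
      1 - (ε * (starRingEnd ℂ) (curve ρ θ) + q) * (ε * curve ρ (θ - α) + q) := by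
  rw [imageDenomK, Kernel.sub_apply, one_apply, mul_apply, h.conjCurveK_apply, h.curveShiftK_apply]

theorem conj_curve_mul_tangent (ρ : ℝ → ℝ) (θ : ℝ) : (starRingEnd ℂ) (curve ρ θ) * tangent ρ θ =
    Real.sqrt (1 + ρ θ) * (radiusDeriv ρ θ + Real.sqrt (1 + ρ θ) * Complex.I) := by
  have : Complex.exp (-(θ * Complex.I)) * Complex.exp (θ * Complex.I) = 1 := by
    rw [← Complex.exp_add]; simp
  rw [curve, tangent, map_mul, Complex.conj_ofReal, ← Complex.exp_conj]
  simp only [map_mul, Complex.conj_ofReal, Complex.conj_I, mul_neg]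
  linear_combination (Real.sqrt (1 + ρ θ) *
    (radiusDeriv ρ θ + Real.sqrt (1 + ρ θ) * Complex.I) : ℂ) * this

/-- Both outer factors of `imageContourK` are i times a geometric quantity: (i R' + R) e^{-iθ} = i
conj γ'(θ), and R (i R' - R) = i conj γ γ' at θ - α. Their product supplies the minus sign. -/
theorem IsGood.imageContourK_apply {ρ : HolderEven s} (h : IsGood hs1 ρ) {ε q : ℝ}
    (hu : IsUnit (imageDenomK hs1 (ε, q, ρ))) (θ : ℝ) (α : Arc) :
    imageContourK hs0 hs1 (ε, q, ρ) θ α =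
      -((starRingEnd ℂ) (tangent ρ θ) * imageQuotient ε q (curve ρ θ) (curve ρ (θ - α)) *
        ((starRingEnd ℂ) (curve ρ (θ - α)) * tangent ρ (θ - α))) := by
  have he : expNegK hs1 θ α = Complex.exp (-(θ * Complex.I)) := rfl
  rw [imageContourK, mul_apply, mul_apply, mul_apply, mul_apply, mul_apply, add_apply,
    Kernel.sub_apply, inverse_apply hu, h.imageDenomK_apply, h.radiusDerivK_apply,
    h.radiusDerivShiftK_apply, h.radiusK_apply, h.radiusShiftK_apply, h.curveShiftK_apply, he,
    imageQuotient, conj_curve_mul_tangent, tangent]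
  simp only [map_mul, map_add, Complex.conj_ofReal, Complex.conj_I, mul_neg, ← Complex.exp_conj]
  rw [div_eq_mul_inv]
  generalize (1 - (ε * (starRingEnd ℂ) (curve ρ θ) + q) * (ε * curve ρ (θ - α) + q))⁻¹ = D
  generalize (ε * curve ρ (θ - α) + q : ℂ) = N
  linear_combination ((radiusDeriv ρ θ * radiusDeriv ρ (θ - α) -
    Real.sqrt (1 + ρ θ) * Real.sqrt (1 + ρ (θ - α))) * Complex.exp (-(θ * Complex.I)) * N * D *
    Real.sqrt (1 + ρ (θ - α))) * Complex.I_sq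

theorem IsGood.imageMap_apply {ρ : HolderEven s} (h : IsGood hs1 ρ) {ε q : ℝ}
    (hu : IsUnit (imageDenomK hs1 (ε, q, ρ))) (θ : ℝ) :
    imageMap hs0 hs1 (ε, q, ρ) θ = -(1 / 2) * ∫ α in (0 : ℝ)..(2 * Real.pi),
      ((starRingEnd ℂ) (tangent ρ θ) * imageQuotient ε q (curve ρ θ) (curve ρ (θ - α)) *
        ((starRingEnd ℂ) (curve ρ (θ - α)) * tangent ρ (θ - α))).im := by
  rw [← integral_arc_eq fun α => ((starRingEnd ℂ) (tangent ρ θ) *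
    imageQuotient ε q (curve ρ θ) (curve ρ (θ - α)) *
      ((starRingEnd ℂ) (curve ρ (θ - α)) * tangent ρ (θ - α))).im, imageMap, map_smul,
    Pi.smul_apply, pushOne_apply]
  simp only [h.imageContourK_apply hu, Complex.neg_im, integral_neg, smul_eq_mul]
  ring

theorem isGood_zero : IsGood hs1 (0 : HolderEven s) := (eventually_isGood hs1).self_of_nhds

theorem curve_zero (θ : ℝ) : curve (0 : HolderEven s) θ = Complex.exp (θ * Complex.I) := by
  simp [curve]

theorem tangent_zero (θ : ℝ) :
    tangent (0 : HolderEven s) θ = Complex.I * Complex.exp (θ * Complex.I) := by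
  simp [tangent, radiusDeriv]

theorem exp_neg_mul_exp (θ : ℝ) :
    Complex.exp (-(θ * Complex.I)) * Complex.exp (θ * Complex.I) = 1 := by
  rw [← Complex.exp_add]; simp

theorem conj_exp (θ : ℝ) : (starRingEnd ℂ) (Complex.exp (θ * Complex.I)) =
    Complex.exp (-(θ * Complex.I)) := by
  rw [← Complex.exp_conj]; simp

theorem imageContourK_zero {ε q : ℝ} (hu : IsUnit (imageDenomK (s := s) hs1 (ε, q, 0))) (θ : ℝ)
    (α : Arc) : imageContourK hs0 hs1 (ε, q, 0) θ α = -(Complex.exp (-(θ * Complex.I)) *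
      imageQuotient ε q (Complex.exp (θ * Complex.I)) (Complex.exp ((θ - α : ℝ) * Complex.I))) := by
  rw [isGood_zero.imageContourK_apply hu, curve_zero, curve_zero, tangent_zero, tangent_zero,
    map_mul, conj_exp, conj_exp, Complex.conj_I]
  linear_combination (-(Complex.exp (-(θ * Complex.I)) *
      imageQuotient ε q (Complex.exp (θ * Complex.I)) (Complex.exp ((θ - α : ℝ) * Complex.I)))) *
      (exp_neg_mul_exp (θ - α) - Complex.exp (-((θ - α : ℝ) * Complex.I)) *
        Complex.exp ((θ - α : ℝ) * Complex.I) * Complex.I_sq)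

/-- At ε = 0 the quotient is the constant q/(1 - q²): the image acts as a uniform field. The
resulting multiple of sin θ is what determines Ω₀(q). -/
theorem imageMap_zero_of_fst {q : ℝ} (hq : 1 - q ^ 2 ≠ 0) (θ : ℝ) :
    imageMap (s := s) hs0 hs1 (0, q, 0) θ = q / (1 - q ^ 2) * Real.pi * Real.sin θ := by
  have h1 : ∀ α : Arc, (imageContourK hs0 hs1 ((0, q, 0) : ℝ × ℝ × HolderEven s) θ α).im =
      q / (1 - q ^ 2) * Real.sin θ := fun α => by
    rw [imageContourK_zero (isUnit_imageDenomK hs1 hq)]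
    have e : imageQuotient 0 q (Complex.exp (θ * Complex.I))
        (Complex.exp ((θ - α : ℝ) * Complex.I)) = ((q / (1 - q ^ 2) : ℝ) : ℂ) := by
      simp [imageQuotient, sq]
    have e3 : (Complex.exp (-(θ * Complex.I))).im = -Real.sin θ := by
      rw [← neg_mul, ← Complex.ofReal_neg, Complex.exp_ofReal_mul_I_im, Real.sin_neg]
    rw [e, Complex.neg_im, Complex.im_mul_ofReal, e3]
    ring
  rw [imageMap, map_smul, Pi.smul_apply, pushOne_apply]
  simp only [h1]
  rw [integral_arc_eq fun _ => q / (1 - q ^ 2) * Real.sin θ, intervalIntegral.integral_const]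
  simp only [smul_eq_mul]
  ring

/-- For a disc centred at the origin, rotation invariance makes the integrand independent of θ. The
symmetry of kernels then makes its imaginary part odd under the reflection of the arc, so the
integral vanishes, which permits the division by q. -/
theorem imageMap_zero_of_snd {ε : ℝ} (hu : IsUnit (imageDenomK (s := s) hs1 (ε, 0, 0))) :
    imageMap (s := s) hs0 hs1 (ε, 0, 0) = 0 := by
  have h1 : ∀ (θ : ℝ) (α : Arc), imageContourK hs0 hs1 ((ε, 0, 0) : ℝ × ℝ × HolderEven s) θ α =
      -((ε * Complex.exp (-(α * Complex.I))) /
        (1 - ε * (ε * Complex.exp (-(α * Complex.I))))) := fun θ α => by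
    have e : Complex.exp ((θ - α : ℝ) * Complex.I) =
        Complex.exp (θ * Complex.I) * Complex.exp (-(α * Complex.I)) := by
      rw [← Complex.exp_add]
      push_cast
      ring_nf
    have e2 : (ε * Complex.exp (-(θ * Complex.I)) + ((0 : ℝ) : ℂ)) *
        (ε * (Complex.exp (θ * Complex.I) * Complex.exp (-(α * Complex.I))) + ((0 : ℝ) : ℂ)) =
        ε * (ε * Complex.exp (-(α * Complex.I))) := by
      rw [Complex.ofReal_zero]
      linear_combination (ε * ε * Complex.exp (-(α * Complex.I)) : ℂ) * exp_neg_mul_exp θ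
    rw [imageContourK_zero hu, imageQuotient, conj_exp, e, e2, ← mul_div_assoc]
    congr 2
    rw [Complex.ofReal_zero]
    linear_combination (ε * Complex.exp (-(α * Complex.I)) : ℂ) * exp_neg_mul_exp θ
  refine HolderOdd.ext fun θ => ?_
  have h2 := integral_arc_reflect
    fun α => (imageContourK hs0 hs1 ((ε, 0, 0) : ℝ × ℝ × HolderEven s) θ α).im
  have h3 : ∀ α : Arc, (imageContourK hs0 hs1 ((ε, 0, 0) : ℝ × ℝ × HolderEven s) θ α.reflect).im =
      -(imageContourK hs0 hs1 ((ε, 0, 0) : ℝ × ℝ × HolderEven s) θ α).im := fun α => by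
    have h4 := symm_apply (imageContourK hs0 hs1 ((ε, 0, 0) : ℝ × ℝ × HolderEven s)) (-θ) α
    rw [neg_neg] at h4
    rw [h4, Complex.conj_im, h1, h1]
  simp only [h3, integral_neg] at h2
  rw [imageMap, map_smul, Pi.smul_apply, pushOne_apply, map_zero, Pi.zero_apply,
    show ∫ α : Arc, (imageContourK hs0 hs1 ((ε, 0, 0) : ℝ × ℝ × HolderEven s) θ α).im = 0 by
      linarith, smul_zero]

end

end

/-! ### Averages of C¹ maps and Hadamard's lemma. -/

section

open scoped Topology
open MeasureTheory

theorem aestronglyMeasurable_uIoc {G : Type*} [NormedAddCommGroup G] {g : ℝ → G}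
    (hg : ContinuousOn g (Set.Icc 0 1)) :
    AEStronglyMeasurable g (volume.restrict (Set.uIoc 0 1)) := by
  rw [Set.uIoc_of_le zero_le_one]
  exact (hg.mono Set.Ioc_subset_Icc_self).aestronglyMeasurable measurableSet_Ioc

/-- Averages over `t ∈ [0, 1]` of `φ (A t x)`, with `φ` of class `C¹` and `A t` linear, are of class
`C¹` in `x`. -/
theorem contDiffOn_integral_comp {E F : Type*} [NormedAddCommGroup E] [NormedSpace ℝ E]
    [NormedAddCommGroup F] [NormedSpace ℝ F] [CompleteSpace F] {φ : E → F} {S : Set E}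
    (hS : IsOpen S) (hφ : ContDiffOn ℝ 1 φ S) {A : ℝ → E →L[ℝ] E} (hA : Continuous A)
    (hAS : ∀ t ∈ Set.Icc (0 : ℝ) 1, ∀ x ∈ S, A t x ∈ S) :
    ContDiffOn ℝ 1 (fun x => ∫ t in (0 : ℝ)..1, φ (A t x)) S := by
  set ψ : ℝ → E → (E →L[ℝ] F) := fun t x => (fderiv ℝ φ (A t x)).comp (A t) with hψ
  have hφd : ∀ y ∈ S, HasFDerivAt φ (fderiv ℝ φ y) y := fun y hy =>
    ((hφ.contDiffAt (hS.mem_nhds hy)).differentiableAt one_ne_zero).hasFDerivAt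
  have hjoint : Continuous fun z : E × ℝ => A z.2 z.1 := by fun_prop
  have hψc : ∀ t ∈ Set.Icc (0 : ℝ) 1, ∀ x ∈ S,
      ContinuousAt (fun z : E × ℝ => ψ z.2 z.1) (x, t) := by
    intro t ht x hx
    have h1 : ContinuousAt (fderiv ℝ φ) (A t x) :=
      (hφ.continuousOn_fderiv_of_isOpen hS le_rfl).continuousAt (hS.mem_nhds (hAS t ht x hx))
    have h2 : ContinuousAt (fun z : E × ℝ => fderiv ℝ φ (A z.2 z.1)) (x, t) :=
      ContinuousAt.comp (g := fderiv ℝ φ) (f := fun z : E × ℝ => A z.2 z.1) h1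
        hjoint.continuousAt
    exact h2.clm_comp (hA.comp continuous_snd).continuousAt
  have hψt : ∀ x ∈ S, ContinuousOn (fun t => ψ t x) (Set.Icc 0 1) := fun x hx t ht =>
    (ContinuousAt.comp (f := fun t : ℝ => (x, t)) (g := fun z : E × ℝ => ψ z.2 z.1)
      (hψc t ht x hx) (by fun_prop)).continuousWithinAt
  have hφt : ∀ x ∈ S, ContinuousOn (fun t => φ (A t x)) (Set.Icc 0 1) := fun x hx =>
    hφ.continuousOn.comp (by fun_prop) fun t ht => hAS t ht x hx
  -- Joint continuity and compactness of [0, 1] give a bound near x₀ that is uniform in t; it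
  -- dominates the differentiation under the integral and the continuity of the derivative.
  have hbound : ∀ x₀ ∈ S, ∃ C, ∀ᶠ x in 𝓝 x₀, ∀ t ∈ Set.Icc (0 : ℝ) 1, ‖ψ t x‖ ≤ C := by
    intro x₀ hx₀
    obtain ⟨C, hC⟩ := (isCompact_Icc.bddAbove_image (hψt x₀ hx₀).norm)
    refine ⟨C + 1, isCompact_Icc.eventually_forall_of_forall_eventually fun t ht => ?_⟩
    have h1 : ‖ψ t x₀‖ < C + 1 := by linarith [hC ⟨t, ht, rfl⟩]
    exact ((hψc t ht x₀ hx₀).norm.eventually_lt_const h1).mono fun z hz => hz.le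
  have hIoc : ∀ {t : ℝ}, t ∈ Set.uIoc (0 : ℝ) 1 → t ∈ Set.Icc (0 : ℝ) 1 := fun ht => by
    rw [Set.uIoc_of_le zero_le_one] at ht
    exact Set.Ioc_subset_Icc_self ht
  have hderiv : ∀ x₀ ∈ S, HasFDerivAt (fun x => ∫ t in (0 : ℝ)..1, φ (A t x))
      (∫ t in (0 : ℝ)..1, ψ t x₀) x₀ := by
    intro x₀ hx₀
    obtain ⟨C, hC⟩ := hbound x₀ hx₀
    refine intervalIntegral.hasFDerivAt_integral_of_dominated_of_fderiv_le
      (F := fun x t => φ (A t x)) (F' := fun x t => ψ t x) (μ := volume)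
      (s := {x | x ∈ S ∧ ∀ t ∈ Set.Icc (0 : ℝ) 1, ‖ψ t x‖ ≤ C}) (bound := fun _ => C)
      ((hS.eventually_mem hx₀).and hC) ?_ ?_ (aestronglyMeasurable_uIoc (hψt x₀ hx₀)) ?_ intervalIntegrable_const ?_
    · filter_upwards [hS.eventually_mem hx₀] with x hx
      exact aestronglyMeasurable_uIoc (hφt x hx)
    · refine ContinuousOn.intervalIntegrable ?_
      rw [Set.uIcc_of_le zero_le_one]
      exact hφt x₀ hx₀
    · exact Filter.Eventually.of_forall fun t ht x hx => hx.2 t (hIoc ht)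
    · exact Filter.Eventually.of_forall fun t ht x hx =>
        (hφd _ (hAS t (hIoc ht) x hx.1)).comp x (A t).hasFDerivAt
  intro x₀ hx₀
  refine ContDiffAt.contDiffWithinAt ?_
  rw [contDiffAt_one_iff]
  refine ⟨fun x => ∫ t in (0 : ℝ)..1, ψ t x, S, hS.mem_nhds hx₀, fun x hx => ?_, hderiv⟩
  obtain ⟨C, hC⟩ := hbound x hx
  refine ContinuousAt.continuousWithinAt ?_
  refine intervalIntegral.continuousAt_of_dominated_interval (bound := fun _ => C) ?_ ?_
    intervalIntegrable_const ?_
  · filter_upwards [hS.eventually_mem hx] with y hy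
    exact aestronglyMeasurable_uIoc (hψt y hy)
  · filter_upwards [hC] with y hy
    exact Filter.Eventually.of_forall fun t ht => hy t (hIoc ht)
  · exact Filter.Eventually.of_forall fun t ht =>
      ContinuousAt.comp (f := fun y : E => (y, t)) (g := fun z : E × ℝ => ψ z.2 z.1)
        (hψc t (hIoc ht) x hx) (by fun_prop)

/-- Hadamard's lemma: a function of class `C²` that vanishes for `q = 0` is `q` times a function of
class `C¹`. -/
theorem exists_eq_smul_of_eq_zero {X F : Type*} [NormedAddCommGroup X] [NormedSpace ℝ X]
    [NormedAddCommGroup F] [NormedSpace ℝ F] [CompleteSpace F] {f : ℝ × X → F} {S : Set (ℝ × X)}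
    (hS : IsOpen S) (hstar : ∀ q x t, (q, x) ∈ S → t ∈ Set.Icc (0 : ℝ) 1 → (t * q, x) ∈ S)
    (hf : ContDiffOn ℝ 2 f S) (h0 : ∀ x, (0, x) ∈ S → f (0, x) = 0) :
    ∃ g : ℝ × X → F, ContDiffOn ℝ 1 g S ∧ ∀ q x, (q, x) ∈ S → f (q, x) = q • g (q, x) := by
  -- The quotient is the average over t in [0, 1] of the partial derivative of f in its first
  -- variable at (tq, x). It has one derivative less than f.
  set φ : ℝ × X → F := fun p => fderiv ℝ f p (1, 0) with hφdef
  have hφ : ContDiffOn ℝ 1 φ S :=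
    (hf.fderiv_of_isOpen hS (by norm_num)).clm_apply contDiffOn_const
  set A : ℝ → (ℝ × X →L[ℝ] ℝ × X) := fun t =>
    (t • ContinuousLinearMap.fst ℝ ℝ X).prod (ContinuousLinearMap.snd ℝ ℝ X) with hAdef
  have hA : Continuous A := by
    have h1 : ∀ t, A t = t • (ContinuousLinearMap.inl ℝ ℝ X).comp (ContinuousLinearMap.fst ℝ ℝ X) +
        (ContinuousLinearMap.inr ℝ ℝ X).comp (ContinuousLinearMap.snd ℝ ℝ X) := fun t => by
      ext <;> simp [hAdef]
    rw [funext h1]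
    fun_prop
  have hAv : ∀ t q x, A t (q, x) = (t * q, x) := fun t q x => rfl
  refine ⟨fun p => ∫ t in (0 : ℝ)..1, φ (A t p), contDiffOn_integral_comp hS hφ hA
    fun t ht p hp => hstar p.1 p.2 t hp ht, fun q x hqx => ?_⟩
  have hd : ∀ t ∈ Set.uIcc (0 : ℝ) 1, HasDerivAt (fun t : ℝ => f (t * q, x)) (q • φ (t * q, x)) t := by
    intro t ht
    rw [Set.uIcc_of_le zero_le_one] at ht
    have h1 := ((hf.contDiffAt (hS.mem_nhds (hstar q x t hqx ht))).differentiableAt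
      two_ne_zero).hasFDerivAt
    have h2 : HasDerivAt (fun t : ℝ => (t * q, x)) (q, 0) t := by
      simpa using ((hasDerivAt_id t).mul_const q).prodMk (hasDerivAt_const t x)
    have h3 := h1.comp_hasDerivAt t h2
    have h4 : ((q, 0) : ℝ × X) = q • (1, 0) := by simp
    rw [h4, map_smul] at h3
    exact h3
  have hc : ContinuousOn (fun t : ℝ => q • φ (t * q, x)) (Set.uIcc 0 1) := by
    rw [Set.uIcc_of_le zero_le_one]
    exact (hφ.continuousOn.comp (by fun_prop) fun t ht => hstar q x t hqx ht).const_smul q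
  have h5 := intervalIntegral.integral_eq_sub_of_hasDerivAt hd hc.intervalIntegrable
  rw [one_mul, zero_mul, h0 x (by simpa using hstar q x 0 hqx (by simp)), sub_zero,
    intervalIntegral.integral_smul] at h5
  simp only [hAv]
  exact h5.symm

end

/-! ### Fourier coefficients of the logarithm of the chord. -/

section

open scoped BoundedContinuousFunction Topology
open MeasureTheory Kernel

/-- Integration by parts against `log (2 sin (α / 2))`. -/
theorem integral_logChord_mul {g g' V : ℝ → ℝ} (hg : ∀ α, HasDerivAt g (g' α) α)
    (hg' : Continuous g') (hV : Continuous V) (hgV : ∀ α, g α = 2 * Real.sin (α / 2) * V α) :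
    ∫ α in (0 : ℝ)..(2 * Real.pi), logChord α * g' α =
      -∫ α in (0 : ℝ)..(2 * Real.pi), Real.cos (α / 2) * V α := by
  have hi1 : IntervalIntegrable (fun α => logChord α * g' α) volume 0 (2 * Real.pi) :=
    intervalIntegrable_logChord.mul_continuousOn hg'.continuousOn
  have hi2 : IntervalIntegrable (fun α => Real.cos (α / 2) * V α) volume 0 (2 * Real.pi) :=
    Continuous.intervalIntegrable (by fun_prop) _ _
  -- In the form x log x · V with x = 2 sin(α/2), the product is continuous up to the endpoints and
  -- vanishes there, so there are no boundary terms.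
  have hF : ∀ α, logChord α * g α =
      2 * Real.sin (α / 2) * Real.log (2 * Real.sin (α / 2)) * V α := fun α => by
    rw [hgV, logChord]; ring
  have h := intervalIntegral.integral_eq_sub_of_hasDerivAt_of_le
    (f := fun α => logChord α * g α)
    (f' := fun α => logChord α * g' α + Real.cos (α / 2) * V α) (a := 0) (b := 2 * Real.pi)
    (by positivity) ?_ ?_ (hi1.add hi2)
  · rw [intervalIntegral.integral_add hi1 hi2] at h
    simp only [hF] at h
    have e : 2 * Real.pi / 2 = Real.pi := by ring
    simp [e] at h
    linarith
  · simp only [hF]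
    have h1 : Continuous fun α : ℝ => 2 * Real.sin (α / 2) := by fun_prop
    exact ((Real.continuous_mul_log.comp h1).mul hV).continuousOn
  · intro α hα
    have hs := sin_half_pos ⟨α, hα⟩
    simp only at hs
    have h1 : HasDerivAt (fun α : ℝ => 2 * Real.sin (α / 2)) (Real.cos (α / 2)) α := by
      have h2 := (((hasDerivAt_id α).div_const 2).sin).const_mul 2
      refine h2.congr_deriv ?_
      simp
      ring
    have h2 : HasDerivAt logChord (Real.cos (α / 2) / (2 * Real.sin (α / 2))) α :=
      h1.log (by positivity)
    refine (h2.mul (hg α)).congr_deriv ?_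
    rw [hgV]
    field_simp
    ring

/-- V is the sum of cos((k + ½)α) over k < n, by telescoping. Step n adds ½ cos((n + 1)α) + ½
cos(nα) to the integrand, and this has nonzero integral only for n = 0, where the integral is π. -/
theorem exists_sin_eq_mul (n : ℕ) : ∃ V : ℝ → ℝ, Continuous V ∧
    (∀ α, Real.sin (n * α) = 2 * Real.sin (α / 2) * V α) ∧
    ∫ α in (0 : ℝ)..(2 * Real.pi), Real.cos (α / 2) * V α = if n = 0 then 0 else Real.pi := by
  induction n with
  | zero => exact ⟨fun _ => 0, continuous_const, by simp, by simp⟩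
  | succ n ih =>
    obtain ⟨V, hV, h1, h2⟩ := ih
    refine ⟨fun α => V α + Real.cos ((n + 1 / 2) * α), by fun_prop, fun α => ?_, ?_⟩
    · rw [mul_add, ← h1]
      have e1 : ((n + 1 : ℕ) : ℝ) * α = (n + 1 / 2) * α + α / 2 := by push_cast; ring
      have e2 : (n : ℝ) * α = (n + 1 / 2) * α - α / 2 := by ring
      rw [e1, e2, Real.sin_add, Real.sin_sub]
      ring
    · have e : ∀ α : ℝ, Real.cos (α / 2) * (V α + Real.cos ((n + 1 / 2) * α)) =
          Real.cos (α / 2) * V α +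
            (1 / 2 * Real.cos ((n + 1 : ℕ) * α) + 1 / 2 * Real.cos (n * α)) := fun α => by
        have e1 : ((n + 1 : ℕ) : ℝ) * α = (n + 1 / 2) * α + α / 2 := by push_cast; ring
        have e2 : (n : ℝ) * α = (n + 1 / 2) * α - α / 2 := by ring
        rw [e1, e2, Real.cos_add, Real.cos_sub]
        ring
      have hcos : ∀ m : ℕ, ∫ α in (0 : ℝ)..(2 * Real.pi), Real.cos (m * α) =
          if m = 0 then 2 * Real.pi else 0 := by
        intro m
        split_ifs with hm
        · subst hm; simp
        · have hm' : (m : ℝ) ≠ 0 := by exact_mod_cast hm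
          rw [intervalIntegral.integral_comp_mul_left (fun x => Real.cos x) hm', integral_cos]
          have : Real.sin (m * (2 * Real.pi)) = 0 := by
            rw [show (m : ℝ) * (2 * Real.pi) = ((2 * m : ℕ) : ℝ) * Real.pi by push_cast; ring]
            exact Real.sin_nat_mul_pi _
          simp [this]
      have hi : ∀ m : ℕ, IntervalIntegrable (fun α : ℝ => 1 / 2 * Real.cos (m * α)) volume 0
          (2 * Real.pi) := fun m => Continuous.intervalIntegrable (by fun_prop) _ _
      simp only [e]
      rw [intervalIntegral.integral_add (Continuous.intervalIntegrable (by fun_prop) _ _)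
        ((hi _).add (hi _)), intervalIntegral.integral_add (hi _) (hi _),
        intervalIntegral.integral_const_mul, intervalIntegral.integral_const_mul, hcos, hcos, h2]
      split_ifs <;> simp_all

/-- The cosine coefficients of `log (2 sin (α / 2))`. -/
theorem integral_logChord_mul_cos {n : ℕ} (hn : n ≠ 0) :
    ∫ α in (0 : ℝ)..(2 * Real.pi), logChord α * Real.cos (n * α) = -(Real.pi / n) := by
  obtain ⟨V, hV, h1, h2⟩ := exists_sin_eq_mul n
  have hn' : (n : ℝ) ≠ 0 := by exact_mod_cast hn
  have h := integral_logChord_mul (g := fun α => Real.sin (n * α))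
    (g' := fun α => n * Real.cos (n * α)) (V := V) (fun α => by
      have := ((hasDerivAt_id α).const_mul (n : ℝ)).sin
      refine this.congr_deriv ?_
      simp
      ring) (by fun_prop) hV h1
  rw [h2, if_neg hn] at h
  have e : ∀ α : ℝ, logChord α * (n * Real.cos (n * α)) =
      n * (logChord α * Real.cos (n * α)) := fun α => by ring
  simp only [e] at h
  rw [intervalIntegral.integral_const_mul] at h
  field_simp
  linarith

theorem integral_sub_mul_sin {n : ℕ} (hn : n ≠ 0) :
    ∫ α in (0 : ℝ)..(2 * Real.pi), (Real.pi - α) * Real.sin (n * α) = 2 * Real.pi / n := by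
  have hn' : (n : ℝ) ≠ 0 := by exact_mod_cast hn
  have h := intervalIntegral.integral_eq_sub_of_hasDerivAt
    (f := fun α => -((Real.pi - α) * Real.cos (n * α)) / n - Real.sin (n * α) / n ^ 2)
    (f' := fun α => (Real.pi - α) * Real.sin (n * α)) (a := 0) (b := 2 * Real.pi) ?_
    (Continuous.intervalIntegrable (by fun_prop) _ _)
  · rw [h]
    have h1 : Real.sin (n * (2 * Real.pi)) = 0 := by
      rw [show (n : ℝ) * (2 * Real.pi) = ((2 * n : ℕ) : ℝ) * Real.pi by push_cast; ring]
      exact Real.sin_nat_mul_pi _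
    have h2 : Real.cos (n * (2 * Real.pi)) = 1 := Real.cos_nat_mul_two_pi n
    rw [h1, h2]
    simp
    ring
  · intro α _
    have h1 : HasDerivAt (fun α : ℝ => (n : ℝ) * α) n α := by
      simpa using (hasDerivAt_id α).const_mul (n : ℝ)
    have h2 : HasDerivAt (fun α : ℝ => Real.pi - α) (-1) α := by
      simpa using (hasDerivAt_id α).const_sub Real.pi
    refine ((((h2.mul h1.cos).neg).div_const _).sub (h1.sin.div_const _)).congr_deriv ?_
    field_simp
    ring

/-- The kernel `-cos α log (2 sin (α / 2)) - ½ (π - α) sin α`, whose cosine coefficients are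
`π / (n - 1)`. -/
def resolventWeight (α : ℝ) : ℝ :=
  -(logChord α * Real.cos α) - 1 / 2 * ((Real.pi - α) * Real.sin α)

theorem intervalIntegrable_resolventWeight :
    IntervalIntegrable resolventWeight volume 0 (2 * Real.pi) :=
  (intervalIntegrable_logChord.mul_continuousOn Real.continuous_cos.continuousOn).neg.sub
    (Continuous.intervalIntegrable (by fun_prop) _ _)

/-- By product-to-sum formulas only the modes n - 1 and n + 1 enter. The logarithm contributes
(π/2)(1/(n - 1) + 1/(n + 1)) and the sawtooth π - α contributes (π/2)(1/(n - 1) - 1/(n + 1)), so the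
terms in n + 1 cancel. -/
theorem integral_resolventWeight_mul_cos {n : ℕ} (hn : 2 ≤ n) :
    ∫ α in (0 : ℝ)..(2 * Real.pi), resolventWeight α * Real.cos (n * α) =
      Real.pi / (n - 1) := by
  obtain ⟨m, rfl⟩ : ∃ m, n = m + 1 := ⟨n - 1, by omega⟩
  have hm : m ≠ 0 := by omega
  have e : ∀ α : ℝ, resolventWeight α * Real.cos ((m + 1 : ℕ) * α) =
      (-(1 / 2)) * (logChord α * Real.cos ((m + 2 : ℕ) * α)) +
      (-(1 / 2)) * (logChord α * Real.cos (m * α)) +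
      ((-(1 / 4)) * ((Real.pi - α) * Real.sin ((m + 2 : ℕ) * α)) +
      (1 / 4) * ((Real.pi - α) * Real.sin (m * α))) := fun α => by
    have e1 : ((m + 2 : ℕ) : ℝ) * α = (m + 1 : ℕ) * α + α := by push_cast; ring
    have e2 : (m : ℝ) * α = (m + 1 : ℕ) * α - α := by push_cast; ring
    rw [e1, e2, Real.cos_add, Real.cos_sub, Real.sin_add, Real.sin_sub, resolventWeight]
    ring
  have i1 : ∀ k : ℕ, IntervalIntegrable (fun α => (-(1 / 2)) * (logChord α * Real.cos (k * α)))
      volume 0 (2 * Real.pi) := fun k =>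
    (intervalIntegrable_logChord.mul_continuousOn
      (Continuous.continuousOn (by fun_prop))).const_mul _
  have i2 : ∀ (c : ℝ) (k : ℕ), IntervalIntegrable
      (fun α => c * ((Real.pi - α) * Real.sin (k * α))) volume 0 (2 * Real.pi) := fun c k =>
    Continuous.intervalIntegrable (by fun_prop) _ _
  simp only [e]
  rw [intervalIntegral.integral_add ((i1 _).add (i1 _)) ((i2 _ _).add (i2 _ _)),
    intervalIntegral.integral_add (i1 _) (i1 _), intervalIntegral.integral_add (i2 _ _) (i2 _ _)]
  simp only [intervalIntegral.integral_const_mul]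
  rw [integral_logChord_mul_cos hm, integral_logChord_mul_cos (by omega : m + 2 ≠ 0),
    integral_sub_mul_sin hm, integral_sub_mul_sin (by omega : m + 2 ≠ 0)]
  have hm' : (m : ℝ) ≠ 0 := by exact_mod_cast hm
  have hm2 : (m : ℝ) + 2 ≠ 0 := by positivity
  push_cast
  rw [add_sub_cancel_right]
  field_simp
  ring

end

/-! ### Convolutions and sine coefficients of odd Hölder functions. -/

section

open scoped BoundedContinuousFunction Topology
open MeasureTheory Kernel

theorem norm_I_mul_ofReal (x : ℝ) : ‖Complex.I * (x : ℂ)‖ = |x| := by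
  rw [norm_mul, Complex.norm_I, one_mul, Complex.norm_real, Real.norm_eq_abs]

namespace HolderOdd

variable {s : ℝ≥0}

theorem continuous (hs0 : 0 < s) (f : HolderOdd s) : Continuous (f : ℝ → ℝ) :=
  f.memHolder.holderWith.continuous hs0

/-- The kernel `i f(θ - α)`. -/
def shiftK (hs0 : 0 < s) : HolderOdd s →L[ℝ] Kernel s :=
  Kernel.clmOfBound (fun f θ α => Complex.I * ((f (θ - α) : ℝ) : ℂ)) 1
    (fun f θ => by
      have := f.continuous hs0
      fun_prop)
    (fun f θ α => by
      rw [norm_I_mul_ofReal, one_mul]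
      exact f.abs_apply_le _)
    (fun f x y α => by
      rw [← mul_sub, ← Complex.ofReal_sub, norm_I_mul_ofReal, one_mul]
      simpa using f.abs_sub_apply_le (x - α) (y - α))
    (fun f θ α => by rw [add_sub_right_comm, f.periodic])
    (fun f θ α => by
      rw [Arc.coe_reflect, show -θ - (2 * Real.pi - α) = -(θ - α) - 2 * Real.pi by ring,
        f.periodic.sub_eq, f.odd]
      simp)
    (fun f g θ α => by simp [mul_add]) (fun c f θ α => by simp; ring)

/-- Convolution with an even integrable function. -/
def conv (hs0 : 0 < s) {w : ℝ → ℝ} (hw : IntervalIntegrable w volume 0 (2 * Real.pi))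
    (hsymm : ∀ α, w (2 * Real.pi - α) = w α) : HolderOdd s →L[ℝ] HolderOdd s :=
  (push (integralIm (fun α => w α) (integrable_arc hw))
    (isOddFunctional_integralIm _ fun α => hsymm α)).comp (shiftK hs0)

theorem conv_apply (hs0 : 0 < s) {w : ℝ → ℝ} (hw : IntervalIntegrable w volume 0 (2 * Real.pi))
    (hsymm : ∀ α, w (2 * Real.pi - α) = w α) (f : HolderOdd s) (θ : ℝ) :
    conv hs0 hw hsymm f θ = ∫ α : Arc, w α * f (θ - α) := by
  change ∫ α : Arc, w α * (Complex.I * ((f (θ - α) : ℝ) : ℂ)).im = _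
  simp

/-- The sine coefficients (up to a factor `π`). -/
def sineCoeff (n : ℕ) (f : HolderOdd s) : ℝ :=
  ∫ θ in (0 : ℝ)..(2 * Real.pi), f θ * Real.sin (n * θ)

theorem intervalIntegrable_mul (hs0 : 0 < s) (f : HolderOdd s) {g : ℝ → ℝ} (hg : Continuous g)
    (a b : ℝ) : IntervalIntegrable (fun θ => f θ * g θ) volume a b :=
  ((f.continuous hs0).mul hg).intervalIntegrable _ _

theorem sineCoeff_add (hs0 : 0 < s) (n : ℕ) (f g : HolderOdd s) :
    sineCoeff n (f + g) = sineCoeff n f + sineCoeff n g := by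
  rw [sineCoeff, sineCoeff, sineCoeff,
    ← intervalIntegral.integral_add (intervalIntegrable_mul hs0 f (by fun_prop) _ _)
      (intervalIntegrable_mul hs0 g (by fun_prop) _ _)]
  simp [add_mul]

theorem sineCoeff_smul (n : ℕ) (c : ℝ) (f : HolderOdd s) :
    sineCoeff n (c • f) = c * sineCoeff n f := by
  rw [sineCoeff, sineCoeff, ← intervalIntegral.integral_const_mul]
  simp [mul_assoc]

theorem integral_mul_cos_eq_zero (f : HolderOdd s) (n : ℕ) :
    ∫ θ in (0 : ℝ)..(2 * Real.pi), f θ * Real.cos (n * θ) = 0 := by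
  have h1 := intervalIntegral.integral_comp_sub_left (a := 0) (b := 2 * Real.pi)
    (fun θ => f θ * Real.cos (n * θ)) (2 * Real.pi)
  have h2 : ∀ θ : ℝ, f (2 * Real.pi - θ) * Real.cos (n * (2 * Real.pi - θ)) =
      -(f θ * Real.cos (n * θ)) := fun θ => by
    rw [show 2 * Real.pi - θ = -θ + 2 * Real.pi by ring, f.periodic, f.odd, mul_add,
      Real.cos_add_nat_mul_two_pi, mul_neg, Real.cos_neg]
    ring
  simp only [h2, intervalIntegral.integral_neg, sub_self, sub_zero] at h1
  linarith

theorem integral_shift_mul_sin (hs0 : 0 < s) (f : HolderOdd s) (n : ℕ) (α : ℝ) :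
    ∫ θ in (0 : ℝ)..(2 * Real.pi), f (θ - α) * Real.sin (n * θ) =
      Real.cos (n * α) * sineCoeff n f := by
  have hp : Function.Periodic (fun θ => f θ * Real.sin (n * (θ + α))) (2 * Real.pi) := fun θ => by
    simp only [f.periodic θ]
    rw [show (n : ℝ) * (θ + 2 * Real.pi + α) = n * (θ + α) + n * (2 * Real.pi) by ring,
      Real.sin_add_nat_mul_two_pi]
  have h1 : ∫ θ in (0 : ℝ)..(2 * Real.pi), f (θ - α) * Real.sin (n * θ) =
      ∫ θ in (0 : ℝ)..(2 * Real.pi), f θ * Real.sin (n * (θ + α)) := by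
    have h2 := intervalIntegral.integral_comp_sub_right (a := 0) (b := 2 * Real.pi)
      (fun θ => f θ * Real.sin (n * (θ + α))) α
    simp only [sub_add_cancel] at h2
    have h3 := hp.intervalIntegral_add_eq (0 - α) 0
    rw [h2, show 2 * Real.pi - α = 0 - α + 2 * Real.pi by ring, h3, zero_add]
  have h4 : ∀ θ : ℝ, f θ * Real.sin (n * (θ + α)) =
      Real.cos (n * α) * (f θ * Real.sin (n * θ)) + Real.sin (n * α) * (f θ * Real.cos (n * θ)) :=
    fun θ => by rw [mul_add, Real.sin_add]; ring
  rw [h1]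
  simp only [h4]
  rw [intervalIntegral.integral_add
    ((intervalIntegrable_mul hs0 f (by fun_prop) _ _).const_mul _)
    ((intervalIntegrable_mul hs0 f (by fun_prop) _ _).const_mul _),
    intervalIntegral.integral_const_mul, intervalIntegral.integral_const_mul,
    integral_mul_cos_eq_zero, mul_zero, add_zero, sineCoeff]

/-- By Fubini it suffices to know the coefficient of a translate: translation by α multiplies it by
cos(nα), because the cosine coefficients of an odd function vanish. -/
theorem sineCoeff_conv (hs0 : 0 < s) {w : ℝ → ℝ}
    (hw : IntervalIntegrable w volume 0 (2 * Real.pi))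
    (hsymm : ∀ α, w (2 * Real.pi - α) = w α) (f : HolderOdd s) (n : ℕ) :
    sineCoeff n (conv hs0 hw hsymm f) =
      (∫ α in (0 : ℝ)..(2 * Real.pi), w α * Real.cos (n * α)) * sineCoeff n f := by
  have hc := f.continuous hs0
  have h1 : ∀ θ : ℝ, conv hs0 hw hsymm f θ * Real.sin (n * θ) =
      ∫ α in Set.Ioc 0 (2 * Real.pi), w α * f (θ - α) * Real.sin (n * θ) := fun θ => by
    rw [conv_apply, integral_arc_eq fun α => w α * f (θ - α), integral_mul_const,
      intervalIntegral.integral_of_le (by positivity)]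
  rw [sineCoeff]
  simp only [h1]
  have hint : Integrable (Function.uncurry fun θ α => w α * f (θ - α) * Real.sin (n * θ))
      ((volume.restrict (Set.uIoc 0 (2 * Real.pi))).prod
        (volume.restrict (Set.Ioc 0 (2 * Real.pi)))) := by
    have hw' : Integrable w (volume.restrict (Set.Ioc 0 (2 * Real.pi))) :=
      (intervalIntegrable_iff_integrableOn_Ioc_of_le (by positivity)).1 hw
    rw [Set.uIoc_of_le (by positivity)]
    have h2 := hw'.comp_snd (volume.restrict (Set.Ioc 0 (2 * Real.pi)))
    have h3 := h2.mul_bdd (g := fun z : ℝ × ℝ => f (z.1 - z.2) * Real.sin (n * z.1)) (c := ‖f‖)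
      (Continuous.aestronglyMeasurable (by fun_prop))
      (Filter.Eventually.of_forall fun z => by
        rw [norm_mul, Real.norm_eq_abs, Real.norm_eq_abs]
        have := f.abs_apply_le (z.1 - z.2)
        have h4 := Real.abs_sin_le_one (n * z.1)
        nlinarith [abs_nonneg (f (z.1 - z.2))])
    refine h3.congr (Filter.Eventually.of_forall fun z => ?_)
    simp [Function.uncurry, mul_assoc]
  rw [intervalIntegral_integral_swap hint]
  have h5 : ∀ α : ℝ, ∫ θ in (0 : ℝ)..(2 * Real.pi), w α * f (θ - α) * Real.sin (n * θ) =
      w α * Real.cos (n * α) * sineCoeff n f := fun α => by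
    simp only [mul_assoc]
    rw [intervalIntegral.integral_const_mul, integral_shift_mul_sin hs0]
  simp only [h5]
  rw [integral_mul_const, intervalIntegral.integral_of_le (by positivity)]

/-- An odd function is determined by its sine coefficients. -/
theorem eq_zero_of_sineCoeff (hs0 : 0 < s) {f : HolderOdd s}
    (h : ∀ n : ℕ, n ≠ 0 → sineCoeff n f = 0) : f = 0 := by
  have hall : ∀ n : ℕ, sineCoeff n f = 0 := fun n => by
    rcases eq_or_ne n 0 with rfl | hn
    · simp [sineCoeff]
    · exact h n hn
  have hT : Fact (0 < 2 * Real.pi) := ⟨by positivity⟩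
  have hp : Function.Periodic (fun θ => (f θ : ℂ)) (2 * Real.pi) := fun θ => by
    simp only [f.periodic θ]
  let F : C(AddCircle (2 * Real.pi), ℂ) := ⟨hp.lift, by
    refine continuous_quot_lift _ ?_
    have := f.continuous hs0
    fun_prop⟩
  have hF : ∀ θ : ℝ, F (θ : AddCircle (2 * Real.pi)) = f θ := fun θ => hp.lift_coe θ
  have hzero : fourierCoeff F = 0 := by
    funext n
    rw [fourierCoeff_eq_intervalIntegral F n 0, zero_add]
    obtain ⟨m, c, hn, hc⟩ : ∃ (m : ℕ) (c : ℝ), (n : ℝ) = c * m ∧ (c = 1 ∨ c = -1) := by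
      obtain ⟨m, rfl | rfl⟩ := n.eq_nat_or_neg
      · exact ⟨m, 1, by simp, Or.inl rfl⟩
      · exact ⟨m, -1, by simp, Or.inr rfl⟩
    have e : ∀ θ : ℝ, (fourier (-n)) (θ : AddCircle (2 * Real.pi)) • F θ =
        ((f θ * Real.cos (m * θ) : ℝ) : ℂ) -
          Complex.I * c * ((f θ * Real.sin (m * θ) : ℝ) : ℂ) := fun θ => by
      rw [hF, fourier_coe_apply]
      have h1 : 2 * Real.pi * Complex.I * ((-n : ℤ) : ℂ) * θ / ((2 * Real.pi : ℝ) : ℂ) =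
          ((-(n * θ) : ℝ) : ℂ) * Complex.I := by
        have : (Real.pi : ℂ) ≠ 0 := by exact_mod_cast Real.pi_ne_zero
        push_cast
        field_simp
      rw [h1, Complex.exp_mul_I, ← Complex.ofReal_cos, ← Complex.ofReal_sin, Real.cos_neg,
        Real.sin_neg, hn]
      rcases hc with rfl | rfl
      · rw [one_mul, smul_eq_mul]
        push_cast
        ring
      · rw [neg_one_mul, neg_mul, Real.cos_neg, Real.sin_neg, smul_eq_mul]
        push_cast
        ring
    simp only [e]
    rw [intervalIntegral.integral_sub, intervalIntegral.integral_const_mul,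
      intervalIntegral.integral_ofReal, intervalIntegral.integral_ofReal,
      integral_mul_cos_eq_zero]
    · have := hall m
      rw [sineCoeff] at this
      rw [this]
      simp
    · have := f.continuous hs0
      exact Continuous.intervalIntegrable (by fun_prop) _ _
    · have := f.continuous hs0
      exact Continuous.intervalIntegrable (by fun_prop) _ _
  -- A continuous function with summable Fourier coefficients is the pointwise sum of its series,
  -- here the zero series.
  have hsum : Summable (fourierCoeff F) := by rw [hzero]; exact summable_zero
  refine HolderOdd.ext fun θ => ?_
  have h2 := has_pointwise_sum_fourier_series_of_summable hsum (θ : AddCircle (2 * Real.pi))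
  rw [hzero, hF] at h2
  simp only [Pi.zero_apply, zero_smul] at h2
  have h3 := h2.unique hasSum_zero
  simpa using h3

/-- The function `sin θ`. -/
def sine (hs1 : s ≤ 1) : HolderOdd s := pushMid (sinK hs1)

@[simp] theorem sine_apply (hs1 : s ≤ 1) (θ : ℝ) : sine hs1 θ = Real.sin θ := by
  have h : sinK hs1 θ Arc.mid = Complex.I * (Real.sin θ : ℂ) := by
    rw [sinK, smul_apply, Kernel.sub_apply]
    change ((2⁻¹ : ℝ) : ℂ) * (Complex.exp (θ * Complex.I) - Complex.exp (-(θ * Complex.I))) = _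
    rw [Complex.ofReal_sin, Complex.sin, neg_mul]
    push_cast
    linear_combination (-(Complex.exp (-(θ * Complex.I)) - Complex.exp (θ * Complex.I)) / 2) *
      Complex.I_sq
  rw [sine, pushMid_apply, h]
  simp [-Complex.ofReal_sin]

theorem sineCoeff_sine (hs1 : s ≤ 1) (n : ℕ) :
    sineCoeff n (sine hs1) = if n = 1 then Real.pi else 0 := by
  have e : ∀ θ : ℝ, sine hs1 θ * Real.sin (n * θ) =
      1 / 2 * Real.cos ((n - 1) * θ) - 1 / 2 * Real.cos ((n + 1) * θ) := fun θ => by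
    rw [sine_apply, sub_mul, add_mul, one_mul, Real.cos_sub, Real.cos_add]
    ring
  -- Integer frequencies are needed because n - 1 is negative when n = 0.
  have hcos : ∀ m : ℤ, ∫ α in (0 : ℝ)..(2 * Real.pi), Real.cos (m * α) =
      if m = 0 then 2 * Real.pi else 0 := by
    intro m
    split_ifs with hm
    · subst hm; simp
    · have hm' : (m : ℝ) ≠ 0 := by exact_mod_cast hm
      rw [intervalIntegral.integral_comp_mul_left (fun x => Real.cos x) hm', integral_cos]
      have : Real.sin (m * (2 * Real.pi)) = 0 := by
        rw [show (m : ℝ) * (2 * Real.pi) = ((2 * m : ℤ) : ℝ) * Real.pi by push_cast; ring]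
        exact Real.sin_int_mul_pi _
      simp [this]
  have h1 := hcos (n - 1)
  have h2 := hcos (n + 1)
  rw [if_neg (by omega)] at h2
  push_cast at h1 h2
  rw [sineCoeff]
  simp only [e]
  rw [intervalIntegral.integral_sub (Continuous.intervalIntegrable (by fun_prop) _ _)
    (Continuous.intervalIntegrable (by fun_prop) _ _), intervalIntegral.integral_const_mul,
    intervalIntegral.integral_const_mul, h1, h2]
  by_cases hn : n = 1
  · subst hn; simp
  · rw [if_neg (by omega), if_neg hn]; simp

end HolderOdd

end

/-! ### The linearized operator and its inverse. -/

section

open scoped BoundedContinuousFunction Topology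
open MeasureTheory Kernel

variable {s : ℝ≥0}

/-- The derivative, as an operator from `X^{1,s}` to `Y^s`. -/
def HolderEven.derivOdd : HolderEven s →L[ℝ] HolderOdd s :=
  LinearMap.mkContinuous
    { toFun := fun r => HolderOdd.mk (deriv r) ⟨isHolder_deriv r.toFun_mem, r.deriv_odd⟩
      map_add' := fun f g => HolderOdd.toFun_injective (f.deriv_add g)
      map_smul' := fun c f => HolderOdd.toFun_injective (f.deriv_smul c) } 1 fun r => by
    rw [one_mul]
    change holderNorm s (deriv r) ≤ ‖r‖
    rw [HolderEven.norm_def]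
    linarith [supNorm_nonneg r]

@[simp] theorem HolderEven.derivOdd_apply (r : HolderEven s) (θ : ℝ) : r.derivOdd θ = deriv r θ :=
  rfl

namespace HolderOdd

/-- The mean-zero primitive of an odd function. -/
def primitiveFun (f : HolderOdd s) (θ : ℝ) : ℝ :=
  (∫ x in (0 : ℝ)..θ, f x) -
    (2 * Real.pi)⁻¹ * ∫ y in (0 : ℝ)..(2 * Real.pi), ∫ x in (0 : ℝ)..y, f x

theorem hasDerivAt_primitiveFun (hs0 : 0 < s) (f : HolderOdd s) (θ : ℝ) :
    HasDerivAt (primitiveFun f) (f θ) θ :=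
  ((f.continuous hs0).integral_hasStrictDerivAt 0 θ).hasDerivAt.sub_const _

theorem deriv_primitiveFun (hs0 : 0 < s) (f : HolderOdd s) : deriv (primitiveFun f) = f :=
  funext fun θ => (hasDerivAt_primitiveFun hs0 f θ).deriv

theorem integral_eq_zero (f : HolderOdd s) : ∫ x in (0 : ℝ)..(2 * Real.pi), f x = 0 := by
  simpa using integral_mul_cos_eq_zero f 0

theorem primitiveFun_periodic (hs0 : 0 < s) (f : HolderOdd s) :
    Function.Periodic (primitiveFun f) (2 * Real.pi) := fun θ => by
  have hi : ∀ a b, IntervalIntegrable f volume a b := fun a b =>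
    (f.continuous hs0).intervalIntegrable a b
  have h := f.periodic.intervalIntegral_add_eq θ 0
  rw [zero_add, integral_eq_zero] at h
  rw [primitiveFun, primitiveFun, ← intervalIntegral.integral_add_adjacent_intervals (hi 0 θ)
    (hi θ (θ + 2 * Real.pi)), h, add_zero]

theorem primitiveFun_mem (hs0 : 0 < s) (f : HolderOdd s) :
    primitiveFun f ∈ holderEvenSubmodule s := by
  have hd : Differentiable ℝ (primitiveFun f) := fun θ =>
    (hasDerivAt_primitiveFun hs0 f θ).differentiableAt
  refine ⟨primitiveFun_periodic hs0 f, fun θ => ?_, hd, ?_, ?_⟩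
  · rw [primitiveFun, primitiveFun]
    have h := intervalIntegral.integral_comp_neg (a := 0) (b := θ) (f := f)
    simp only [f.odd, intervalIntegral.integral_neg, neg_zero] at h
    rw [intervalIntegral.integral_symm (-θ) 0, ← h, neg_neg]
  · rw [deriv_primitiveFun hs0]
    exact f.memHolder
  · have hc : Continuous fun y => ∫ x in (0 : ℝ)..y, f x := by
      have h1 := f.continuous hs0
      exact intervalIntegral.continuous_primitive (fun a b => h1.intervalIntegrable a b) 0
    have h := Real.pi_ne_zero
    simp only [primitiveFun]
    rw [intervalIntegral.integral_sub (hc.intervalIntegrable _ _) intervalIntegrable_const]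
    simp
    field_simp
    ring

theorem abs_primitiveFun_le (hs0 : 0 < s) (f : HolderOdd s) (θ : ℝ) :
    |primitiveFun f θ| ≤ 4 * Real.pi * ‖f‖ := by
  have hpi := Real.pi_pos
  have h1 : ∀ y ∈ Set.Icc 0 (2 * Real.pi), |∫ x in (0 : ℝ)..y, f x| ≤ 2 * Real.pi * ‖f‖ := by
    intro y hy
    have h := intervalIntegral.norm_integral_le_of_norm_le_const (a := 0) (b := y) (f := f)
      (C := ‖f‖) fun x _ => f.abs_apply_le x
    rw [sub_zero, abs_of_nonneg hy.1] at h
    refine h.trans ?_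
    nlinarith [hy.2, norm_nonneg f]
  have h2 : |∫ y in (0 : ℝ)..(2 * Real.pi), ∫ x in (0 : ℝ)..y, f x| ≤
      2 * Real.pi * ‖f‖ * (2 * Real.pi) := by
    have h := intervalIntegral.norm_integral_le_of_norm_le_const (a := 0) (b := 2 * Real.pi)
      (f := fun y => ∫ x in (0 : ℝ)..y, f x) (C := 2 * Real.pi * ‖f‖) fun y hy => by
        rw [Set.uIoc_of_le (by positivity)] at hy
        exact h1 y ⟨hy.1.le, hy.2⟩
    rwa [sub_zero, abs_of_pos (by positivity)] at h
  obtain ⟨y, hy, hy'⟩ := (primitiveFun_periodic hs0 f).exists_mem_Ico₀ (by positivity) θ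
  rw [hy', primitiveFun]
  refine (abs_sub _ _).trans ?_
  rw [abs_mul, abs_of_pos (show 0 < (2 * Real.pi)⁻¹ by positivity)]
  have h3 := mul_le_mul_of_nonneg_left h2 (show 0 ≤ (2 * Real.pi)⁻¹ by positivity)
  have e : (2 * Real.pi)⁻¹ * (2 * Real.pi * ‖f‖ * (2 * Real.pi)) = 2 * Real.pi * ‖f‖ := by
    field_simp
  rw [e] at h3
  linarith [h1 y ⟨hy.1, hy.2.le⟩]

/-- The primitive with mean zero, as an operator from `Y^s` to `X^{1,s}`. -/
def primitive (hs0 : 0 < s) : HolderOdd s →L[ℝ] HolderEven s :=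
  LinearMap.mkContinuous
    { toFun := fun f => (⟨primitiveFun f, primitiveFun_mem hs0 f⟩ : ↥(holderEvenSubmodule s))
      map_add' := fun f g => HolderEven.toFun_injective (funext fun θ => by
        have hi : ∀ (f : HolderOdd s) a b, IntervalIntegrable f volume a b := fun f a b =>
          (f.continuous hs0).intervalIntegrable a b
        have hc : ∀ f : HolderOdd s, Continuous fun y => ∫ x in (0 : ℝ)..y, f x := fun f =>
          intervalIntegral.continuous_primitive (hi f) 0
        change primitiveFun (f + g) θ = primitiveFun f θ + primitiveFun g θ
        simp only [primitiveFun, map_add, Pi.add_apply]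
        simp only [intervalIntegral.integral_add (hi f _ _) (hi g _ _)]
        rw [intervalIntegral.integral_add ((hc f).intervalIntegrable _ _)
          ((hc g).intervalIntegrable _ _)]
        ring)
      map_smul' := fun c f => HolderEven.toFun_injective (funext fun θ => by
        change primitiveFun (c • f) θ = c * primitiveFun f θ
        simp only [primitiveFun, map_smul, Pi.smul_apply, smul_eq_mul,
          intervalIntegral.integral_const_mul]
        ring) } (4 * Real.pi + 1) fun f => by
    change supNorm (primitiveFun f) + holderNorm s (deriv (primitiveFun f)) ≤ _
    rw [deriv_primitiveFun hs0, add_mul, one_mul]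
    exact add_le_add (ciSup_le (abs_primitiveFun_le hs0 f)) le_rfl

theorem derivOdd_primitive (hs0 : 0 < s) (f : HolderOdd s) : (primitive hs0 f).derivOdd = f :=
  HolderOdd.toFun_injective (deriv_primitiveFun hs0 f)

/-- The sine coefficients as bounded functionals. -/
def sineCoeffL (hs0 : 0 < s) (n : ℕ) : HolderOdd s →L[ℝ] ℝ :=
  LinearMap.mkContinuous
    { toFun := sineCoeff n
      map_add' := sineCoeff_add hs0 n
      map_smul' := sineCoeff_smul n } (2 * Real.pi) fun f => by
    have h := intervalIntegral.norm_integral_le_of_norm_le_const (a := 0) (b := 2 * Real.pi)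
      (f := fun θ => f θ * Real.sin (n * θ)) (C := ‖f‖) fun x _ => by
        rw [norm_mul, Real.norm_eq_abs, Real.norm_eq_abs]
        have := f.abs_apply_le x
        have h4 := Real.abs_sin_le_one (n * x)
        nlinarith [abs_nonneg (f x)]
    rw [sub_zero, abs_of_pos (by positivity)] at h
    rw [mul_comm]
    exact h

@[simp] theorem sineCoeffL_apply (hs0 : 0 < s) (n : ℕ) (f : HolderOdd s) :
    sineCoeffL hs0 n f = sineCoeff n f := rfl

theorem logChord_symm (α : ℝ) : logChord (2 * Real.pi - α) = logChord α := by
  rw [logChord, logChord, show (2 * Real.pi - α) / 2 = Real.pi - α / 2 by ring, Real.sin_pi_sub]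

theorem resolventWeight_symm (α : ℝ) :
    resolventWeight (2 * Real.pi - α) = resolventWeight α := by
  rw [resolventWeight, resolventWeight, logChord_symm, Real.cos_two_pi_sub, Real.sin_two_pi_sub]
  ring

/-- The multiplier `sin nθ ↦ (1 - 1 / n) sin nθ`. -/
def rankine (hs0 : 0 < s) : HolderOdd s →L[ℝ] HolderOdd s :=
  ContinuousLinearMap.id ℝ _ +
    Real.pi⁻¹ • conv hs0 intervalIntegrable_logChord logChord_symm

/-- The multiplier `sin nθ ↦ (1 + 1 / (n - 1)) sin nθ` (`n ≥ 2`). -/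
def rankineInv (hs0 : 0 < s) : HolderOdd s →L[ℝ] HolderOdd s :=
  ContinuousLinearMap.id ℝ _ +
    Real.pi⁻¹ • conv hs0 intervalIntegrable_resolventWeight resolventWeight_symm

theorem sineCoeff_rankine (hs0 : 0 < s) {n : ℕ} (hn : n ≠ 0) (f : HolderOdd s) :
    sineCoeff n (rankine hs0 f) = (1 - 1 / n) * sineCoeff n f := by
  have h : rankine hs0 f = f + Real.pi⁻¹ • conv hs0 intervalIntegrable_logChord logChord_symm f :=
    rfl
  have hpi := Real.pi_ne_zero
  have hn' : (n : ℝ) ≠ 0 := by exact_mod_cast hn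
  rw [h, sineCoeff_add hs0, sineCoeff_smul, sineCoeff_conv, integral_logChord_mul_cos hn]
  field_simp
  ring

theorem sineCoeff_rankineInv (hs0 : 0 < s) {n : ℕ} (hn : 2 ≤ n) (f : HolderOdd s) :
    sineCoeff n (rankineInv hs0 f) = (1 + 1 / (n - 1)) * sineCoeff n f := by
  have h : rankineInv hs0 f =
      f + Real.pi⁻¹ • conv hs0 intervalIntegrable_resolventWeight resolventWeight_symm f := rfl
  have hpi := Real.pi_ne_zero
  rw [h, sineCoeff_add hs0, sineCoeff_smul, sineCoeff_conv, integral_resolventWeight_mul_cos hn]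
  field_simp

theorem ext_sineCoeff (hs0 : 0 < s) {f g : HolderOdd s}
    (h : ∀ n : ℕ, n ≠ 0 → sineCoeff n f = sineCoeff n g) : f = g := by
  refine sub_eq_zero.1 (eq_zero_of_sineCoeff hs0 fun n hn => ?_)
  rw [← sineCoeffL_apply hs0, map_sub, sineCoeffL_apply, sineCoeffL_apply, h n hn, sub_self]

theorem rankine_sine (hs0 : 0 < s) (hs1 : s ≤ 1) : rankine hs0 (sine hs1) = 0 := by
  refine eq_zero_of_sineCoeff hs0 fun n hn => ?_
  rw [sineCoeff_rankine hs0 hn, sineCoeff_sine]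
  split_ifs with h
  · simp [h]
  · simp

/-- For n ≥ 2 the multipliers satisfy (1 - 1/n)(1 + 1/(n - 1)) = 1. For n = 1 the factor 1 - 1/n
vanishes, which is why the first coefficient of f must vanish too. -/
theorem rankine_rankineInv (hs0 : 0 < s) {f : HolderOdd s} (hf : sineCoeff 1 f = 0) :
    rankine hs0 (rankineInv hs0 f) = f := by
  refine ext_sineCoeff hs0 fun n hn => ?_
  rw [sineCoeff_rankine hs0 hn]
  rcases eq_or_ne n 1 with rfl | h1
  · simp [hf]
  · have h2 : 2 ≤ n := by omega
    have h3 : (n : ℝ) - 1 ≠ 0 := by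
      have : (2 : ℝ) ≤ n := by exact_mod_cast h2
      linarith
    have h4 : (n : ℝ) ≠ 0 := by exact_mod_cast hn
    rw [sineCoeff_rankineInv hs0 h2]
    field_simp
    ring

/-- The multiplier 1 - 1/n vanishes only for n = 1, so only the first sine mode of f can be present.
-/
theorem eq_smul_sine_of_rankine (hs0 : 0 < s) (hs1 : s ≤ 1) {f : HolderOdd s}
    (h : rankine hs0 f = 0) : f = (sineCoeff 1 f / Real.pi) • sine hs1 := by
  refine ext_sineCoeff hs0 fun n hn => ?_
  have hpi := Real.pi_ne_zero
  rw [sineCoeff_smul, sineCoeff_sine]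
  split_ifs with h1
  · subst h1; field_simp
  · have h2 := sineCoeff_rankine hs0 hn f
    rw [h, ← sineCoeffL_apply hs0, map_zero] at h2
    have h3 : 1 - 1 / (n : ℝ) ≠ 0 := by
      have h4 : (n : ℝ) ≠ 0 := by exact_mod_cast hn
      have h5 : (n : ℝ) ≠ 1 := by exact_mod_cast h1
      have : (n : ℝ) - 1 ≠ 0 := sub_ne_zero.2 h5
      rw [one_sub_div h4]
      exact div_ne_zero this h4
    rw [mul_zero]
    exact (mul_eq_zero.1 h2.symm).resolve_left h3

end HolderOdd

open HolderOdd

/-- Integration by parts. It moves the condition defining `noFirstMode` to the derivative, where the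
multipliers act. -/
theorem HolderEven.sineCoeff_one_derivOdd (h : HolderEven s) (hs0 : 0 < s) :
    sineCoeff 1 h.derivOdd = -∫ θ in (0 : ℝ)..(2 * Real.pi), h θ * Real.cos θ := by
  have h1 := intervalIntegral.integral_mul_deriv_eq_deriv_mul (a := 0) (b := 2 * Real.pi)
    (u := Real.sin) (v := h) (u' := Real.cos) (v' := deriv h)
    (fun x _ => Real.hasDerivAt_sin x) (fun x _ => h.hasDerivAt x)
    (Real.continuous_cos.intervalIntegrable _ _)
    ((h.continuous_deriv hs0).intervalIntegrable _ _)
  rw [sineCoeff]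
  simp only [derivOdd_apply, Nat.cast_one, one_mul]
  have e : ∀ x : ℝ, deriv h x * Real.sin x = Real.sin x * deriv h x := fun x => mul_comm _ _
  simp only [e]
  rw [h1, Real.sin_two_pi]
  simp [mul_comm]

theorem HolderEven.eq_mul_cos (hs1 : s ≤ 1) {h : HolderEven s} {c : ℝ}
    (hc : h.derivOdd = c • sine hs1) (θ : ℝ) : h θ = -c * Real.cos θ := by
  have hd : ∀ x, HasDerivAt (fun x => h x + c * Real.cos x) 0 x := fun x => by
    have h1 : deriv h x = c * Real.sin x := by
      rw [← derivOdd_apply, hc]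
      simp
    refine ((h.hasDerivAt x).add ((Real.hasDerivAt_cos x).const_mul c)).congr_deriv ?_
    rw [h1]
    ring
  have hconst : ∀ x, h x = h 0 + c * Real.cos 0 - c * Real.cos x := fun x => by
    have := is_const_of_deriv_eq_zero (fun x => (hd x).differentiableAt) (fun x => (hd x).deriv) x 0
    linarith
  have h2 : ∫ x in (0 : ℝ)..(2 * Real.pi), h x = 0 := h.toFun_mem.2.2.2.2
  rw [intervalIntegral.integral_congr fun x _ => hconst x] at h2
  rw [intervalIntegral.integral_sub intervalIntegrable_const
    (Continuous.intervalIntegrable (by fun_prop) _ _), intervalIntegral.integral_const,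
    intervalIntegral.integral_const_mul, integral_cos] at h2
  have hpi := Real.pi_pos
  have h3 : h 0 + c = 0 := by simpa [hpi.ne'] using h2
  rw [hconst θ, Real.cos_zero, mul_one, h3]
  ring

/-- The linearized operator `(ω, h) ↦ -ω sin θ - ½ Λ h'` at the Rankine vortex. -/
def linearization (hs0 : 0 < s) (hs1 : s ≤ 1) : ℝ × HolderEven s →L[ℝ] HolderOdd s :=
  -((ContinuousLinearMap.fst ℝ ℝ (HolderEven s)).smulRight (sine hs1)) -
    (2⁻¹ : ℝ) • ((rankine hs0).comp HolderEven.derivOdd).comp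
      (ContinuousLinearMap.snd ℝ ℝ (HolderEven s))

theorem linearization_apply (hs0 : 0 < s) (hs1 : s ≤ 1) (ω : ℝ) (h : HolderEven s) :
    linearization hs0 hs1 (ω, h) =
      -(ω • sine hs1) - (2⁻¹ : ℝ) • rankine hs0 h.derivOdd := rfl

/-- The operator Λ has no first mode in its range, so the first sine coefficient of the equation
isolates ω. Then Λ h' = 0 makes h' a multiple of sin θ, and mean zero fixes the constant of
integration. -/
theorem linearization_eq_zero_iff (hs0 : 0 < s) (hs1 : s ≤ 1) (ω : ℝ) (h : HolderEven s) :
    linearization hs0 hs1 (ω, h) = 0 ↔ ω = 0 ∧ ∃ c : ℝ, ∀ θ : ℝ, h θ = c * Real.cos θ := by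
  rw [linearization_apply]
  constructor
  · intro h0
    have hω : ω = 0 := by
      have h1 := congrArg (sineCoeffL hs0 1) h0
      simp only [map_sub, map_neg, map_smul, sineCoeffL_apply, sineCoeff_sine, map_zero,
        sineCoeff_rankine hs0 one_ne_zero] at h1
      have hpi := Real.pi_ne_zero
      simpa [hpi] using h1
    refine ⟨hω, ?_⟩
    rw [hω, zero_smul, neg_zero, zero_sub, neg_eq_zero] at h0
    have h1 := (smul_eq_zero.1 h0).resolve_left (by norm_num)
    exact ⟨_, HolderEven.eq_mul_cos hs1 (eq_smul_sine_of_rankine hs0 hs1 h1)⟩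
  · rintro ⟨rfl, c, hc⟩
    have h1 : h.derivOdd = (-c) • sine hs1 := HolderOdd.ext fun θ => by
      have h2 : HasDerivAt (fun θ => c * Real.cos θ) (c * -Real.sin θ) θ :=
        (Real.hasDerivAt_cos θ).const_mul c
      rw [HolderEven.derivOdd_apply, show (h : ℝ → ℝ) = fun θ => c * Real.cos θ from funext hc,
        h2.deriv]
      simp
    rw [h1, map_smul, rankine_sine]
    simp

theorem HolderEven.mem_noFirstMode_iff (hs0 : 0 < s) (h : HolderEven s) :
    h ∈ noFirstMode s ↔ sineCoeff 1 h.derivOdd = 0 := by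
  rw [sineCoeff_one_derivOdd h hs0, neg_eq_zero]
  rfl

/-- The restriction of the linearized operator to `ℝ × X^{1,s}_{≥2}` is an isomorphism. -/
def linearizationEquiv (hs0 : 0 < s) (hs1 : s ≤ 1) :
    (ℝ × noFirstMode s) ≃L[ℝ] HolderOdd s :=
  let A : (ℝ × noFirstMode s) →L[ℝ] HolderOdd s :=
    (linearization hs0 hs1).comp
      ((ContinuousLinearMap.id ℝ ℝ).prodMap (noFirstMode s).subtypeL)
  -- The equation to solve is -ω sin θ - ½ Λ h' = f. Since Λ h' has no first mode, ω is minus the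
  -- first coefficient of f; the factor 1/π normalizes `sineCoeff`.
  let w : HolderOdd s →L[ℝ] ℝ := -(Real.pi⁻¹ • sineCoeffL hs0 1)
  -- This is the derivative of the unknown, h' = Λ⁻¹(-2(f + ω sin θ)), whose argument has no first
  -- mode.
  let g : HolderOdd s →L[ℝ] HolderOdd s :=
    (rankineInv hs0).comp ((-2 : ℝ) • (ContinuousLinearMap.id ℝ _ + w.smulRight (sine hs1)))
  have hg : ∀ f, sineCoeff 1 (f + w f • sine hs1) = 0 := fun f => by
    have hpi := Real.pi_ne_zero
    have : w f = -(Real.pi⁻¹ * sineCoeff 1 f) := rfl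
    rw [sineCoeff_add hs0, sineCoeff_smul, sineCoeff_sine, this, if_pos rfl]
    field_simp
    ring
  have hg2 : ∀ f, sineCoeff 1 ((-2 : ℝ) • (f + w f • sine hs1)) = 0 := fun f => by
    rw [sineCoeff_smul, hg, mul_zero]
  have hgT : ∀ f, rankine hs0 (g f) = (-2 : ℝ) • (f + w f • sine hs1) := fun f => by
    have : g f = rankineInv hs0 ((-2 : ℝ) • (f + w f • sine hs1)) := rfl
    rw [this, rankine_rankineInv hs0 (hg2 f)]
  have hg1 : ∀ f, sineCoeff 1 (g f) = 0 := fun f => by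
    have : g f = (-2 : ℝ) • (f + w f • sine hs1) + Real.pi⁻¹ • conv hs0
      intervalIntegrable_resolventWeight resolventWeight_symm ((-2 : ℝ) • (f + w f • sine hs1)) :=
      rfl
    rw [this, sineCoeff_add hs0, sineCoeff_smul 1 Real.pi⁻¹, sineCoeff_conv, hg2]
    simp
  let B : HolderOdd s →L[ℝ] ℝ × noFirstMode s :=
    w.prod (((primitive hs0).comp g).codRestrict (noFirstMode s) fun f => by
      rw [HolderEven.mem_noFirstMode_iff hs0]
      change sineCoeff 1 (primitive hs0 (g f)).derivOdd = 0
      rw [derivOdd_primitive, hg1])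
  have hAB : ∀ f, A (B f) = f := fun f => by
    change linearization hs0 hs1 (w f, primitive hs0 (g f)) = f
    rw [linearization_apply, derivOdd_primitive, hgT]
    module
  have hinj : Function.Injective A := by
    rw [injective_iff_map_eq_zero]
    rintro ⟨ω, h⟩ h0
    have h1 : linearization hs0 hs1 (ω, (h : HolderEven s)) = 0 := h0
    obtain ⟨rfl, c, hc⟩ := (linearization_eq_zero_iff hs0 hs1 _ _).1 h1
    have h2 : ∫ θ in (0 : ℝ)..(2 * Real.pi), (h : HolderEven s) θ * Real.cos θ = 0 := h.2
    simp only [hc, mul_assoc, ← sq] at h2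
    rw [intervalIntegral.integral_const_mul, integral_cos_sq] at h2
    have hpi := Real.pi_pos
    have hc0 : c = 0 := by
      simpa [hpi.ne'] using h2
    have : h = 0 := Subtype.ext (HolderEven.toFun_injective (funext fun θ => by
      rw [hc, hc0]; simp))
    rw [this]
    rfl
  ContinuousLinearEquiv.equivOfInverse A B (fun p => hinj (hAB _)) hAB

theorem linearizationEquiv_apply (hs0 : 0 < s) (hs1 : s ≤ 1) (ω : ℝ) (h : noFirstMode s) :
    linearizationEquiv hs0 hs1 (ω, h) = linearization hs0 hs1 (ω, (h : HolderEven s)) := rfl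

/-- The derivative of `selfMap` at the disc. -/
theorem hasDerivAt_selfMap_smul_rankine (hs0 : 0 < s) (hs1 : s ≤ 1) (r : HolderEven s) (θ : ℝ) :
    HasDerivAt (fun t : ℝ => selfMap hs0 hs1 (t • r) θ)
      (Real.pi / 2 * rankine hs0 r.derivOdd θ) 0 := by
  refine (hasDerivAt_selfMap_smul r θ).congr_deriv ?_
  have hr' := r.continuous_deriv hs0
  have hr := r.differentiable.continuous
  have hi : ∀ {g : ℝ → ℝ}, Continuous g →
      IntervalIntegrable (fun α => logChord α * g α) volume 0 (2 * Real.pi) := fun hg =>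
    intervalIntegrable_logChord.mul_continuousOn hg.continuousOn
  -- Split -cos α r'(θ - α) as -r'(θ - α) + (1 - cos α) r'(θ - α). The first piece gives the
  -- convolution in Λ. The second combines with -sin α r(θ - α) into an exact derivative, and
  -- integrating it by parts produces a term that cancels the contribution of the chord ratio.
  have h1 := integral_logChord_mul (g := fun α => (1 - Real.cos α) * r (θ - α))
    (g' := fun α => Real.sin α * r (θ - α) - (1 - Real.cos α) * deriv r (θ - α))
    (V := fun α => Real.sin (α / 2) * r (θ - α)) (fun α => by
      have h2 : HasDerivAt (fun α => r (θ - α)) (-deriv r (θ - α)) α := by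
        simpa using (r.hasDerivAt (θ - α)).comp_const_sub θ α
      refine (((Real.hasDerivAt_cos α).const_sub 1).mul h2).congr_deriv ?_
      ring) (by fun_prop) (by fun_prop) (fun α => by
      have : Real.cos α = 1 - 2 * Real.sin (α / 2) ^ 2 := by
        rw [← Real.cos_sq_add_sin_sq (α / 2), Real.cos_sq']
        have := Real.cos_sq_add_sin_sq (α / 2)
        have h3 : Real.cos α = Real.cos (2 * (α / 2)) := by ring_nf
        rw [h3, Real.cos_two_mul]
        linarith
      rw [this]
      ring)
  have hcos := integral_logChord_mul_cos one_ne_zero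
  have hsin : ∫ α in (0 : ℝ)..(2 * Real.pi), logChord α * Real.sin α = 0 := by
    have h2 := intervalIntegral.integral_comp_sub_left (a := 0) (b := 2 * Real.pi)
      (fun α => logChord α * Real.sin α) (2 * Real.pi)
    simp only [logChord_symm, Real.sin_two_pi_sub, mul_neg, intervalIntegral.integral_neg,
      sub_self, sub_zero] at h2
    linarith
  simp only [Nat.cast_one, one_mul, div_one] at hcos
  have e1 : ∀ α : ℝ, logChord α * ((deriv r θ - deriv r (θ - α)) / 2 * Real.cos α -
      (r θ + r (θ - α)) / 2 * Real.sin α) =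
      deriv r θ / 2 * (logChord α * Real.cos α) - r θ / 2 * (logChord α * Real.sin α) -
        1 / 2 * (logChord α * (Real.sin α * r (θ - α) - (1 - Real.cos α) * deriv r (θ - α))) -
        1 / 2 * (logChord α * deriv r (θ - α)) := fun α => by ring
  have e2 : ∀ α : ℝ, (r θ + r (θ - α)) / 4 * Real.sin α =
      r θ / 4 * Real.sin α + 1 / 2 * (Real.cos (α / 2) * (Real.sin (α / 2) * r (θ - α))) :=
    fun α => by
      have h3 : Real.sin α = 2 * Real.sin (α / 2) * Real.cos (α / 2) := by
        rw [← Real.sin_two_mul]; ring_nf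
      rw [h3]
      ring
  have e3 : rankine hs0 r.derivOdd θ =
      deriv r θ + Real.pi⁻¹ * ∫ α in (0 : ℝ)..(2 * Real.pi), logChord α * deriv r (θ - α) := by
    have h3 := conv_apply hs0 intervalIntegrable_logChord logChord_symm r.derivOdd θ
    rw [integral_arc_eq fun α => logChord α * r.derivOdd (θ - α)] at h3
    change deriv r θ + Real.pi⁻¹ *
      conv hs0 intervalIntegrable_logChord logChord_symm r.derivOdd θ = _
    rw [h3]
    rfl
  rw [integral_arc_eq fun α => logChord α * ((deriv r θ - deriv r (θ - α)) / 2 * Real.cos α -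
      (r θ + r (θ - α)) / 2 * Real.sin α),
    integral_arc_eq fun α => (r θ + r (θ - α)) / 4 * Real.sin α, e3]
  simp only [e1, e2]
  rw [intervalIntegral.integral_add (Continuous.intervalIntegrable (by fun_prop) _ _)
      (Continuous.intervalIntegrable (by fun_prop) _ _),
    intervalIntegral.integral_sub ((((hi Real.continuous_cos).const_mul _).sub
      ((hi Real.continuous_sin).const_mul _)).sub ((hi (by fun_prop)).const_mul _))
      ((hi (by fun_prop)).const_mul _),
    intervalIntegral.integral_sub (((hi Real.continuous_cos).const_mul _).sub
      ((hi Real.continuous_sin).const_mul _)) ((hi (by fun_prop)).const_mul _),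
    intervalIntegral.integral_sub ((hi Real.continuous_cos).const_mul _)
      ((hi Real.continuous_sin).const_mul _)]
  simp only [intervalIntegral.integral_const_mul]
  rw [h1, hcos, hsin, integral_sin]
  have hpi := Real.pi_ne_zero
  simp
  field_simp
  ring

end

/-! ### The star-shaped domain in polar coordinates. -/

section

open scoped BoundedContinuousFunction Topology
open MeasureTheory Kernel

variable {s : ℝ≥0}

/-- The star-shaped domain enclosed by the curve `√(1 + ρ(θ)) e^{iθ}`. -/
def starDomain (ρ : ℝ → ℝ) : Set ℂ := {z | ‖z‖ < Real.sqrt (1 + ρ z.arg)}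

theorem norm_curve (ρ : ℝ → ℝ) (θ : ℝ) : ‖curve ρ θ‖ = Real.sqrt (1 + ρ θ) := by
  rw [curve, norm_mul, Complex.norm_exp_ofReal_mul_I, mul_one, Complex.norm_real,
    Real.norm_of_nonneg (Real.sqrt_nonneg _)]

theorem curve_periodic (ρ : HolderEven s) : Function.Periodic (curve ρ) (2 * Real.pi) := fun θ => by
  rw [curve, curve, ρ.periodic]
  have := Complex.exp_periodic (θ * Complex.I)
  push_cast
  rw [add_mul, this]

theorem tangent_periodic (ρ : HolderEven s) :
    Function.Periodic (tangent ρ) (2 * Real.pi) := fun θ => by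
  rw [tangent, tangent, radiusDeriv, radiusDeriv, ρ.periodic, ρ.deriv_periodic]
  have := Complex.exp_periodic (θ * Complex.I)
  rw [Complex.ofReal_add, add_mul (θ : ℂ)]
  push_cast
  rw [this]

theorem continuous_curve (ρ : HolderEven s) : Continuous (curve ρ) := by
  have := ρ.differentiable.continuous
  unfold curve
  fun_prop

theorem measurableSet_starDomain (ρ : HolderEven s) : MeasurableSet (starDomain ρ) := by
  have := ρ.differentiable.continuous
  exact measurableSet_lt measurable_norm
    (Real.continuous_sqrt.measurable.comp
      ((continuous_const.add this).measurable.comp Complex.measurable_arg))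

namespace IsGood

variable {hs1 : s ≤ 1} {ρ : HolderEven s}

theorem sqrt_le (h : IsGood hs1 ρ) (θ : ℝ) : Real.sqrt (1 + ρ θ) ≤ 3 / 2 := by
  have := abs_le.1 (ρ.abs_apply_le θ)
  rw [Real.sqrt_le_left (by norm_num)]
  linarith [h.norm_le]

theorem half_le_sqrt (h : IsGood hs1 ρ) (θ : ℝ) : 1 / 2 ≤ Real.sqrt (1 + ρ θ) := by
  rw [Real.le_sqrt (by norm_num) (h.pos θ).le]
  linarith [h.half_le θ]

theorem norm_curve_le (h : IsGood hs1 ρ) (θ : ℝ) : ‖curve ρ θ‖ ≤ 3 / 2 := by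
  rw [norm_curve]
  exact h.sqrt_le θ

theorem starDomain_subset (h : IsGood hs1 ρ) : starDomain ρ ⊆ Metric.ball 0 (3 / 2) := fun z hz => by
  rw [mem_ball_zero_iff]
  exact lt_of_lt_of_le hz (h.sqrt_le _)

theorem hasDerivAt_curve (h : IsGood hs1 ρ) (θ : ℝ) : HasDerivAt (curve ρ) (tangent ρ θ) θ := by
  have h1 : HasDerivAt (fun θ => Real.sqrt (1 + ρ θ)) (radiusDeriv ρ θ) θ :=
    ((ρ.hasDerivAt θ).const_add 1).sqrt (h.pos θ).ne'
  have h2 : HasDerivAt (fun θ : ℝ => Complex.exp (θ * Complex.I))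
      (Complex.exp (θ * Complex.I) * Complex.I) θ := by
    have := ((Complex.hasDerivAt_exp (θ * Complex.I)).comp (θ : ℂ)
      ((hasDerivAt_id (θ : ℂ)).mul_const Complex.I)).comp_ofReal
    simpa using this
  refine (h1.ofReal_comp.mul h2).congr_deriv ?_
  rw [tangent]
  ring

theorem continuous_tangent (h : IsGood hs1 ρ) (hs0 : 0 < s) : Continuous (tangent ρ) := by
  have h1 := ρ.differentiable.continuous
  have h2 := ρ.continuous_deriv hs0
  have h3 : ∀ θ, 2 * Real.sqrt (1 + ρ θ) ≠ 0 := fun θ => by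
    have := h.half_le_sqrt θ
    positivity
  have h4 : Continuous (radiusDeriv ρ) := h2.div (by fun_prop) h3
  unfold tangent
  fun_prop

theorem norm_tangent_le (h : IsGood hs1 ρ) (θ : ℝ) : ‖tangent ρ θ‖ ≤ 2 := by
  rw [tangent, norm_mul, Complex.norm_exp_ofReal_mul_I, mul_one]
  refine (norm_add_le _ _).trans ?_
  rw [norm_mul, Complex.norm_I, mul_one, Complex.norm_real, Complex.norm_real,
    Real.norm_of_nonneg (Real.sqrt_nonneg _), radiusDeriv, Real.norm_eq_abs, abs_div,
    abs_of_nonneg (by positivity : 0 ≤ 2 * Real.sqrt (1 + ρ θ))]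
  have h1 := h.half_le_sqrt θ
  have h2 := ρ.abs_deriv_le θ
  have h3 : |deriv ρ θ| / (2 * Real.sqrt (1 + ρ θ)) ≤ 1 / 2 := by
    rw [div_le_iff₀ (by linarith)]
    linarith [h.norm_le]
  linarith [h.sqrt_le θ]

/-- Integration over the star-shaped domain in polar coordinates. -/
theorem setIntegral_starDomain (h : IsGood hs1 ρ) {E : Type*} [NormedAddCommGroup E] [NormedSpace ℝ E]
    {f : ℂ → E} (hf : ContinuousOn f (Metric.ball 0 2)) :
    ∫ z in starDomain ρ, f z = ∫ φ in (-Real.pi)..Real.pi, ∫ τ in (0 : ℝ)..1,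
      ((1 + ρ φ) * τ) • f (τ * curve ρ φ) := by
  have hρ := ρ.differentiable.continuous
  rw [← integral_indicator (measurableSet_starDomain ρ), ← Complex.integral_comp_polarCoord_symm]
  set S : Set (ℝ × ℝ) :=
    {p | p.1 < Real.sqrt (1 + ρ p.2)} ∩ (Set.Ioi (0 : ℝ) ×ˢ Set.Ioo (-Real.pi) Real.pi) with hS
  have hSm : MeasurableSet S := by
    refine (measurableSet_lt measurable_fst ?_).inter (measurableSet_Ioi.prod measurableSet_Ioo)
    exact (Real.continuous_sqrt.comp (continuous_const.add (hρ.comp continuous_snd))).measurable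
  set G : ℝ × ℝ → E := fun p => p.1 • f (Complex.polarCoord.symm p) with hG
  have hint : IntegrableOn G S := by
    have hK : IsCompact (Set.Icc (0 : ℝ) (3 / 2) ×ˢ Set.Icc (-Real.pi) Real.pi) :=
      isCompact_Icc.prod isCompact_Icc
    refine IntegrableOn.mono_set (ContinuousOn.integrableOn_compact hK ?_) ?_
    · refine continuous_fst.continuousOn.smul (hf.comp ?_ ?_)
      · have : Continuous fun p : ℝ × ℝ =>
            (p.1 : ℂ) * (Real.cos p.2 + Real.sin p.2 * Complex.I) := by fun_prop
        exact (this.congr fun p => (Complex.polarCoord_symm_apply p).symm).continuousOn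
      · intro p hp
        rw [mem_ball_zero_iff, Complex.norm_polarCoord_symm, abs_of_nonneg hp.1.1]
        linarith [hp.1.2]
    · rintro p ⟨h1, h2, h3⟩
      exact ⟨⟨le_of_lt h2, (le_of_lt h1).trans (h.sqrt_le _)⟩, h3.1.le, h3.2.le⟩
  have e1 : ∫ p in polarCoord.target, p.1 • (starDomain ρ).indicator f (Complex.polarCoord.symm p) =
      ∫ p, S.indicator G p := by
    rw [← integral_indicator polarCoord.open_target.measurableSet]
    refine integral_congr_ae (Filter.Eventually.of_forall fun p => ?_)
    by_cases hp : p ∈ polarCoord.target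
    · have hp' : 0 < p.1 ∧ p.2 ∈ Set.Ioo (-Real.pi) Real.pi := hp
      have harg : (Complex.polarCoord.symm p).arg = p.2 := by
        rw [Complex.polarCoord_symm_apply, Complex.ofReal_cos, Complex.ofReal_sin]
        exact Complex.arg_mul_cos_add_sin_mul_I hp'.1 ⟨hp'.2.1, hp'.2.2.le⟩
      have hmem : Complex.polarCoord.symm p ∈ starDomain ρ ↔ p ∈ S := by
        change ‖_‖ < Real.sqrt (1 + ρ (Complex.polarCoord.symm p).arg) ↔ _
        rw [Complex.norm_polarCoord_symm, abs_of_pos hp'.1, harg]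
        exact ⟨fun h1 => ⟨h1, hp⟩, fun h1 => h1.1⟩
      simp only [Set.indicator_of_mem hp]
      by_cases hpS : p ∈ S
      · rw [Set.indicator_of_mem hpS, Set.indicator_of_mem (hmem.2 hpS)]
      · rw [Set.indicator_of_notMem hpS, Set.indicator_of_notMem (fun h1 => hpS (hmem.1 h1)),
          smul_zero]
    · simp only [Set.indicator_of_notMem hp]
      rw [Set.indicator_of_notMem fun h1 => hp h1.2]
  rw [e1, Measure.volume_eq_prod, integral_prod_symm _ (by
    rw [← Measure.volume_eq_prod]; exact (integrable_indicator_iff hSm).2 hint)]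
  rw [intervalIntegral.integral_of_le (by linarith [Real.pi_pos]), integral_Ioc_eq_integral_Ioo,
    ← integral_indicator measurableSet_Ioo]
  refine integral_congr_ae (Filter.Eventually.of_forall fun φ => ?_)
  by_cases hφ : φ ∈ Set.Ioo (-Real.pi) Real.pi
  · simp only [Set.indicator_of_mem hφ]
    have hR := h.half_le_sqrt φ
    have e2 : ∀ t, S.indicator G (t, φ) =
        (Set.Ioo 0 (Real.sqrt (1 + ρ φ))).indicator (fun t => G (t, φ)) t := fun t => by
      by_cases ht : t ∈ Set.Ioo 0 (Real.sqrt (1 + ρ φ))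
      · rw [Set.indicator_of_mem ht, Set.indicator_of_mem]
        exact ⟨ht.2, ht.1, hφ⟩
      · rw [Set.indicator_of_notMem ht, Set.indicator_of_notMem]
        exact fun h1 => ht ⟨h1.2.1, h1.1⟩
    simp only [e2]
    rw [integral_indicator measurableSet_Ioo, ← integral_Ioc_eq_integral_Ioo,
      ← intervalIntegral.integral_of_le (by positivity)]
    -- The substitution t = Rτ turns t dt into R² τ dτ, and R² = 1 + ρ: the Jacobian is affine in ρ
    -- because the radius is a square root.
    have e3 := intervalIntegral.smul_integral_comp_mul_left (a := 0) (b := 1)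
      (fun t => G (t, φ)) (Real.sqrt (1 + ρ φ))
    rw [mul_zero, mul_one] at e3
    rw [← e3, ← intervalIntegral.integral_smul]
    refine intervalIntegral.integral_congr fun τ _ => ?_
    simp only [hG, Complex.polarCoord_symm_apply, smul_smul]
    rw [← mul_assoc, Real.mul_self_sqrt (h.pos φ).le, curve, Complex.exp_mul_I]
    push_cast
    congr 2
    ring
  · simp only [Set.indicator_of_notMem hφ]
    rw [integral_eq_zero_of_ae]
    refine Filter.Eventually.of_forall fun t => ?_
    exact Set.indicator_of_notMem (fun h1 => hφ h1.2.2) _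

end IsGood

end

/-! ### Green's formula for curves with continuous tangent. -/

section

open scoped BoundedContinuousFunction Topology
open MeasureTheory Kernel

variable {s : ℝ≥0} {E : Type*} [NormedAddCommGroup E] [NormedSpace ℝ E]

theorem integral_swap_of_continuousOn {F : ℝ → ℝ → E} {a b c d : ℝ} (hab : a ≤ b) (hcd : c ≤ d)
    (hF : ContinuousOn (Function.uncurry F) (Set.Icc a b ×ˢ Set.Icc c d)) :
    ∫ x in a..b, ∫ y in c..d, F x y = ∫ y in c..d, ∫ x in a..b, F x y := by
  have hint : Integrable (Function.uncurry F)
      ((volume.restrict (Set.Ioc a b)).prod (volume.restrict (Set.Ioc c d))) := by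
    rw [Measure.prod_restrict, ← Measure.volume_eq_prod]
    exact (hF.integrableOn_compact (isCompact_Icc.prod isCompact_Icc)).mono_set
      (Set.prod_mono Set.Ioc_subset_Icc_self Set.Ioc_subset_Icc_self)
  simp only [intervalIntegral.integral_of_le hab, intervalIntegral.integral_of_le hcd]
  exact integral_integral_swap hint

theorem intervalIntegrable_integral_of_continuousOn {F : ℝ → ℝ → E} {a b c d : ℝ} (hab : a ≤ b)
    (hcd : c ≤ d) (hF : ContinuousOn (Function.uncurry F) (Set.Icc a b ×ˢ Set.Icc c d)) :
    IntervalIntegrable (fun x => ∫ y in c..d, F x y) volume a b := by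
  have hint : Integrable (Function.uncurry F)
      ((volume.restrict (Set.Ioc a b)).prod (volume.restrict (Set.Ioc c d))) := by
    rw [Measure.prod_restrict, ← Measure.volume_eq_prod]
    exact (hF.integrableOn_compact (isCompact_Icc.prod isCompact_Icc)).mono_set
      (Set.prod_mono Set.Ioc_subset_Icc_self Set.Ioc_subset_Icc_self)
  simp only [intervalIntegral.integral_of_le hcd]
  exact (intervalIntegrable_iff_integrableOn_Ioc_of_le hab).2 hint.integral_prod_left

/-- The cross product with a fixed vector. -/
def crossL (v : ℂ) : ℂ →L[ℝ] ℝ := v.re • Complex.imCLM - v.im • Complex.reCLM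

@[simp] theorem crossL_apply (v w : ℂ) : crossL v w = cross v w := rfl

theorem cross_curve_tangent {ρ : ℝ → ℝ} {θ : ℝ} (hpos : 0 < 1 + ρ θ) :
    cross (curve ρ θ) (tangent ρ θ) = 1 + ρ θ := by
  rw [cross, curve, tangent, Complex.exp_mul_I, ← Complex.ofReal_cos, ← Complex.ofReal_sin]
  simp only [Complex.mul_re, Complex.mul_im, Complex.add_re, Complex.add_im, Complex.ofReal_re,
    Complex.ofReal_im, Complex.I_re, Complex.I_im]
  have h1 := Real.sq_sqrt hpos.le
  have h2 := Real.sin_sq_add_cos_sq θ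
  linear_combination (Real.sqrt (1 + ρ θ)) ^ 2 * h2 + h1

/-- Cramer's rule in the plane. It decomposes a fixed direction v into its components along the
position vector and the tangent. -/
theorem cross_smul_eq (v w z : ℂ) :
    cross w z • v = cross v z • w - cross v w • z := by
  apply Complex.ext <;> simp [cross] <;> ring

namespace IsGood

variable {hs1 : s ≤ 1} {ρ : HolderEven s}

/-- Green's formula on a star-shaped domain. -/
theorem integral_fderiv_starDomain [CompleteSpace E] (h : IsGood hs1 ρ) (hs0 : 0 < s) {g : ℂ → E}
    {g' : ℂ → ℂ →L[ℝ] E} (hg : ∀ z ∈ Metric.ball 0 2, HasFDerivAt g (g' z) z)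
    (hg' : ContinuousOn g' (Metric.ball 0 2)) (v : ℂ) :
    ∫ z in starDomain ρ, g' z v =
      ∫ φ in (-Real.pi)..Real.pi, cross v (tangent ρ φ) • g (curve ρ φ) := by
  have hγ := continuous_curve ρ
  have hγ' := h.continuous_tangent hs0
  have hcr : Continuous fun φ => cross v (curve ρ φ) := (crossL v).continuous.comp hγ
  have hcr' : Continuous fun φ => cross v (tangent ρ φ) := (crossL v).continuous.comp hγ'
  have hpi : -Real.pi ≤ Real.pi := by linarith [Real.pi_pos]
  have hmem : ∀ {τ : ℝ}, τ ∈ Set.Icc (0 : ℝ) 1 → ∀ φ, (τ : ℂ) * curve ρ φ ∈ Metric.ball (0 : ℂ) 2 := by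
    intro τ hτ φ
    rw [mem_ball_zero_iff, norm_mul, Complex.norm_real, Real.norm_of_nonneg hτ.1]
    have := h.norm_curve_le φ
    nlinarith [hτ.1, hτ.2, norm_nonneg (curve ρ φ)]
  have hgc : ContinuousOn g (Metric.ball 0 2) := fun z hz => (hg z hz).continuousAt.continuousWithinAt
  set K : Set (ℝ × ℝ) := Set.Icc (-Real.pi) Real.pi ×ˢ Set.Icc (0 : ℝ) 1 with hK
  have hmaps : Set.MapsTo (fun p : ℝ × ℝ => (p.2 : ℂ) * curve ρ p.1) K (Metric.ball 0 2) :=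
    fun p hp => hmem hp.2 _
  have hpt : Continuous fun p : ℝ × ℝ => (p.2 : ℂ) * curve ρ p.1 := by fun_prop
  have cg : ContinuousOn (fun p : ℝ × ℝ => g ((p.2 : ℂ) * curve ρ p.1)) K :=
    hgc.comp hpt.continuousOn hmaps
  have cg' : ContinuousOn (fun p : ℝ × ℝ => g' ((p.2 : ℂ) * curve ρ p.1)) K :=
    hg'.comp hpt.continuousOn hmaps
  -- the two factorizations of the integrand
  set A : ℝ → ℝ → E := fun φ τ => cross v (tangent ρ φ) •
    (g (τ * curve ρ φ) + τ • g' (τ * curve ρ φ) (curve ρ φ)) with hA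
  set B : ℝ → ℝ → E := fun φ τ => cross v (curve ρ φ) • g' (τ * curve ρ φ) (τ * tangent ρ φ) +
    cross v (tangent ρ φ) • g (τ * curve ρ φ) with hB
  have cA : ContinuousOn (Function.uncurry A) K := by
    refine (hcr'.comp continuous_fst).continuousOn.smul (cg.add ?_)
    exact continuous_snd.continuousOn.smul
      (cg'.clm_apply (hγ.comp continuous_fst).continuousOn)
  have cB : ContinuousOn (Function.uncurry B) K := by
    refine ((hcr.comp continuous_fst).continuousOn.smul ?_).add
      ((hcr'.comp continuous_fst).continuousOn.smul cg)
    refine cg'.clm_apply (Continuous.continuousOn ?_)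
    fun_prop
  -- Since γ × γ' = 1 + ρ, the Jacobian times v is (v × γ') γ - (v × γ) γ', so the integrand is a
  -- radial derivative minus an angular one, up to a term added to both.
  have hAB : ∀ φ τ, ((1 + ρ φ) * τ) • g' (τ * curve ρ φ) v = A φ τ - B φ τ := by
    intro φ τ
    have h1 := cross_smul_eq v (curve ρ φ) (tangent ρ φ)
    rw [cross_curve_tangent (h.pos φ)] at h1
    have h2 := congrArg (g' (τ * curve ρ φ)) h1
    rw [map_sub, map_smul, map_smul, map_smul] at h2
    have h3 : g' (τ * curve ρ φ) (τ * tangent ρ φ) =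
        τ • g' (τ * curve ρ φ) (tangent ρ φ) := by rw [← map_smul, Complex.real_smul]
    simp only [hA, hB, h3]
    rw [mul_comm, mul_smul, h2]
    module
  have hAint : ∀ φ ∈ Set.Icc (-Real.pi) Real.pi,
      IntervalIntegrable (A φ) volume 0 1 := fun φ hφ =>
    (ContinuousOn.uncurry_left φ hφ cA).intervalIntegrable_of_Icc zero_le_one
  have hBint : ∀ φ ∈ Set.Icc (-Real.pi) Real.pi,
      IntervalIntegrable (B φ) volume 0 1 := fun φ hφ =>
    (ContinuousOn.uncurry_left φ hφ cB).intervalIntegrable_of_Icc zero_le_one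
  -- For fixed τ, B is the φ-derivative of the periodic function (v × γ) g(τγ), so it integrates to
  -- zero. No second derivative of γ appears.
  have hB0 : ∫ φ in (-Real.pi)..Real.pi, ∫ τ in (0 : ℝ)..1, B φ τ = 0 := by
    rw [integral_swap_of_continuousOn hpi zero_le_one cB]
    have : ∀ τ ∈ Set.uIcc (0 : ℝ) 1, ∫ φ in (-Real.pi)..Real.pi, B φ τ = 0 := by
      intro τ hτ
      rw [Set.uIcc_of_le zero_le_one] at hτ
      have hcont : ContinuousOn (fun φ => B φ τ) (Set.Icc (-Real.pi) Real.pi) :=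
        ContinuousOn.uncurry_right τ hτ cB
      have h1 := intervalIntegral.integral_eq_sub_of_hasDerivAt (a := -Real.pi) (b := Real.pi)
        (f := fun φ => cross v (curve ρ φ) • g (τ * curve ρ φ)) (f' := fun φ => B φ τ) ?_
        (hcont.intervalIntegrable_of_Icc hpi)
      · rw [h1]
        have h2 := curve_periodic ρ (-Real.pi)
        rw [show -Real.pi + 2 * Real.pi = Real.pi by ring] at h2
        simp only [h2, sub_self]
      · intro φ _
        have h2 : HasDerivAt (fun φ => g (τ * curve ρ φ)) (g' (τ * curve ρ φ) (τ * tangent ρ φ)) φ :=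
          (hg _ (hmem hτ φ)).comp_hasDerivAt φ ((h.hasDerivAt_curve φ).const_mul (τ : ℂ))
        have h3 : HasDerivAt (fun φ => cross v (curve ρ φ)) (cross v (tangent ρ φ)) φ :=
          (crossL v).hasFDerivAt.comp_hasDerivAt φ (h.hasDerivAt_curve φ)
        exact h3.smul h2
    rw [intervalIntegral.integral_congr this]
    simp
  -- For fixed φ, A is v × γ' times the τ-derivative of τ g(τγ), so only the boundary value at τ = 1
  -- remains.
  have hA1 : ∀ φ, ∫ τ in (0 : ℝ)..1, A φ τ = cross v (tangent ρ φ) • g (curve ρ φ) := by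
    intro φ
    have h1 := intervalIntegral.integral_eq_sub_of_hasDerivAt (a := 0) (b := 1)
      (f := fun τ : ℝ => τ • g (τ * curve ρ φ))
      (f' := fun τ : ℝ => g (τ * curve ρ φ) + τ • g' (τ * curve ρ φ) (curve ρ φ)) ?_ ?_
    · simp only [hA]
      rw [intervalIntegral.integral_smul, h1]
      simp
    · intro τ hτ
      rw [Set.uIcc_of_le zero_le_one] at hτ
      have h2 : HasDerivAt (fun τ : ℝ => (τ : ℂ) * curve ρ φ) (curve ρ φ) τ := by
        simpa using (hasDerivAt_id τ).ofReal_comp.mul_const (curve ρ φ)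
      have h3 : HasDerivAt (fun τ : ℝ => g (τ * curve ρ φ)) (g' (τ * curve ρ φ) (curve ρ φ)) τ :=
        (hg _ (hmem hτ φ)).comp_hasDerivAt τ h2
      refine ((hasDerivAt_id τ).smul h3).congr_deriv ?_
      simp [add_comm]
    · have h2 : ContinuousOn (fun τ : ℝ => (τ : ℂ) * curve ρ φ) (Set.Icc 0 1) :=
        Continuous.continuousOn (by fun_prop)
      have h3 : Set.MapsTo (fun τ : ℝ => (τ : ℂ) * curve ρ φ) (Set.Icc 0 1) (Metric.ball 0 2) :=
        fun τ hτ => hmem hτ φ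
      exact ContinuousOn.intervalIntegrable_of_Icc zero_le_one ((hgc.comp h2 h3).add
        (continuousOn_id.smul ((hg'.comp h2 h3).clm_apply continuousOn_const)))
  rw [h.setIntegral_starDomain (f := fun z => g' z v) (hg'.clm_apply continuousOn_const)]
  simp only [hAB]
  have h5 : ∀ φ ∈ Set.uIcc (-Real.pi) Real.pi, ∫ τ in (0 : ℝ)..1, (A φ τ - B φ τ) =
      cross v (tangent ρ φ) • g (curve ρ φ) - ∫ τ in (0 : ℝ)..1, B φ τ := fun φ hφ => by
    rw [Set.uIcc_of_le hpi] at hφ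
    rw [intervalIntegral.integral_sub (hAint φ hφ) (hBint φ hφ), hA1]
  rw [intervalIntegral.integral_congr h5, intervalIntegral.integral_sub, hB0, sub_zero]
  · have : Continuous fun φ => cross v (tangent ρ φ) • g (curve ρ φ) := by
      refine hcr'.smul (continuousOn_univ.1 (hgc.comp hγ.continuousOn fun φ _ => ?_))
      simpa using hmem (Set.right_mem_Icc.2 zero_le_one) φ
    exact this.intervalIntegrable _ _
  · exact intervalIntegrable_integral_of_continuousOn hpi zero_le_one cB

end IsGood

end

/-! ### The logarithmic potential along the boundary, by regularization. -/

section

open scoped BoundedContinuousFunction Topology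
open MeasureTheory Kernel

variable {s : ℝ≥0}

/-- The polar Jacobian replaces log y by y log y, which is continuous at 0. -/
theorem integrableOn_log_norm (r : ℝ) :
    IntegrableOn (fun z : ℂ => Real.log ‖z‖) (Metric.ball 0 r) := by
  have h1 : (fun z : ℂ => (Set.Iio r).indicator Real.log ‖z‖) =
      (Metric.ball (0 : ℂ) r).indicator fun z => Real.log ‖z‖ := by
    funext z
    by_cases hz : ‖z‖ < r
    · rw [Set.indicator_of_mem (by exact hz), Set.indicator_of_mem (by simpa using hz)]
    · rw [Set.indicator_of_notMem (by exact hz), Set.indicator_of_notMem (by simpa using hz)]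
  rw [← integrable_indicator_iff measurableSet_ball, ← h1, integrable_fun_norm_addHaar]
  have h2 : IntegrableOn (fun y : ℝ => y * Real.log y) (Set.Ioo 0 r) :=
    (Real.continuous_mul_log.continuousOn.integrableOn_compact isCompact_Icc).mono_set
      Set.Ioo_subset_Icc_self
  have h3 : (Set.Iio r).indicator (fun y : ℝ => y * Real.log y) =
      fun y => y ^ (Module.finrank ℝ ℂ - 1) • (Set.Iio r).indicator Real.log y := by
    funext y
    rw [Complex.finrank_real_complex]
    by_cases hy : y ∈ Set.Iio r
    · simp [Set.indicator_of_mem hy]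
    · simp [Set.indicator_of_notMem hy]
  rw [← h3, IntegrableOn, integrable_indicator_iff measurableSet_Iio, IntegrableOn,
    Measure.restrict_restrict measurableSet_Iio]
  rwa [Set.inter_comm, Set.Ioi_inter_Iio]

theorem integrableOn_log_norm_sub (w : ℂ) {S : Set ℂ} {r : ℝ} (hS : S ⊆ Metric.ball 0 r) :
    IntegrableOn (fun z : ℂ => Real.log ‖w - z‖) S := by
  have h1 := (Measure.measurePreserving_sub_left (volume : Measure ℂ) w).integrableOn_comp_preimage
    (Homeomorph.subLeft w).measurableEmbedding
    (s := Metric.ball 0 (‖w‖ + r)) (f := fun z : ℂ => Real.log ‖z‖)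
  refine (h1.2 (integrableOn_log_norm _)).mono_set fun z hz => ?_
  have h2 := hS hz
  rw [mem_ball_zero_iff] at h2
  rw [Set.mem_preimage, mem_ball_zero_iff]
  exact (norm_sub_le _ _).trans_lt (by linarith)

/-- The regularized logarithm `½ log (|z|² + k)`. -/
def regLog (k : ℝ) (z : ℂ) : ℝ := 1 / 2 * Real.log (Complex.normSq z + k)

/-- The derivative of the regularized logarithm. -/
def regLogDeriv (k : ℝ) (z : ℂ) : ℂ →L[ℝ] ℝ :=
  (Complex.normSq z + k)⁻¹ • (z.re • Complex.reCLM + z.im • Complex.imCLM)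

theorem hasFDerivAt_regLog {k : ℝ} (hk : 0 < k) (z : ℂ) :
    HasFDerivAt (regLog k) (regLogDeriv k z) z := by
  have hpos : 0 < Complex.normSq z + k := by positivity [Complex.normSq_nonneg z]
  have h1 : HasFDerivAt (fun z : ℂ => z.re * z.re + z.im * z.im + k)
      ((z.re • Complex.reCLM + z.re • Complex.reCLM) +
        (z.im • Complex.imCLM + z.im • Complex.imCLM)) z :=
    ((Complex.reCLM.hasFDerivAt.mul Complex.reCLM.hasFDerivAt).add
      (Complex.imCLM.hasFDerivAt.mul Complex.imCLM.hasFDerivAt)).add_const k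
  have h2 : HasFDerivAt (fun z : ℂ => Complex.normSq z + k) _ z := h1
  refine ((h2.log hpos.ne').const_mul (1 / 2 : ℝ)).congr_fderiv ?_
  ext
  all_goals
    simp [regLogDeriv]
    ring

theorem continuous_regLogDeriv {k : ℝ} (hk : 0 < k) : Continuous (regLogDeriv k) := by
  have h1 : ∀ z : ℂ, Complex.normSq z + k ≠ 0 := fun z => by
    have := Complex.normSq_nonneg z
    positivity
  unfold regLogDeriv
  have := Complex.continuous_normSq
  have h2 := Complex.continuous_re
  have h3 := Complex.continuous_im
  fun_prop (disch := exact h1 _)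

theorem norm_regLogDeriv_le {k : ℝ} (hk : 0 < k) (z v : ℂ) :
    ‖regLogDeriv k z v‖ ≤ k⁻¹ * (‖z‖ * ‖v‖) := by
  have h0 := Complex.normSq_nonneg z
  have h1 : regLogDeriv k z v = (Complex.normSq z + k)⁻¹ * ((starRingEnd ℂ) z * v).re := by
    simp [regLogDeriv]
    ring
  have h2 : |((starRingEnd ℂ) z * v).re| ≤ ‖z‖ * ‖v‖ := by
    refine (Complex.abs_re_le_norm _).trans_eq ?_
    rw [norm_mul, Complex.norm_conj]
  rw [h1, norm_mul, Real.norm_eq_abs, Real.norm_eq_abs, abs_of_pos (by positivity)]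
  gcongr
  linarith

theorem continuous_regLog {k : ℝ} (hk : 0 < k) : Continuous (regLog k) :=
  continuous_iff_continuousAt.2 fun z => (hasFDerivAt_regLog hk z).continuousAt

theorem regLog_sub_log_le {k d : ℝ} (hk : 0 < k) (hd : 0 < d) {z : ℂ} (hz : d ≤ ‖z‖) :
    |regLog k z - Real.log ‖z‖| ≤ 1 / 2 * Real.log (1 + k / d ^ 2) := by
  have hn : 0 < ‖z‖ := hd.trans_le hz
  have h1 : regLog k z - Real.log ‖z‖ = 1 / 2 * Real.log (1 + k / ‖z‖ ^ 2) := by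
    have h2 : Complex.normSq z + k = ‖z‖ ^ 2 * (1 + k / ‖z‖ ^ 2) := by
      rw [Complex.normSq_eq_norm_sq]
      field_simp
    rw [regLog, h2, Real.log_mul (by positivity) (by positivity), Real.log_pow]
    push_cast
    ring
  rw [h1, abs_of_nonneg (mul_nonneg (by norm_num) (Real.log_nonneg (by simp; positivity)))]
  gcongr

variable {hs0 : 0 < s} {hs1 : s ≤ 1} {ρ : HolderEven s}

theorem volume_starDomain_lt_top (h : IsGood hs1 ρ) : volume (starDomain ρ) < ⊤ :=
  (measure_mono h.starDomain_subset).trans_lt measure_ball_lt_top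

theorem IsGood.norm_curve_sub_le (h : IsGood hs1 ρ) (θ : ℝ) {z : ℂ} (hz : z ∈ starDomain ρ) :
    ‖curve ρ θ - z‖ ≤ 3 := by
  have h1 := h.starDomain_subset hz
  rw [mem_ball_zero_iff] at h1
  refine (norm_sub_le _ _).trans ?_
  linarith [h.norm_curve_le θ]

/-- The regularized kernel can be differentiated under the integral. Its θ-derivative is minus the
derivative in z in the fixed direction γ'(θ), and Green's formula moves that to the boundary. -/
theorem hasDerivAt_integral_regLog (h : IsGood hs1 ρ) (hs0 : 0 < s) {k : ℝ} (hk : 0 < k) (θ : ℝ) :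
    HasDerivAt (fun θ => ∫ z in starDomain ρ, regLog k (curve ρ θ - z))
      (-∫ φ in (-Real.pi)..Real.pi, cross (tangent ρ θ) (tangent ρ φ) *
        regLog k (curve ρ θ - curve ρ φ)) θ := by
  have hfin := volume_starDomain_lt_top h
  have hc := continuous_regLog hk
  have hc' := continuous_regLogDeriv hk
  have hbd : ∀ᵐ z ∂volume.restrict (starDomain ρ), ∀ x : ℝ, x ∈ Set.univ →
      ‖regLogDeriv k (curve ρ x - z) (tangent ρ x)‖ ≤ k⁻¹ * (3 * 2) := by
    filter_upwards [ae_restrict_mem (measurableSet_starDomain ρ)] with z hz x _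
    refine (norm_regLogDeriv_le hk _ _).trans ?_
    have h1 := h.norm_curve_sub_le x hz
    have h2 := h.norm_tangent_le x
    gcongr
  have hint : Integrable (fun z => regLog k (curve ρ θ - z)) (volume.restrict (starDomain ρ)) := by
    have h1 : Continuous fun z => regLog k (curve ρ θ - z) := by fun_prop
    exact (h1.continuousOn.integrableOn_compact (isCompact_closedBall 0 (3 / 2))).mono_set
      (h.starDomain_subset.trans Metric.ball_subset_closedBall)
  have hmain := (hasDerivAt_integral_of_dominated_loc_of_deriv_le (μ := volume.restrict (starDomain ρ))
    (F := fun θ z => regLog k (curve ρ θ - z))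
    (F' := fun θ z => regLogDeriv k (curve ρ θ - z) (tangent ρ θ)) (x₀ := θ)
    (bound := fun _ => k⁻¹ * (3 * 2)) Filter.univ_mem
    (Filter.Eventually.of_forall fun x => Continuous.aestronglyMeasurable (by fun_prop)) hint
    (Continuous.aestronglyMeasurable (by fun_prop)) hbd
    (integrableOn_const hfin.ne)
    (Filter.Eventually.of_forall fun z x _ =>
      (hasFDerivAt_regLog hk _).comp_hasDerivAt x ((h.hasDerivAt_curve x).sub_const z))).2
  refine hmain.congr_deriv ?_
  have hgreen := h.integral_fderiv_starDomain hs0 (g := fun z => regLog k (curve ρ θ - z))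
    (g' := fun z => -regLogDeriv k (curve ρ θ - z))
    (fun z _ => by
      have h1 := (hasFDerivAt_regLog hk (curve ρ θ - z)).comp z
        ((hasFDerivAt_id z).const_sub (curve ρ θ))
      refine h1.congr_fderiv ?_
      ext1
      all_goals simp) (by fun_prop) (tangent ρ θ)
  simp only [smul_eq_mul] at hgreen
  rw [← hgreen, ← integral_neg]
  exact integral_congr_ae (Filter.Eventually.of_forall fun z => (neg_neg _).symm)

theorem tendsto_integral_regLog (h : IsGood hs1 ρ) (θ : ℝ) :
    Filter.Tendsto (fun n : ℕ => ∫ z in starDomain ρ, regLog (1 / (n + 1 : ℝ)) (curve ρ θ - z))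
      Filter.atTop (𝓝 (∫ z in starDomain ρ, Real.log ‖curve ρ θ - z‖)) := by
  have hint : IntegrableOn (fun z => Real.log ‖curve ρ θ - z‖) (starDomain ρ) :=
    integrableOn_log_norm_sub _ h.starDomain_subset
  have hk : ∀ n : ℕ, (0 : ℝ) < 1 / (n + 1 : ℝ) := fun n => Nat.one_div_pos_of_nat
  have hne : ∀ᵐ z ∂volume.restrict (starDomain ρ), z ≠ curve ρ θ := by
    refine ae_restrict_of_ae ?_
    exact compl_mem_ae_iff.2 (measure_singleton _)
  refine tendsto_integral_of_dominated_convergence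
    -- The regularized logarithm lies between log |γ(θ) - z| and ½ log 10, because |γ(θ) - z| ≤ 3
    -- and the regularization parameter is at most 1.
    (fun z => |Real.log ‖curve ρ θ - z‖| + |1 / 2 * Real.log 10|) (fun n => ?_) ?_ (fun n => ?_) ?_
  · have := continuous_regLog (hk n)
    exact Continuous.aestronglyMeasurable (by fun_prop)
  · exact hint.abs.add (integrableOn_const (volume_starDomain_lt_top h).ne)
  · filter_upwards [hne, ae_restrict_mem (measurableSet_starDomain ρ)] with z hz hzm
    have hpos : 0 < ‖curve ρ θ - z‖ := norm_pos_iff.2 (sub_ne_zero.2 hz.symm)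
    have h3 := h.norm_curve_sub_le θ hzm
    have hk1 : 1 / (n + 1 : ℝ) ≤ 1 := by
      rw [div_le_one (by positivity)]
      linarith [n.cast_nonneg (α := ℝ)]
    have hlow : Real.log ‖curve ρ θ - z‖ ≤ regLog (1 / (n + 1 : ℝ)) (curve ρ θ - z) := by
      rw [regLog, Complex.normSq_eq_norm_sq]
      have h4 : Real.log (‖curve ρ θ - z‖ ^ 2) ≤
          Real.log (‖curve ρ θ - z‖ ^ 2 + 1 / (n + 1 : ℝ)) :=
        Real.log_le_log (by positivity) (by linarith [hk n])
      rw [Real.log_pow] at h4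
      push_cast at h4
      linarith
    have hup : regLog (1 / (n + 1 : ℝ)) (curve ρ θ - z) ≤ 1 / 2 * Real.log 10 := by
      rw [regLog, Complex.normSq_eq_norm_sq]
      have h4 := hk n
      gcongr
      nlinarith
    rw [Real.norm_eq_abs, abs_le]
    have h5 := neg_abs_le (Real.log ‖curve ρ θ - z‖)
    have h6 := le_abs_self (1 / 2 * Real.log 10)
    constructor
    · linarith [abs_nonneg (1 / 2 * Real.log 10)]
    · linarith [abs_nonneg (Real.log ‖curve ρ θ - z‖)]
  · filter_upwards [hne] with z hz
    have hpos : 0 < ‖curve ρ θ - z‖ := norm_pos_iff.2 (sub_ne_zero.2 hz.symm)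
    have h1 : ContinuousAt (fun k : ℝ => 1 / 2 * Real.log (Complex.normSq (curve ρ θ - z) + k)) 0 := by
      refine continuousAt_const.mul (ContinuousAt.log (by fun_prop) ?_)
      rw [Complex.normSq_eq_norm_sq]
      positivity
    have h2 := h1.tendsto.comp (tendsto_one_div_add_atTop_nhds_zero_nat (𝕜 := ℝ))
    have h3 : 1 / 2 * Real.log (Complex.normSq (curve ρ θ - z) + 0) =
        Real.log ‖curve ρ θ - z‖ := by
      rw [Complex.normSq_eq_norm_sq, add_zero, Real.log_pow]
      push_cast
      ring
    rwa [h3] at h2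

theorem abs_cross_le (v w : ℂ) : |cross v w| ≤ ‖v‖ * ‖w‖ := by
  have h : cross v w = ((starRingEnd ℂ) v * w).im := by simp [cross]; ring
  rw [h]
  refine (Complex.abs_im_le_norm _).trans_eq ?_
  rw [norm_mul, Complex.norm_conj]

/-- The error of the regularization of the logarithm on the chord of angle `α`. -/
def chordError (k α : ℝ) : ℝ := 1 / 2 * Real.log (1 + k / Real.sin (α / 2) ^ 2)

theorem chordError_nonneg {k : ℝ} (hk : 0 < k) (α : ℝ) : 0 ≤ chordError k α := by
  refine mul_nonneg (by norm_num) (Real.log_nonneg ?_)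
  have : 0 ≤ k / Real.sin (α / 2) ^ 2 := by positivity
  linarith

/-- From k ≤ 1 and sin² ≤ 1 follows 1 + k/sin² ≤ 2/sin². This gives an integrable majorant
independent of k. -/
theorem chordError_le {k : ℝ} (hk : 0 < k) (hk1 : k ≤ 1) (α : Arc) :
    chordError k α ≤ 3 / 2 * Real.log 2 - logChord α := by
  have hs := sin_half_pos α
  have h1 : (1 + k / Real.sin (α / 2) ^ 2) ≤ 2 / Real.sin (α / 2) ^ 2 := by
    rw [le_div_iff₀ (by positivity), add_mul, div_mul_cancel₀ _ (by positivity)]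
    nlinarith [Real.sin_sq_le_one ((α : ℝ) / 2)]
  have h2 := Real.log_le_log (by positivity) h1
  rw [Real.log_div (by norm_num) (by positivity), Real.log_pow] at h2
  rw [chordError, logChord, Real.log_mul (by norm_num) hs.ne']
  push_cast at h2
  linarith

theorem integrable_chordError {k : ℝ} (hk : 0 < k) (hk1 : k ≤ 1) :
    Integrable fun α : Arc => chordError k α := by
  have hb : Integrable fun α : Arc => 3 / 2 * Real.log 2 - logChord α :=
    (integrable_one_arc.const_mul (3 / 2 * Real.log 2)).congr
      (Filter.Eventually.of_forall fun _ => mul_one _) |>.sub integrable_logChord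
  refine hb.mono' ?_ (Filter.Eventually.of_forall fun α => ?_)
  · refine Measurable.aestronglyMeasurable ?_
    unfold chordError
    fun_prop
  · rw [Real.norm_eq_abs, abs_of_nonneg (chordError_nonneg hk _)]
    exact chordError_le hk hk1 α

theorem tendsto_integral_chordError :
    Filter.Tendsto (fun n : ℕ => ∫ α : Arc, chordError (1 / (n + 1 : ℝ)) α)
      Filter.atTop (𝓝 0) := by
  have hk : ∀ n : ℕ, (0 : ℝ) < 1 / (n + 1 : ℝ) := fun n => Nat.one_div_pos_of_nat
  have hk1 : ∀ n : ℕ, 1 / (n + 1 : ℝ) ≤ 1 := fun n => by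
    rw [div_le_one (by positivity)]
    linarith [n.cast_nonneg (α := ℝ)]
  have hb : Integrable fun α : Arc => 3 / 2 * Real.log 2 - logChord α :=
    (integrable_one_arc.const_mul (3 / 2 * Real.log 2)).congr
      (Filter.Eventually.of_forall fun _ => mul_one _) |>.sub integrable_logChord
  have h0 : ∫ _ : Arc, (0 : ℝ) = 0 := integral_zero _ _
  suffices h3 : Filter.Tendsto (fun n : ℕ => ∫ α : Arc, chordError (1 / (n + 1 : ℝ)) α)
      Filter.atTop (𝓝 (∫ _ : Arc, (0 : ℝ))) by rwa [h0] at h3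
  refine tendsto_integral_of_dominated_convergence _
    (fun n => (integrable_chordError (hk n) (hk1 n)).aestronglyMeasurable) hb
    (fun n => Filter.Eventually.of_forall fun α => ?_) (Filter.Eventually.of_forall fun α => ?_)
  · rw [Real.norm_eq_abs, abs_of_nonneg (chordError_nonneg (hk n) _)]
    exact chordError_le (hk n) (hk1 n) α
  · have h1 : ContinuousAt (fun k : ℝ => chordError k α) 0 := by
      unfold chordError
      exact continuousAt_const.mul (ContinuousAt.log (by fun_prop) (by simp))
    have h2 := h1.tendsto.comp (tendsto_one_div_add_atTop_nhds_zero_nat (𝕜 := ℝ))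
    have h3 : chordError 0 α = 0 := by simp [chordError]
    rwa [h3] at h2

/-- The derivative of the logarithmic potential of the domain along its boundary. -/
theorem IsGood.hasDerivAt_integral_log (h : IsGood hs1 ρ) (hs0 : 0 < s) (θ : ℝ) :
    HasDerivAt (fun θ => ∫ z in starDomain ρ, Real.log ‖curve ρ θ - z‖)
      (selfMap hs0 hs1 ρ θ) θ := by
  have hk : ∀ n : ℕ, (0 : ℝ) < 1 / (n + 1 : ℝ) := fun n => Nat.one_div_pos_of_nat
  have hk1 : ∀ n : ℕ, 1 / (n + 1 : ℝ) ≤ 1 := fun n => by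
    rw [div_le_one (by positivity)]
    linarith [n.cast_nonneg (α := ℝ)]
  have hγ := continuous_curve ρ
  have hγ' := h.continuous_tangent hs0
  -- The regularized derivatives converge uniformly in θ: tangents have norm at most 2, so the error
  -- is at most 4 times the integral of `chordError`, which does not depend on θ.
  refine hasDerivAt_of_tendstoUniformly (l := Filter.atTop) (𝕜 := ℝ)
    (f := fun (n : ℕ) θ => ∫ z in starDomain ρ, regLog (1 / (n + 1 : ℝ)) (curve ρ θ - z))
    ?_ (Filter.Eventually.of_forall fun n θ => hasDerivAt_integral_regLog h hs0 (hk n) θ)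
    (fun θ => tendsto_integral_regLog h θ) θ
  rw [Metric.tendstoUniformly_iff]
  intro ε hε
  have hsmall := (tendsto_integral_chordError.const_mul 4).eventually
    (gt_mem_nhds (show 4 * (0 : ℝ) < ε by simpa using hε))
  filter_upwards [hsmall] with n hn θ
  refine lt_of_le_of_lt ?_ hn
  have hcr : Continuous fun φ => cross (tangent ρ θ) (tangent ρ φ) :=
    (crossL (tangent ρ θ)).continuous.comp hγ'
  have hreg := continuous_regLog (hk n)
  -- both integrals over the arc
  have e1 : ∫ φ in (-Real.pi)..Real.pi, cross (tangent ρ θ) (tangent ρ φ) *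
        regLog (1 / (n + 1 : ℝ)) (curve ρ θ - curve ρ φ) =
      ∫ α : Arc, regLog (1 / (n + 1 : ℝ)) (curve ρ θ - curve ρ (θ - α)) *
        cross (tangent ρ θ) (tangent ρ (θ - α)) := by
    have hp : Function.Periodic (fun φ => regLog (1 / (n + 1 : ℝ)) (curve ρ θ - curve ρ φ) *
        cross (tangent ρ θ) (tangent ρ φ)) (2 * Real.pi) := fun φ => by
      simp only [curve_periodic ρ φ, tangent_periodic ρ φ]
    have h1 := intervalIntegral.integral_comp_sub_left (a := 0) (b := 2 * Real.pi)
      (fun φ => regLog (1 / (n + 1 : ℝ)) (curve ρ θ - curve ρ φ) *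
        cross (tangent ρ θ) (tangent ρ φ)) θ
    have h2 := hp.intervalIntegral_add_eq (θ - 2 * Real.pi) (-Real.pi)
    rw [integral_arc_eq fun α => regLog (1 / (n + 1 : ℝ)) (curve ρ θ - curve ρ (θ - α)) *
        cross (tangent ρ θ) (tangent ρ (θ - α)), h1, sub_zero]
    rw [show θ - 2 * Real.pi + 2 * Real.pi = θ by ring,
      show -Real.pi + 2 * Real.pi = Real.pi by ring] at h2
    rw [h2]
    simp only [mul_comm]
  have hdiff : ∀ α : Arc, |regLog (1 / (n + 1 : ℝ)) (curve ρ θ - curve ρ (θ - α)) *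
      cross (tangent ρ θ) (tangent ρ (θ - α)) - Real.log ‖curve ρ θ - curve ρ (θ - α)‖ *
        cross (tangent ρ θ) (tangent ρ (θ - α))| ≤ 4 * chordError (1 / (n + 1 : ℝ)) α := by
    intro α
    rw [← sub_mul, abs_mul, mul_comm]
    have h1 := regLog_sub_log_le (hk n) (sin_half_pos α) (h.sin_le_norm_curve_sub θ α)
    have h2 := abs_cross_le (tangent ρ θ) (tangent ρ (θ - α))
    have h3 := h.norm_tangent_le θ
    have h4 := h.norm_tangent_le (θ - α)
    have h5 : |cross (tangent ρ θ) (tangent ρ (θ - α))| ≤ 4 := by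
      refine h2.trans ?_
      nlinarith [norm_nonneg (tangent ρ θ), norm_nonneg (tangent ρ (θ - α))]
    exact mul_le_mul h5 h1 (abs_nonneg _) (by norm_num)
  have i1 : Integrable fun α : Arc => regLog (1 / (n + 1 : ℝ)) (curve ρ θ - curve ρ (θ - α)) *
      cross (tangent ρ θ) (tangent ρ (θ - α)) := by
    refine integrable_arc (f := fun α => regLog (1 / (n + 1 : ℝ)) (curve ρ θ - curve ρ (θ - α)) *
      cross (tangent ρ θ) (tangent ρ (θ - α))) (Continuous.intervalIntegrable ?_ _ _)
    have := hcr.comp (continuous_const.sub continuous_id : Continuous fun α : ℝ => θ - α)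
    exact Continuous.mul (by fun_prop) this
  have i2 : Integrable fun α : Arc => Real.log ‖curve ρ θ - curve ρ (θ - α)‖ *
      cross (tangent ρ θ) (tangent ρ (θ - α)) := by
    have h6 : Integrable fun α : Arc => regLog (1 / (n + 1 : ℝ)) (curve ρ θ - curve ρ (θ - α)) *
      cross (tangent ρ θ) (tangent ρ (θ - α)) - Real.log ‖curve ρ θ - curve ρ (θ - α)‖ *
        cross (tangent ρ θ) (tangent ρ (θ - α)) := by
      refine ((integrable_chordError (hk n) (hk1 n)).const_mul 4).mono'
        (i1.aestronglyMeasurable.sub (Measurable.aestronglyMeasurable ?_))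
        (Filter.Eventually.of_forall hdiff)
      have h7 : Measurable fun α : Arc => (α : ℝ) := measurable_subtype_coe
      have h8 : Measurable fun α : ℝ => Real.log ‖curve ρ θ - curve ρ (θ - α)‖ *
          cross (tangent ρ θ) (tangent ρ (θ - α)) := by
        have h9 := (hcr.comp (continuous_const.sub continuous_id :
          Continuous fun α : ℝ => θ - α)).measurable
        have h10 : Continuous fun α : ℝ => ‖curve ρ θ - curve ρ (θ - α)‖ := by fun_prop
        exact (Real.measurable_log.comp h10.measurable).mul h9
      exact h8.comp h7
    refine (i1.sub h6).congr (Filter.Eventually.of_forall fun α => ?_)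
    simp
  rw [h.selfMap_apply, e1, ← integral_arc_eq fun α => Real.log ‖curve ρ θ - curve ρ (θ - α)‖ *
    cross (tangent ρ θ) (tangent ρ (θ - α)), Real.dist_eq, neg_sub_neg, ← integral_sub i1 i2,
    ← integral_const_mul]
  exact (abs_integral_le_integral_abs).trans
    (integral_mono (i1.sub i2).abs ((integrable_chordError (hk n) (hk1 n)).const_mul 4) hdiff)

end

/-! ### Area integrals of holomorphic functions and the image potential. -/

section

open scoped BoundedContinuousFunction Topology
open MeasureTheory Kernel

variable {s : ℝ≥0} {hs0 : 0 < s} {hs1 : s ≤ 1} {ρ : HolderEven s}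

theorem IsGood.integrableOn_of_continuousOn {E : Type*} [NormedAddCommGroup E] (h : IsGood hs1 ρ)
    {f : ℂ → E} (hf : ContinuousOn f (Metric.ball 0 2)) : IntegrableOn f (starDomain ρ) := by
  have h1 : Metric.closedBall (0 : ℂ) (3 / 2) ⊆ Metric.ball 0 2 :=
    Metric.closedBall_subset_ball (by norm_num)
  exact ((hf.mono h1).integrableOn_compact (isCompact_closedBall 0 (3 / 2))).mono_set
    (h.starDomain_subset.trans Metric.ball_subset_closedBall)

theorem IsGood.continuous_comp_curve {E : Type*} [NormedAddCommGroup E] (h : IsGood hs1 ρ)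
    {f : ℂ → E} (hf : ContinuousOn f (Metric.ball 0 2)) : Continuous fun φ => f (curve ρ φ) :=
  continuousOn_univ.1 (hf.comp (continuous_curve ρ).continuousOn fun φ _ => by
    rw [mem_ball_zero_iff]
    exact (h.norm_curve_le φ).trans_lt (by norm_num))

/-- The area integral of a holomorphic function as a contour integral. -/
theorem IsGood.setIntegral_holomorphic (h : IsGood hs1 ρ) (hs0 : 0 < s) {f : ℂ → ℂ}
    (hf : DifferentiableOn ℂ f (Metric.ball 0 2)) :
    ∫ z in starDomain ρ, f z = -(Complex.I / 2) * ∫ φ in (-Real.pi)..Real.pi,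
      f (curve ρ φ) * ((starRingEnd ℂ) (curve ρ φ) * tangent ρ φ) := by
  -- Since f is holomorphic, f is the ∂̄-derivative of f(z) z̄, that is ½(∂ₓ + i∂ᵧ) of it. Green's
  -- formula in the directions 1 and i then gives the contour integral.
  set g' : ℂ → ℂ →L[ℝ] ℂ := fun z =>
    f z • (Complex.conjCLE : ℂ →L[ℝ] ℂ) +
      (starRingEnd ℂ) z • (deriv f z • (ContinuousLinearMap.id ℝ ℂ)) with hg'
  have hg : ∀ z ∈ Metric.ball (0 : ℂ) 2, HasFDerivAt (fun z => f z * (starRingEnd ℂ) z) (g' z) z := by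
    intro z hz
    have h1 : HasFDerivAt f (deriv f z • (ContinuousLinearMap.id ℝ ℂ)) z := by
      have h2 := (hf.differentiableAt (Metric.isOpen_ball.mem_nhds hz)).hasDerivAt.hasFDerivAt
      refine (h2.restrictScalars ℝ).congr_fderiv ?_
      ext1
      simp [mul_comm]
    exact h1.mul (Complex.conjCLE : ℂ →L[ℝ] ℂ).hasFDerivAt
  have hc : ContinuousOn g' (Metric.ball 0 2) := by
    have h1 := hf.continuousOn
    have h2 := (hf.deriv Metric.isOpen_ball).continuousOn
    have h3 : ContinuousOn (fun z : ℂ => (starRingEnd ℂ) z) (Metric.ball 0 2) :=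
      Complex.continuous_conj.continuousOn
    exact (h1.smul continuousOn_const).add (h3.smul (h2.smul continuousOn_const))
  have e1 := h.integral_fderiv_starDomain hs0 hg hc 1
  have e2 := h.integral_fderiv_starDomain hs0 hg hc Complex.I
  have i1 := h.integrableOn_of_continuousOn (hc.clm_apply (continuousOn_const (c := (1 : ℂ))))
  have i2 := h.integrableOn_of_continuousOn (hc.clm_apply (continuousOn_const (c := Complex.I)))
  have e3 : ∀ z, f z = 1 / 2 * (g' z 1 + Complex.I * g' z Complex.I) := fun z => by
    simp [hg']
    linear_combination (-(1 / 2) * (starRingEnd ℂ) z * deriv f z + 1 / 2 * f z) * Complex.I_sq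
  have e4 : ∫ z in starDomain ρ, f z = ∫ z in starDomain ρ,
      1 / 2 * (g' z 1 + Complex.I * g' z Complex.I) :=
    integral_congr_ae (Filter.Eventually.of_forall e3)
  rw [e4, integral_const_mul, integral_add i1 (i2.const_mul _), integral_const_mul, e1, e2,
    ← intervalIntegral.integral_const_mul, ← intervalIntegral.integral_add,
    ← intervalIntegral.integral_const_mul, ← intervalIntegral.integral_const_mul]
  · refine intervalIntegral.integral_congr fun φ _ => ?_
    have h1 := Complex.re_add_im (tangent ρ φ)
    have e5 : cross 1 (tangent ρ φ) = (tangent ρ φ).im := by simp [cross]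
    have e6 : cross Complex.I (tangent ρ φ) = -(tangent ρ φ).re := by simp [cross]
    simp only [e5, e6, Complex.real_smul]
    push_cast
    linear_combination (-(Complex.I / 2) * f (curve ρ φ) * (starRingEnd ℂ) (curve ρ φ)) * h1 +
      (1 / 2 * f (curve ρ φ) * (starRingEnd ℂ) (curve ρ φ) * (tangent ρ φ).im) * Complex.I_sq
  all_goals
    have h1 : Continuous fun φ => f (curve ρ φ) * (starRingEnd ℂ) (curve ρ φ) :=
      (h.continuous_comp_curve hf.continuousOn).mul
        (Complex.continuous_conj.comp (continuous_curve ρ))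
  · exact (((crossL 1).continuous.comp (h.continuous_tangent hs0)).smul h1).intervalIntegrable _ _
  · exact (continuous_const.mul
      (((crossL Complex.I).continuous.comp (h.continuous_tangent hs0)).smul h1)).intervalIntegrable _ _

section image

variable {ε q : ℝ}

theorem norm_mul_add_le {c : ℝ} (hc : 2 * |ε| + |q| ≤ c) {z : ℂ} (hz : ‖z‖ ≤ 2) :
    ‖(ε : ℂ) * z + q‖ ≤ c := by
  refine (norm_add_le _ _).trans (le_trans ?_ hc)
  rw [norm_mul, Complex.norm_real, Complex.norm_real, Real.norm_eq_abs, Real.norm_eq_abs, mul_comm]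
  gcongr

theorem norm_image_mul_le {c : ℝ} (hc : 2 * |ε| + |q| ≤ c) {z w : ℂ} (hz : ‖z‖ ≤ 2)
    (hw : ‖w‖ ≤ 2) :
    ‖((ε : ℂ) * (starRingEnd ℂ) z + q) * ((ε : ℂ) * w + q)‖ ≤ c * c := by
  rw [norm_mul]
  have h1 := norm_mul_add_le hc (z := (starRingEnd ℂ) z) (by rwa [Complex.norm_conj])
  have h2 := norm_mul_add_le hc hw
  have h3 := norm_nonneg ((ε : ℂ) * w + q)
  exact mul_le_mul h1 h2 h3 ((norm_nonneg _).trans h1)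

/-- The image factor `1 - (ε z̄ + q) (ε w + q)`. -/
def imageDenom (ε q : ℝ) (z w : ℂ) : ℂ :=
  1 - ((ε : ℂ) * (starRingEnd ℂ) z + q) * ((ε : ℂ) * w + q)

theorem le_norm_imageDenom {c : ℝ} (hc : 2 * |ε| + |q| ≤ c) {z w : ℂ} (hz : ‖z‖ ≤ 2)
    (hw : ‖w‖ ≤ 2) : 1 - c * c ≤ ‖imageDenom ε q z w‖ := by
  have h1 := norm_image_mul_le hc hz hw
  have h2 := norm_sub_norm_le (1 : ℂ) (((ε : ℂ) * (starRingEnd ℂ) z + q) * ((ε : ℂ) * w + q))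
  rw [norm_one] at h2
  rw [imageDenom]
  linarith

/-- Both factors of the product have modulus less than 1, so the denominator is 1 minus a number of
the open unit disc. -/
theorem imageDenom_mem_slitPlane (hc : 2 * |ε| + |q| < 1) {z w : ℂ} (hz : ‖z‖ ≤ 2)
    (hw : ‖w‖ ≤ 2) : imageDenom ε q z w ∈ Complex.slitPlane := by
  refine Complex.mem_slitPlane_of_norm_lt_one (z := -_) ?_ |> fun h => by
    rw [imageDenom, sub_eq_add_neg]; exact h
  rw [norm_neg]
  have := norm_image_mul_le le_rfl hz hw (ε := ε) (q := q)
  have h0 : 0 ≤ 2 * |ε| + |q| := by positivity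
  nlinarith

/-- The logarithm of the modulus is the real part of the complex logarithm. The variable θ enters
only through ε conj γ(θ), which yields the factor ε that later cancels the one in 1/(εq). -/
theorem IsGood.hasDerivAt_log_imageDenom (h : IsGood hs1 ρ) (hc : 2 * |ε| + |q| < 1) {z : ℂ}
    (hz : ‖z‖ ≤ 2) (θ : ℝ) :
    HasDerivAt (fun θ => Real.log ‖imageDenom ε q (curve ρ θ) z‖)
      (-(ε * ((starRingEnd ℂ) (tangent ρ θ) * imageQuotient ε q (curve ρ θ) z).re)) θ := by
  have h1 : HasDerivAt (fun θ => (starRingEnd ℂ) (curve ρ θ)) ((starRingEnd ℂ) (tangent ρ θ)) θ :=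
    (Complex.conjCLE : ℂ →L[ℝ] ℂ).hasFDerivAt.comp_hasDerivAt θ (h.hasDerivAt_curve θ)
  have h2 : HasDerivAt (fun θ => imageDenom ε q (curve ρ θ) z)
      (-((ε : ℂ) * (starRingEnd ℂ) (tangent ρ θ) * ((ε : ℂ) * z + q))) θ :=
    (((h1.const_mul (ε : ℂ)).add_const (q : ℂ)).mul_const ((ε : ℂ) * z + q)).const_sub 1
  have h3 := h2.clog_real (imageDenom_mem_slitPlane hc ((h.norm_curve_le θ).trans (by norm_num)) hz)
  have h4 := Complex.reCLM.hasFDerivAt.comp_hasDerivAt θ h3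
  have e1 : (fun θ => Real.log ‖imageDenom ε q (curve ρ θ) z‖) =
      (⇑Complex.reCLM ∘ fun t => Complex.log (imageDenom ε q (curve ρ t) z)) := by
    funext t
    simp [Complex.log_re]
  rw [e1]
  refine h4.congr_deriv ?_
  rw [← Complex.re_ofReal_mul, ← Complex.neg_re, Complex.reCLM_apply, imageQuotient, imageDenom]
  congr 1
  ring

theorem differentiableOn_imageQuotient (hc : 2 * |ε| + |q| < 1) {z : ℂ} (hz : ‖z‖ ≤ 2) :
    DifferentiableOn ℂ (imageQuotient ε q z) (Metric.ball 0 2) := by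
  intro w hw
  rw [mem_ball_zero_iff] at hw
  have h1 := Complex.slitPlane_ne_zero (imageDenom_mem_slitPlane hc hz hw.le)
  refine DifferentiableAt.differentiableWithinAt ?_
  unfold imageQuotient
  exact DifferentiableAt.div (by fun_prop) (by fun_prop) h1

theorem continuousOn_log_imageDenom (hc : 2 * |ε| + |q| < 1) {z : ℂ} (hz : ‖z‖ ≤ 2) :
    ContinuousOn (fun w => Real.log ‖imageDenom ε q z w‖) (Metric.ball 0 2) := by
  intro w hw
  rw [mem_ball_zero_iff] at hw
  have h1 := Complex.slitPlane_ne_zero (imageDenom_mem_slitPlane hc hz hw.le)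
  refine ContinuousAt.continuousWithinAt (ContinuousAt.log ?_ (norm_ne_zero_iff.2 h1))
  unfold imageDenom
  fun_prop

/-- The derivative of the image potential of the domain along its boundary. -/
theorem IsGood.hasDerivAt_integral_image (h : IsGood hs1 ρ) (hs0 : 0 < s)
    (hc : 2 * |ε| + |q| < 1) (hu : IsUnit (imageDenomK hs1 (ε, q, ρ))) (θ : ℝ) :
    HasDerivAt (fun θ => ∫ z in starDomain ρ, Real.log ‖imageDenom ε q (curve ρ θ) z‖)
      (ε * imageMap hs0 hs1 (ε, q, ρ) θ) θ := by
  set c := 2 * |ε| + |q| with hcdef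
  have hc0 : 0 ≤ c := by positivity
  have hcc : 0 < 1 - c * c := by nlinarith
  have hle : ∀ x, ‖curve ρ x‖ ≤ 2 := fun x => (h.norm_curve_le x).trans (by norm_num)
  have hQ : ∀ x, IntegrableOn (imageQuotient ε q (curve ρ x)) (starDomain ρ) := fun x =>
    h.integrableOn_of_continuousOn (differentiableOn_imageQuotient hc (hle x)).continuousOn
  have hbd : ∀ᵐ z ∂volume.restrict (starDomain ρ), ∀ x : ℝ, x ∈ Set.univ →
      ‖-(ε * ((starRingEnd ℂ) (tangent ρ x) * imageQuotient ε q (curve ρ x) z).re)‖ ≤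
        |ε| * (2 * (1 / (1 - c * c))) := by
    filter_upwards [ae_restrict_mem (measurableSet_starDomain ρ)] with z hz x _
    have hz2 : ‖z‖ ≤ 2 := by
      have := h.starDomain_subset hz
      rw [mem_ball_zero_iff] at this
      linarith
    have h1 := h.norm_tangent_le x
    rw [norm_neg, norm_mul, Real.norm_eq_abs, Real.norm_eq_abs]
    gcongr
    refine (Complex.abs_re_le_norm _).trans ?_
    rw [norm_mul, Complex.norm_conj, imageQuotient, norm_div]
    have h2 := le_norm_imageDenom le_rfl (hle x) hz2 (ε := ε) (q := q)
    have h3 := norm_mul_add_le (le_refl (2 * |ε| + |q|)) hz2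
    have h4 : ‖(ε : ℂ) * z + q‖ ≤ 1 := h3.trans hc.le
    have h5 : 0 ≤ 1 / (1 - c * c) := by positivity
    refine mul_le_mul h1 ?_ (by positivity) (by norm_num)
    exact div_le_div₀ zero_le_one h4 hcc h2
  have hmain := (hasDerivAt_integral_of_dominated_loc_of_deriv_le (μ := volume.restrict (starDomain ρ))
    (F := fun θ z => Real.log ‖imageDenom ε q (curve ρ θ) z‖)
    (F' := fun θ z => -(ε * ((starRingEnd ℂ) (tangent ρ θ) * imageQuotient ε q (curve ρ θ) z).re))
    (x₀ := θ) (bound := fun _ => |ε| * (2 * (1 / (1 - c * c)))) Filter.univ_mem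
    (Filter.Eventually.of_forall fun x =>
      (h.integrableOn_of_continuousOn (continuousOn_log_imageDenom hc (hle x))).aestronglyMeasurable)
    (h.integrableOn_of_continuousOn (continuousOn_log_imageDenom hc (hle θ)))
    (((hQ θ).const_mul _).re.const_mul ε).neg.aestronglyMeasurable hbd
    (integrableOn_const (volume_starDomain_lt_top h).ne)
    (by
      filter_upwards [ae_restrict_mem (measurableSet_starDomain ρ)] with z hz x _
      have := h.starDomain_subset hz
      rw [mem_ball_zero_iff] at this
      exact h.hasDerivAt_log_imageDenom hc (by linarith) x)).2
  refine hmain.congr_deriv ?_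
  rw [integral_neg, integral_const_mul]
  have e0 : ∫ z in starDomain ρ, ((starRingEnd ℂ) (tangent ρ θ) *
      imageQuotient ε q (curve ρ θ) z).re = (∫ z in starDomain ρ, (starRingEnd ℂ) (tangent ρ θ) *
      imageQuotient ε q (curve ρ θ) z).re :=
    integral_re ((hQ θ).const_mul _)
  rw [e0, integral_const_mul, h.setIntegral_holomorphic hs0 (differentiableOn_imageQuotient hc (hle θ)),
    h.imageMap_apply hu]
  set Q : ℝ → ℂ := fun φ => imageQuotient ε q (curve ρ θ) (curve ρ φ) *
    ((starRingEnd ℂ) (curve ρ φ) * tangent ρ φ) with hQdef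
  have hQc : Continuous Q :=
    (h.continuous_comp_curve (differentiableOn_imageQuotient hc (hle θ)).continuousOn).mul
      ((Complex.continuous_conj.comp (continuous_curve ρ)).mul (h.continuous_tangent hs0))
  have hQp : Function.Periodic Q (2 * Real.pi) := fun φ => by
    simp only [hQdef, curve_periodic ρ φ, tangent_periodic ρ φ]
  have e2 : ∀ α : ℝ, ((starRingEnd ℂ) (tangent ρ θ) *
      imageQuotient ε q (curve ρ θ) (curve ρ (θ - α)) *
        ((starRingEnd ℂ) (curve ρ (θ - α)) * tangent ρ (θ - α))).im =
      Complex.imCLM ((starRingEnd ℂ) (tangent ρ θ) * Q (θ - α)) := fun α => by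
    rw [mul_assoc]
    rfl
  have e3 : ∫ α in (0 : ℝ)..(2 * Real.pi), Q (θ - α) = ∫ φ in (-Real.pi)..Real.pi, Q φ := by
    have h1 := hQp.intervalIntegral_add_eq (θ - 2 * Real.pi) (-Real.pi)
    rw [show θ - 2 * Real.pi + 2 * Real.pi = θ by ring,
      show -Real.pi + 2 * Real.pi = Real.pi by ring] at h1
    rw [intervalIntegral.integral_comp_sub_left, sub_zero, h1]
  simp only [e2]
  rw [Complex.imCLM.intervalIntegral_comp_comm (Continuous.intervalIntegrable (by fun_prop) _ _),
    intervalIntegral.integral_const_mul, e3, Complex.imCLM_apply]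
  generalize ∫ φ in (-Real.pi)..Real.pi, Q φ = J
  have e4 : (starRingEnd ℂ) (tangent ρ θ) * (-(Complex.I / 2) * J) =
      ((1 / 2 : ℝ) : ℂ) * (-(Complex.I * ((starRingEnd ℂ) (tangent ρ θ) * J))) := by
    push_cast
    ring
  rw [e4, Complex.re_ofReal_mul, Complex.neg_re, Complex.I_mul_re]
  ring

end image

end

/-! ### The extended contour functional. -/

section

open scoped BoundedContinuousFunction Topology
open MeasureTheory Kernel

variable {s : ℝ≥0} (hs0 : 0 < s) (hs1 : s ≤ 1)

/-- The parameters at which all the terms of the contour functional are regular. -/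
structure IsRegular (ε q : ℝ) (ρ : HolderEven s) : Prop where
  good : IsGood hs1 ρ
  contDiffAt_self : ContDiffAt ℝ 2 (selfMap hs0 hs1) ρ
  contDiffAt_translation : ContDiffAt ℝ 2 (translationMap hs1) ρ
  contDiffAt_image : ContDiffAt ℝ 2 (imageMap hs0 hs1) (ε, q, ρ)
  isUnit : IsUnit (imageDenomK hs1 (ε, q, ρ))

/-- Each condition holds near every point (0, q, 0) with |q| ≤ 1 - κ; compactness of this interval
of q gives one radius for all of them. -/
theorem exists_isRegular {κ : ℝ} (hκ : 0 < κ) : ∃ b : ℝ, 0 < b ∧ ∀ (ε q : ℝ) (ρ : HolderEven s),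
    |ε| < b → |q| ≤ 1 - κ → ‖ρ‖ < b → IsRegular hs0 hs1 ε q ρ := by
  have hev : ∀ᶠ x : ℝ × HolderEven s in 𝓝 0, ∀ q ∈ Set.Icc (-(1 - κ)) (1 - κ),
      IsRegular hs0 hs1 x.1 q x.2 := by
    refine isCompact_Icc.eventually_forall_of_forall_eventually
      (P := fun (x : ℝ × HolderEven s) q => IsRegular hs0 hs1 x.1 q x.2) fun q hq => ?_
    have hq' : 1 - q ^ 2 ≠ 0 := by nlinarith [hq.1, hq.2]
    have t1 : Filter.Tendsto (fun z : (ℝ × HolderEven s) × ℝ => z.1.2) (𝓝 (0, q)) (𝓝 0) :=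
      (continuous_snd.comp continuous_fst).tendsto' _ _ rfl
    have t2 : Filter.Tendsto (fun z : (ℝ × HolderEven s) × ℝ => (z.1.1, z.2, z.1.2)) (𝓝 (0, q))
        (𝓝 (0, q, 0)) :=
      Continuous.tendsto' (by fun_prop) _ _ rfl
    filter_upwards [t1.eventually (eventually_isGood hs1),
      t1.eventually ((contDiffAt_selfMap hs0 hs1).eventually (by simp)),
      t1.eventually ((contDiffAt_translationMap hs1).eventually (by simp)),
      t2.eventually ((contDiffAt_imageMap hs0 hs1 hq').eventually (by simp)),
      t2.eventually (eventually_isUnit_imageDenomK hs1 hq')] with z a1 a2 a3 a4 a5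
    exact ⟨a1, a2, a3, a4, a5⟩
  obtain ⟨b, hb, hball⟩ := Metric.eventually_nhds_iff_ball.1 hev
  refine ⟨b, hb, fun ε q ρ hε hq hρ => hball (ε, ρ) ?_ q (abs_le.1 hq)⟩
  rw [mem_ball_zero_iff, Prod.norm_def]
  exact max_lt hε hρ

variable {hs0 hs1}

theorem boundary_eq_curve (ε q : ℝ) (r : HolderEven s) (θ : ℝ) :
    boundary ε q r θ = curve ((2 * (ε * q)) • r : HolderEven s) θ := by
  rw [boundary, curve, radius, map_smul, Pi.smul_apply, smul_eq_mul]
  simp only [mul_assoc]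

theorem radius_eq_sqrt (ε q : ℝ) (r : HolderEven s) (θ : ℝ) :
    radius ε q r θ = Real.sqrt (1 + ((2 * (ε * q)) • r : HolderEven s) θ) := by
  rw [radius, map_smul, Pi.smul_apply, smul_eq_mul]
  simp only [mul_assoc]

theorem patch_eq_starDomain (ε q : ℝ) (r : HolderEven s) :
    patch ε q r = starDomain ((2 * (ε * q)) • r : HolderEven s) := by
  ext z
  rw [patch, starDomain, Set.mem_ofPred_eq, Set.mem_ofPred_eq, radius_eq_sqrt]

theorem translationMap_zero : translationMap hs1 (0 : HolderEven s) = -HolderOdd.sine hs1 :=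
  HolderOdd.ext fun θ => by
    rw [isGood_zero.translationMap_apply]
    simp [radiusDeriv]

theorem logKernel_eq (ε q : ℝ) (r : HolderEven s) (θ : ℝ) (z : ℂ) :
    logKernel ε q r θ z = Real.log ‖curve ((2 * (ε * q)) • r : HolderEven s) θ - z‖ := by
  rw [logKernel, boundary_eq_curve]

theorem imageKernel_eq (ε q : ℝ) (r : HolderEven s) (θ : ℝ) (z : ℂ) :
    imageKernel ε q r θ z =
      Real.log ‖imageDenom ε q (curve ((2 * (ε * q)) • r : HolderEven s) θ) z‖ := by
  rw [imageKernel, boundary_eq_curve, imageDenom]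

/-- The derivative of the contour potential in terms of the boundary operators. -/
theorem IsGood.hasDerivAt_contourPotential (hs0 : 0 < s) {ε q : ℝ} {r : HolderEven s}
    (h : IsGood hs1 ((2 * (ε * q)) • r)) (hc : 2 * |ε| + |q| < 1)
    (hu : IsUnit (imageDenomK hs1 (ε, q, (2 * (ε * q)) • r))) (Ω θ : ℝ) :
    HasDerivAt (contourPotential ε q Ω r)
      (ε ^ 2 * Ω * deriv r θ + Ω * translationMap hs1 ((2 * (ε * q)) • r) θ -
        1 / (2 * Real.pi * (ε * q)) * selfMap hs0 hs1 ((2 * (ε * q)) • r) θ +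
        1 / (2 * Real.pi * (ε * q)) * (ε * imageMap hs0 hs1 (ε, q, (2 * (ε * q)) • r) θ)) θ := by
  set ρ : HolderEven s := (2 * (ε * q)) • r with hρ
  have h1 : HasDerivAt (fun θ => Real.sqrt (1 + ρ θ)) (radiusDeriv ρ θ) θ :=
    ((ρ.hasDerivAt θ).const_add 1).sqrt (h.pos θ).ne'
  have h2 := h1.mul (Real.hasDerivAt_cos θ)
  have h3 := h.hasDerivAt_integral_log hs0 θ
  have h4 := h.hasDerivAt_integral_image hs0 hc hu θ
  have h5 := ((((r.hasDerivAt θ).const_mul (ε ^ 2 * Ω)).add (h2.const_mul Ω)).sub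
    (h3.const_mul (1 / (2 * Real.pi * (ε * q))))).add (h4.const_mul (1 / (2 * Real.pi * (ε * q))))
  have e : contourPotential ε q Ω r = fun θ => ε ^ 2 * Ω * r θ +
      Ω * (Real.sqrt (1 + ρ θ) * Real.cos θ) -
      1 / (2 * Real.pi * (ε * q)) * (∫ z in starDomain ρ, Real.log ‖curve ρ θ - z‖) +
      1 / (2 * Real.pi * (ε * q)) *
        (∫ z in starDomain ρ, Real.log ‖imageDenom ε q (curve ρ θ) z‖) := by
    funext θ
    simp only [contourPotential, radius_eq_sqrt, patch_eq_starDomain, logKernel_eq, imageKernel_eq]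
    rw [← hρ]
  rw [e]
  refine h5.congr_deriv ?_
  rw [h.translationMap_apply]
  ring

theorem hasDerivAt_smul_self {F : Type*} [NormedAddCommGroup F] [NormedSpace ℝ F] {g : ℝ → F}
    (hg : DifferentiableAt ℝ g 0) : HasDerivAt (fun t => t • g t) (g 0) 0 := by
  refine ((hasDerivAt_id (0 : ℝ)).smul hg.hasDerivAt).congr_deriv ?_
  simp

variable (hs0 hs1)

/-- The contour functional, extended to a `C¹` map across `ε q = 0`. -/
theorem exists_contourMap {κ : ℝ} (hκ : 0 < κ) : ∃ (b a : ℝ) (G : ℝ × ℝ × ℝ × HolderEven s → HolderOdd s),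
    0 < b ∧ 0 < a ∧
    (∀ ε q : ℝ, |ε| < b → |q| < 1 - κ → 2 * |ε| + |q| < 1) ∧
    (∀ (ε q : ℝ) (r : HolderEven s), |ε| < b → |q| < 1 - κ → ‖r‖ < a →
      IsGood hs1 ((2 * (ε * q)) • r)) ∧
    (∀ (ε q : ℝ) (r : HolderEven s), |ε| < b → |q| < 1 - κ → ‖r‖ < a → ε * q ≠ 0 → ∀ Ω θ : ℝ,
      HasDerivAt (contourPotential ε q Ω r) (G (ε, q, Ω, r) θ) θ) ∧
    ContDiffOn ℝ 1 G {p | |p.1| < b ∧ |p.2.1| < 1 - κ ∧ ‖p.2.2.2‖ < a} ∧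
    (∀ (q Ω : ℝ) (r : HolderEven s), |q| < 1 - κ → ‖r‖ < a →
      G (0, q, Ω, r) = (1 / (2 * (1 - q ^ 2)) - Ω) • HolderOdd.sine hs1 -
        (2⁻¹ : ℝ) • HolderOdd.rankine hs0 r.derivOdd) := by
  obtain ⟨a, ha, hreg⟩ := exists_isRegular hs0 hs1 hκ
  rcases le_or_gt 1 κ with hκ1 | hκ1
  · have hF : ∀ q : ℝ, ¬ |q| < 1 - κ := fun q hq => by linarith [abs_nonneg q]
    refine ⟨1, 1, 0, one_pos, one_pos, fun _ q _ hq => absurd hq (hF q),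
      fun _ q _ _ hq => absurd hq (hF q), fun _ q _ _ hq => absurd hq (hF q),
      fun p hp => absurd hp.2.1 (hF _), fun q _ _ hq => absurd hq (hF q)⟩
  -- The bound κ/2 yields 2|ε| + |q| < 1, and also |2εq| ≤ 1, so that ρ = 2εq r stays in the ball of
  -- r.
  set b : ℝ := min a (κ / 2) with hb
  have hb0 : 0 < b := lt_min ha (by linarith)
  have hba : b ≤ a := min_le_left _ _
  have hbκ : b ≤ κ / 2 := min_le_right _ _
  have hsmall : ∀ (ε q : ℝ) (r : HolderEven s), |ε| < b → |q| < 1 - κ → ‖r‖ < a →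
      ‖(2 * (ε * q)) • r‖ < a := by
    intro ε q r hε hq hr
    rw [norm_smul, norm_mul, norm_mul, Real.norm_eq_abs, Real.norm_eq_abs, Real.norm_eq_abs, abs_two]
    have h1 : 2 * (|ε| * |q|) ≤ 1 := by nlinarith [abs_nonneg ε, abs_nonneg q]
    nlinarith [norm_nonneg r]
  have hR : ∀ (ε q : ℝ) (r : HolderEven s), |ε| < b → |q| < 1 - κ → ‖r‖ < a →
      IsRegular hs0 hs1 ε q ((2 * (ε * q)) • r) := fun ε q r hε hq hr =>
    hreg ε q _ (hε.trans_le hba) hq.le (hsmall ε q r hε hq hr)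
  -- the division of the self-interaction by `ε q`
  obtain ⟨K, hK, hKeq⟩ := exists_eq_smul_of_eq_zero
    (f := fun p : ℝ × HolderEven s => selfMap hs0 hs1 ((2 * p.1) • p.2))
    (S := {p | ‖(2 * p.1) • p.2‖ < a}) (isOpen_lt (by fun_prop) continuous_const)
    (by
      intro q x t hq ht
      have e : (2 * (t * q)) • x = t • (2 * q) • x := by rw [smul_smul]; congr 1; ring
      simp only [Set.mem_ofPred_eq] at hq ⊢
      rw [e, norm_smul, Real.norm_of_nonneg ht.1]
      nlinarith [norm_nonneg ((2 * q) • x), ht.2])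
    (by
      intro p hp
      -- The self-interaction does not involve (ε, q), so regularity at (0, 0) is enough. Here the
      -- divisor εq is an independent variable, constrained only through the size of ρ.
      have h1 := (hreg 0 0 ((2 * p.1) • p.2) (by simpa using ha) (by simp; linarith) hp).contDiffAt_self
      refine ContDiffAt.contDiffWithinAt (ContDiffAt.comp (g := selfMap hs0 hs1)
        (f := fun p : ℝ × HolderEven s => (2 * p.1) • p.2) p h1 ?_)
      fun_prop)
    (by
      intro x _
      simp only [mul_zero, zero_smul]
      exact selfMap_zero)
  -- the division of the image interaction by `q`
  have hSL : IsOpen {p : ℝ × (ℝ × HolderEven s) | |p.1| < 1 - κ ∧ |p.2.1| < b ∧ ‖p.2.2‖ < a} := by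
    have o1 : IsOpen {p : ℝ × (ℝ × HolderEven s) | |p.1| < 1 - κ} :=
      isOpen_lt (by fun_prop) continuous_const
    have o2 : IsOpen {p : ℝ × (ℝ × HolderEven s) | |p.2.1| < b} :=
      isOpen_lt (by fun_prop) continuous_const
    have o3 : IsOpen {p : ℝ × (ℝ × HolderEven s) | ‖p.2.2‖ < a} :=
      isOpen_lt (by fun_prop) continuous_const
    exact o1.inter (o2.inter o3)
  obtain ⟨L, hL, hLeq⟩ := exists_eq_smul_of_eq_zero
    (f := fun p : ℝ × (ℝ × HolderEven s) =>
      imageMap hs0 hs1 (p.2.1, p.1, (2 * (p.2.1 * p.1)) • p.2.2))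
    (S := {p | |p.1| < 1 - κ ∧ |p.2.1| < b ∧ ‖p.2.2‖ < a})
    hSL
    (by
      rintro q ⟨ε, r⟩ t ⟨hq, hε, hr⟩ ht
      refine ⟨?_, hε, hr⟩
      simp only at hq ⊢
      rw [abs_mul, abs_of_nonneg ht.1]
      nlinarith [abs_nonneg q, ht.2])
    (by
      rintro ⟨q, ε, r⟩ ⟨hq, hε, hr⟩
      have h1 := (hR ε q r hε hq hr).contDiffAt_image
      refine ContDiffAt.contDiffWithinAt (ContDiffAt.comp (g := imageMap hs0 hs1)
        (f := fun p : ℝ × (ℝ × HolderEven s) => (p.2.1, p.1, (2 * (p.2.1 * p.1)) • p.2.2))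
        (q, ε, r) h1 ?_)
      fun_prop)
    (by
      rintro ⟨ε, r⟩ ⟨hq, hε, hr⟩
      have h1 := (hR ε 0 r hε hq hr).isUnit
      simp only [mul_zero, zero_smul] at h1 ⊢
      exact imageMap_zero_of_snd h1)
  set G : ℝ × ℝ × ℝ × HolderEven s → HolderOdd s := fun p =>
    (p.1 ^ 2 * p.2.2.1) • p.2.2.2.derivOdd +
      p.2.2.1 • translationMap hs1 ((2 * (p.1 * p.2.1)) • p.2.2.2) -
      (1 / (2 * Real.pi)) • K (p.1 * p.2.1, p.2.2.2) +
      (1 / (2 * Real.pi)) • L (p.2.1, p.1, p.2.2.2) with hG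
  refine ⟨b, a, G, hb0, ha, ?_, fun ε q r hε hq hr => (hR ε q r hε hq hr).good, ?_, ?_, ?_⟩
  · intro ε q hε hq
    linarith
  · intro ε q r hε hq hr hne Ω θ
    have hr' := hR ε q r hε hq hr
    refine (hr'.good.hasDerivAt_contourPotential hs0 (by linarith) hr'.isUnit Ω θ).congr_deriv ?_
    have e1 := hKeq (ε * q) r (hsmall ε q r hε hq hr)
    have e2 := hLeq q (ε, r) ⟨hq, hε, hr⟩
    simp only at e1 e2
    have hε0 := left_ne_zero_of_mul hne
    have hq0 := right_ne_zero_of_mul hne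
    have hpi := Real.pi_ne_zero
    rw [e1, e2]
    simp only [hG, map_add, map_sub, map_smul, Pi.add_apply, Pi.sub_apply, Pi.smul_apply,
      smul_eq_mul, HolderEven.derivOdd_apply]
    field_simp
  · rintro ⟨ε, q, Ω, r⟩ ⟨hε, hq, hr⟩
    simp only at hε hq hr
    refine ContDiffAt.contDiffWithinAt ?_
    have c1 : ContDiffAt ℝ 1 (fun p : ℝ × ℝ × ℝ × HolderEven s => translationMap hs1
        ((2 * (p.1 * p.2.1)) • p.2.2.2)) (ε, q, Ω, r) := by
      refine ContDiffAt.comp (g := translationMap hs1)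
        (f := fun p : ℝ × ℝ × ℝ × HolderEven s => (2 * (p.1 * p.2.1)) • p.2.2.2)
        (ε, q, Ω, r) ((hR ε q r hε hq hr).contDiffAt_translation.of_le (by norm_num)) ?_
      fun_prop
    have c2 : ContDiffAt ℝ 1 (fun p : ℝ × ℝ × ℝ × HolderEven s => K (p.1 * p.2.1, p.2.2.2))
        (ε, q, Ω, r) := by
      refine ContDiffAt.comp (g := K)
        (f := fun p : ℝ × ℝ × ℝ × HolderEven s => (p.1 * p.2.1, p.2.2.2))
        (ε, q, Ω, r) (hK.contDiffAt ?_) (by fun_prop)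
      exact (isOpen_lt (by fun_prop) continuous_const).mem_nhds (hsmall ε q r hε hq hr)
    have c3 : ContDiffAt ℝ 1 (fun p : ℝ × ℝ × ℝ × HolderEven s => L (p.2.1, p.1, p.2.2.2))
        (ε, q, Ω, r) := by
      refine ContDiffAt.comp (g := L)
        (f := fun p : ℝ × ℝ × ℝ × HolderEven s => (p.2.1, p.1, p.2.2.2))
        (ε, q, Ω, r) (hL.contDiffAt (hSL.mem_nhds ⟨hq, hε, hr⟩)) (by fun_prop)
    have c4 : ContDiffAt ℝ 1 (fun p : ℝ × ℝ × ℝ × HolderEven s => p.2.2.2.derivOdd)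
        (ε, q, Ω, r) :=
      HolderEven.derivOdd.contDiff.contDiffAt.comp _ (by fun_prop)
    have c5 : ContDiffAt ℝ 1 (fun p : ℝ × ℝ × ℝ × HolderEven s => p.1 ^ 2 * p.2.2.1)
        (ε, q, Ω, r) := by fun_prop
    have c6 : ContDiffAt ℝ 1 (fun p : ℝ × ℝ × ℝ × HolderEven s => p.2.2.1)
        (ε, q, Ω, r) := by fun_prop
    exact (((c5.smul c4).add (c6.smul c1)).sub (c2.const_smul _)).add (c3.const_smul _)
  · intro q Ω r hq hr
    have hpi := Real.pi_ne_zero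
    -- K(0, r) is the derivative at η = 0 of η ↦ `selfMap` at 2ηr. The factor 2 and the derivative
    -- (π/2) Λ r' at the disc combine to π Λ r'.
    have hK0 : K (0, r) = Real.pi • HolderOdd.rankine hs0 r.derivOdd := by
      refine HolderOdd.ext fun θ => ?_
      have hmem : (0, r) ∈ {p : ℝ × HolderEven s | ‖(2 * p.1) • p.2‖ < a} := by simpa using ha
      have hopen : IsOpen {p : ℝ × HolderEven s | ‖(2 * p.1) • p.2‖ < a} :=
        isOpen_lt (by fun_prop) continuous_const
      have hKd : DifferentiableAt ℝ (fun η : ℝ => K (η, r)) 0 :=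
        DifferentiableAt.comp (g := K) (f := fun η : ℝ => (η, r)) 0
          ((hK.contDiffAt (hopen.mem_nhds hmem)).differentiableAt (by norm_num)) (by fun_prop)
      have h1 := (HolderOdd.eval θ).hasFDerivAt.comp_hasDerivAt (0 : ℝ) (hasDerivAt_smul_self hKd)
      have h2 : HasDerivAt (fun η : ℝ => selfMap hs0 hs1 ((2 * η) • r) θ)
          (Real.pi / 2 * HolderOdd.rankine hs0 r.derivOdd θ * 2) 0 := by
        have h3 := hasDerivAt_selfMap_smul_rankine hs0 hs1 r θ
        rw [← mul_zero (2 : ℝ)] at h3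
        exact h3.comp (0 : ℝ) (by simpa using (hasDerivAt_id (0 : ℝ)).const_mul 2)
      have h4 : (fun η : ℝ => selfMap hs0 hs1 ((2 * η) • r) θ) =ᶠ[𝓝 0]
          (HolderOdd.eval θ ∘ fun η => η • K (η, r)) := by
        have h5 : ∀ᶠ η : ℝ in 𝓝 0, (η, r) ∈ {p : ℝ × HolderEven s | ‖(2 * p.1) • p.2‖ < a} :=
          (by fun_prop : Continuous fun η : ℝ => (η, r)).continuousAt.eventually
            (hopen.mem_nhds hmem)
        filter_upwards [h5] with η hη
        rw [Function.comp_apply, ← hKeq η r hη]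
        rfl
      have h5 := h1.unique (h2.congr_of_eventuallyEq h4.symm)
      change K (0, r) θ = _ at h5
      rw [h5, map_smul, Pi.smul_apply, smul_eq_mul]
      ring
    -- The identity after multiplication by q is explicit. For q ≠ 0 it can be divided by q; at q =
    -- 0 the derivatives of the two products at 0 are compared instead.
    have hL0 : L (q, 0, r) = (Real.pi / (1 - q ^ 2)) • HolderOdd.sine hs1 := by
      have himg : ∀ t : ℝ, |t| < 1 - κ →
          t • L (t, 0, r) = t • (Real.pi / (1 - t ^ 2)) • HolderOdd.sine hs1 := by
        intro t ht
        have h1 := hLeq t (0, r) ⟨ht, by simpa using hb0, hr⟩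
        have ht' : 1 - t ^ 2 ≠ 0 := by
          have := abs_lt.1 ht
          nlinarith
        rw [← h1]
        refine HolderOdd.ext fun θ => ?_
        simp only [zero_mul, mul_zero, zero_smul]
        rw [imageMap_zero_of_fst ht' θ]
        simp
        ring
      rcases eq_or_ne q 0 with rfl | hq0
      · have hLd : DifferentiableAt ℝ (fun t : ℝ => L (t, 0, r)) 0 :=
          DifferentiableAt.comp (g := L) (f := fun t : ℝ => (t, (0 : ℝ), r)) 0
            ((hL.contDiffAt (hSL.mem_nhds ⟨hq, by simpa using hb0, hr⟩)).differentiableAt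
              (by norm_num)) (by fun_prop)
        have h1 := hasDerivAt_smul_self hLd
        have h2 : DifferentiableAt ℝ (fun t : ℝ => (Real.pi / (1 - t ^ 2)) • HolderOdd.sine hs1) 0 := by
          refine DifferentiableAt.smul_const (DifferentiableAt.div (by fun_prop) (by fun_prop) ?_) _
          norm_num
        have h3 := hasDerivAt_smul_self h2
        have h4 : (fun t : ℝ => t • L (t, 0, r)) =ᶠ[𝓝 0]
            fun t => t • (Real.pi / (1 - t ^ 2)) • HolderOdd.sine hs1 := by
          filter_upwards [(isOpen_lt continuous_abs continuous_const).mem_nhds hq] with t ht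
          exact himg t ht
        exact h1.unique (h3.congr_of_eventuallyEq h4)
      · have h1 := himg q hq
        exact smul_right_injective _ hq0 h1
    have hq' : 1 - q ^ 2 ≠ 0 := by
      have := abs_lt.1 hq
      nlinarith
    simp only [hG, zero_mul, mul_zero, zero_smul, translationMap_zero, hK0, hL0, smul_smul]
    rw [show (0 : ℝ) ^ 2 * Ω = 0 by ring, zero_smul]
    have e1 : 1 / (2 * Real.pi) * Real.pi = 2⁻¹ := by field_simp
    have e2 : 1 / (2 * Real.pi) * (Real.pi / (1 - q ^ 2)) = 1 / (2 * (1 - q ^ 2)) := by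
      field_simp
    rw [e1, e2]
    module

end

/-! ### An implicit function theorem uniform over a compact interval. -/

section

open scoped BoundedContinuousFunction Topology
open MeasureTheory Kernel

/-- The implicit function theorem, uniformly along a compact interval of trivial solutions. -/
theorem exists_branch {E F : Type*} [NormedAddCommGroup E] [NormedSpace ℝ E] [CompleteSpace E]
    [NormedAddCommGroup F] [NormedSpace ℝ F] [CompleteSpace F] {H : (ℝ × ℝ) × E → F} {c d : ℝ}
    (hH : ∀ q ∈ Set.Icc c d, ContDiffAt ℝ 1 H ((0, q), 0))
    (h0 : ∀ q ∈ Set.Icc c d, H ((0, q), 0) = 0)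
    (hinv : ∀ q ∈ Set.Icc c d,
      (fderiv ℝ H ((0, q), 0) ∘L ContinuousLinearMap.inr ℝ (ℝ × ℝ) E).IsInvertible)
    {η : ℝ} (hη : 0 < η) :
    ∃ ε₀ : ℝ, 0 < ε₀ ∧ ∃ y : ℝ × ℝ → E,
      ContDiffOn ℝ 1 y (Set.Ioo (-ε₀) ε₀ ×ˢ Set.Ioo c d) ∧ (∀ q ∈ Set.Ioo c d, y (0, q) = 0) ∧
      ∀ ε ∈ Set.Ioo (-ε₀) ε₀, ∀ q ∈ Set.Ioo c d,
        ‖y (ε, q)‖ < η ∧ H ((ε, q), y (ε, q)) = 0 := by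
  -- Any two small zeros over the same (ε, q) both equal the value of one local implicit function;
  -- compactness makes the neighbourhood uniform in q.
  have huniq : ∀ᶠ x : ℝ × E × E in 𝓝 0, ∀ q ∈ Set.Icc c d,
      H ((x.1, q), x.2.1) = 0 → H ((x.1, q), x.2.2) = 0 → x.2.1 = x.2.2 := by
    refine isCompact_Icc.eventually_forall_of_forall_eventually
      (P := fun (x : ℝ × E × E) q =>
        H ((x.1, q), x.2.1) = 0 → H ((x.1, q), x.2.2) = 0 → x.2.1 = x.2.2) fun q hq => ?_
    have h1 := (hH q hq).eventually_apply_eq_iff_implicitFunction (by norm_num) (hinv q hq)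
    have t1 : Filter.Tendsto (fun z : (ℝ × E × E) × ℝ => ((z.1.1, z.2), z.1.2.1)) (𝓝 (0, q))
        (𝓝 ((0, q), 0)) := Continuous.tendsto' (by fun_prop) _ _ rfl
    have t2 : Filter.Tendsto (fun z : (ℝ × E × E) × ℝ => ((z.1.1, z.2), z.1.2.2)) (𝓝 (0, q))
        (𝓝 ((0, q), 0)) := Continuous.tendsto' (by fun_prop) _ _ rfl
    filter_upwards [t1.eventually h1, t2.eventually h1] with z a1 a2 b1 b2
    rw [h0 q hq] at a1 a2
    exact (a1.1 b1).symm.trans (a2.1 b2)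
  obtain ⟨η₁, hη₁, hU⟩ := Metric.eventually_nhds_iff_ball.1 huniq
  set μ := min η η₁ with hμ
  have hμ0 : 0 < μ := lt_min hη hη₁
  have hU' : ∀ ε q : ℝ, |ε| < η₁ → q ∈ Set.Icc c d → ∀ y y' : E, ‖y‖ < μ → ‖y'‖ < μ →
      H ((ε, q), y) = 0 → H ((ε, q), y') = 0 → y = y' := by
    intro ε q hε hq y y' hy hy'
    refine hU (ε, y, y') ?_ q hq
    rw [mem_ball_zero_iff, Prod.norm_def, Prod.norm_def]
    exact max_lt hε (max_lt (hy.trans_le (min_le_right _ _)) (hy'.trans_le (min_le_right _ _)))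
  have hex : ∀ᶠ ε : ℝ in 𝓝 0, ∀ q ∈ Set.Icc c d, ∃ ψ : ℝ × ℝ → E, ContDiffAt ℝ 1 ψ (ε, q) ∧
      ∀ᶠ p in 𝓝 (ε, q), ‖ψ p‖ < μ ∧ H (p, ψ p) = 0 := by
    refine isCompact_Icc.eventually_forall_of_forall_eventually
      (P := fun (ε : ℝ) q => ∃ ψ : ℝ × ℝ → E, ContDiffAt ℝ 1 ψ (ε, q) ∧
        ∀ᶠ p in 𝓝 (ε, q), ‖ψ p‖ < μ ∧ H (p, ψ p) = 0) fun q hq => ?_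
    have c1 := (hH q hq).contDiffAt_implicitFunction (by norm_num) (hinv q hq)
    have c2 := (hH q hq).eventually_apply_implicitFunction (by norm_num) (hinv q hq)
    have c3 := (hH q hq).implicitFunction_apply_self (by norm_num) (hinv q hq)
    set ψ := (hH q hq).implicitFunction (by norm_num) (hinv q hq)
    simp only at c1 c2 c3
    have c4 : ∀ᶠ p in 𝓝 ((0 : ℝ), q), ‖ψ p‖ < μ := by
      refine c1.continuousAt.norm.eventually_lt continuousAt_const ?_
      rw [c3, norm_zero]
      exact hμ0
    filter_upwards [c1.eventually (by simp), (c2.and c4).eventually_nhds] with z a1 a2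
    refine ⟨ψ, a1, a2.mono fun p hp => ⟨hp.2, ?_⟩⟩
    rw [hp.1, h0 q hq]
  obtain ⟨η₂, hη₂, hE⟩ := Metric.eventually_nhds_iff_ball.1 hex
  set ε₀ := min η₁ η₂ with hε₀
  have hε : ∀ ε ∈ Set.Ioo (-ε₀) ε₀, |ε| < η₁ ∧ ε ∈ Metric.ball (0 : ℝ) η₂ := fun ε h => by
    have h1 := abs_lt.2 h
    rw [mem_ball_zero_iff, Real.norm_eq_abs]
    exact ⟨h1.trans_le (min_le_left _ _), h1.trans_le (min_le_right _ _)⟩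
  -- Any small zero may be chosen at each point. Uniqueness makes the choice agree near each point
  -- with a local C¹ branch, so the chosen function is C¹.
  have hsol : ∀ p : ℝ × ℝ, ∃ y : E, p ∈ Set.Ioo (-ε₀) ε₀ ×ˢ Set.Ioo c d →
      ‖y‖ < μ ∧ H (p, y) = 0 := by
    intro p
    by_cases hp : p ∈ Set.Ioo (-ε₀) ε₀ ×ˢ Set.Ioo c d
    · obtain ⟨ψ, -, h2⟩ := hE p.1 (hε p.1 hp.1).2 p.2 (Set.Ioo_subset_Icc_self hp.2)
      exact ⟨ψ p, fun _ => h2.self_of_nhds⟩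
    · exact ⟨0, fun h => absurd h hp⟩
  choose y hy using hsol
  refine ⟨ε₀, lt_min hη₁ hη₂, y, ?_, ?_, ?_⟩
  · intro p hp
    obtain ⟨ψ, h1, h2⟩ := hE p.1 (hε p.1 hp.1).2 p.2 (Set.Ioo_subset_Icc_self hp.2)
    refine ContDiffAt.contDiffWithinAt (h1.congr_of_eventuallyEq ?_)
    filter_upwards [h2, (isOpen_Ioo.prod isOpen_Ioo).mem_nhds hp] with p' h3 hp'
    exact hU' p'.1 p'.2 (hε p'.1 hp'.1).1 (Set.Ioo_subset_Icc_self hp'.2) _ _ (hy p' hp').1 h3.1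
      (hy p' hp').2 h3.2
  · intro q hq
    have hε00 : 0 < ε₀ := lt_min hη₁ hη₂
    have h1 := hy (0, q) ⟨⟨by linarith, hε00⟩, hq⟩
    exact hU' 0 q (by simpa using hη₁) (Set.Ioo_subset_Icc_self hq) _ _ h1.1 (by simpa using hμ0)
      h1.2 (h0 q (Set.Ioo_subset_Icc_self hq))
  · intro ε hε' q hq
    have h1 := hy (ε, q) ⟨hε', hq⟩
    exact ⟨h1.1.trans_le (min_le_left _ _), h1.2⟩

end

/-! ### Completeness of the domain of the linearization. -/

section

open scoped BoundedContinuousFunction Topology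
open MeasureTheory Kernel

/-- The implicit function theorem needs a complete space of unknowns; completeness is transported
from the target through the isomorphism. -/
theorem completeSpace_prod_noFirstMode {s : ℝ≥0} (hs0 : 0 < s) (hs1 : s ≤ 1) :
    CompleteSpace (ℝ × noFirstMode s) :=
  (completeSpace_congr (e := (linearizationEquiv hs0 hs1).toEquiv)
    (linearizationEquiv hs0 hs1).isUniformEmbedding).2 inferInstance

end

end RotatingPatch

end

/-! ### The theorem. -/

open RotatingPatch
open scoped Topology

theorem theorem4p1 (s : ℝ≥0) (hs0 : 0 < s) (hs1 : s < 1) (δ : ℝ) (hδ : δ ∈ Set.Ioo (0 : ℝ) 1) :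
    ∃ ε₀ a₀ : ℝ, 0 < ε₀ ∧ 0 < a₀ ∧
      -- for all parameters in the domain the patch is well defined and lies inside the unit disc
      (∀ ε ∈ Set.Ioo (-ε₀) ε₀, ∀ q ∈ Set.Ioo (-1 + δ) (1 - δ),
        ∀ r ∈ Metric.ball (0 : RotatingPatch.HolderEven s) a₀, ∀ θ : ℝ,
          0 < 1 + 2 * ε * q * r θ ∧
          ∀ ρ ∈ Set.Icc (0 : ℝ) (RotatingPatch.radius ε q r θ),
            ‖(ε : ℂ) * ((ρ : ℂ) * Complex.exp (θ * Complex.I)) + q‖ < 1) ∧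
      ∃ G : ℝ × ℝ × ℝ × RotatingPatch.HolderEven s → RotatingPatch.HolderOdd s,
        -- (i) `G` is given by the contour formula where `ε q ≠ 0`, and is of class `C¹` everywhere
        (∀ ε ∈ Set.Ioo (-ε₀) ε₀, ∀ q ∈ Set.Ioo (-1 + δ) (1 - δ), ε * q ≠ 0 →
          ∀ Ω : ℝ, ∀ r ∈ Metric.ball (0 : RotatingPatch.HolderEven s) a₀, ∀ θ : ℝ,
            MeasureTheory.IntegrableOn (RotatingPatch.logKernel ε q r θ)
              (RotatingPatch.patch ε q r) ∧
            MeasureTheory.IntegrableOn (RotatingPatch.imageKernel ε q r θ)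
              (RotatingPatch.patch ε q r) ∧
            HasDerivAt (RotatingPatch.contourPotential ε q Ω r) (G (ε, q, Ω, r) θ) θ) ∧
        ContDiffOn ℝ 1 G (Set.Ioo (-ε₀) ε₀ ×ˢ Set.Ioo (-1 + δ) (1 - δ) ×ˢ
          (Set.univ : Set ℝ) ×ˢ Metric.ball (0 : RotatingPatch.HolderEven s) a₀) ∧
        -- (ii) the trivial solutions at `ε = 0`
        (∀ q ∈ Set.Ioo (-1 + δ) (1 - δ), ∀ Ω : ℝ,
          G (0, q, Ω, 0) = 0 ↔ Ω = 1 / (2 * (1 - q ^ 2))) ∧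
        -- (iii) the linearization in `(Ω, r)`
        (∀ q ∈ Set.Ioo (-1 + δ) (1 - δ),
          ∃ L : ℝ × RotatingPatch.HolderEven s →L[ℝ] RotatingPatch.HolderOdd s,
            HasFDerivAt
              (fun p : ℝ × RotatingPatch.HolderEven s => G (0, q, p.1, p.2)) L
              (1 / (2 * (1 - q ^ 2)), 0) ∧
            (∀ (ω : ℝ) (h : RotatingPatch.HolderEven s),
              L (ω, h) = 0 ↔ ω = 0 ∧ ∃ c : ℝ, ∀ θ : ℝ, h θ = c * Real.cos θ) ∧
            ∃ e : (ℝ × RotatingPatch.noFirstMode s) ≃L[ℝ] RotatingPatch.HolderOdd s,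
              ∀ (ω : ℝ) (h : RotatingPatch.noFirstMode s),
                e (ω, h) = L (ω, (h : RotatingPatch.HolderEven s))) ∧
        -- (iv) the branch of solutions
        ∃ (Ω : ℝ × ℝ → ℝ) (r : ℝ × ℝ → RotatingPatch.noFirstMode s),
          ContDiffOn ℝ 1 Ω (Set.Ioo (-ε₀) ε₀ ×ˢ Set.Ioo (-1 + δ) (1 - δ)) ∧
          ContDiffOn ℝ 1 r (Set.Ioo (-ε₀) ε₀ ×ˢ Set.Ioo (-1 + δ) (1 - δ)) ∧
          (∀ q ∈ Set.Ioo (-1 + δ) (1 - δ), Ω (0, q) = 1 / (2 * (1 - q ^ 2)) ∧ r (0, q) = 0) ∧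
          ∀ ε ∈ Set.Ioo (-ε₀) ε₀, ∀ q ∈ Set.Ioo (-1 + δ) (1 - δ),
            r (ε, q) ∈ Metric.ball (0 : RotatingPatch.noFirstMode s) a₀ ∧
            G (ε, q, Ω (ε, q), (r (ε, q) : RotatingPatch.HolderEven s)) = 0 := by
  have hs1' := hs1.le
  obtain ⟨hδ0, hδ1⟩ := hδ
  -- Half of δ is kept as a margin, so that the closed interval [-1 + δ, 1 - δ] lies in the open
  -- region where the functional is defined and C¹.
  have hκ : 0 < δ / 2 := by linarith
  obtain ⟨b, a, G, hb, ha, hc, hgood, hder, hG, hG0⟩ := exists_contourMap hs0 hs1' hκ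
  have hJ : ∀ q ∈ Set.Icc (-1 + δ) (1 - δ), |q| < 1 - δ / 2 := fun q hq =>
    abs_lt.2 ⟨by linarith [hq.1], by linarith [hq.2]⟩
  have hJ' : ∀ q ∈ Set.Ioo (-1 + δ) (1 - δ), |q| < 1 - δ / 2 := fun q hq =>
    hJ q (Set.Ioo_subset_Icc_self hq)
  have hq2 : ∀ q : ℝ, |q| < 1 - δ / 2 → 1 - q ^ 2 ≠ 0 := fun q hq => by
    have := abs_lt.1 hq
    nlinarith
  have hDopen : IsOpen {p : ℝ × ℝ × ℝ × HolderEven s |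
      |p.1| < b ∧ |p.2.1| < 1 - δ / 2 ∧ ‖p.2.2.2‖ < a} := by
    have o1 : IsOpen {p : ℝ × ℝ × ℝ × HolderEven s | |p.1| < b} :=
      isOpen_lt (by fun_prop) continuous_const
    have o2 : IsOpen {p : ℝ × ℝ × ℝ × HolderEven s | |p.2.1| < 1 - δ / 2} :=
      isOpen_lt (by fun_prop) continuous_const
    have o3 : IsOpen {p : ℝ × ℝ × ℝ × HolderEven s | ‖p.2.2.2‖ < a} :=
      isOpen_lt (by fun_prop) continuous_const
    exact o1.inter (o2.inter o3)
  have := completeSpace_prod_noFirstMode hs0 hs1'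
  -- the functional near the trivial solutions
  set T : (ℝ × ℝ) × (ℝ × noFirstMode s) → ℝ × ℝ × ℝ × HolderEven s := fun z =>
    (z.1.1, z.1.2, 1 / (2 * (1 - z.1.2 ^ 2)) + z.2.1, (noFirstMode s).subtypeL z.2.2) with hT
  have hTd : ∀ q, |q| < 1 - δ / 2 → ContDiffAt ℝ 1 T ((0, q), 0) := fun q hq => by
    have h1 : ContDiffAt ℝ 1 (fun z : (ℝ × ℝ) × (ℝ × noFirstMode s) =>
        1 / (2 * (1 - z.1.2 ^ 2))) ((0, q), 0) := by
      refine ContDiffAt.div contDiffAt_const (by fun_prop) ?_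
      have := hq2 q hq
      simpa using this
    have h2 : ContDiffAt ℝ 1 (fun z : (ℝ × ℝ) × (ℝ × noFirstMode s) =>
        (noFirstMode s).subtypeL z.2.2) ((0, q), 0) :=
      (noFirstMode s).subtypeL.contDiff.contDiffAt.comp _ (by fun_prop)
    exact ContDiffAt.prodMk (by fun_prop) (ContDiffAt.prodMk (by fun_prop)
      (ContDiffAt.prodMk (h1.add (by fun_prop)) h2))
  have hGT : ∀ q, |q| < 1 - δ / 2 → ContDiffAt ℝ 1 (fun z => G (T z)) ((0, q), 0) := fun q hq =>
    ContDiffAt.comp (g := G) _ (hG.contDiffAt (hDopen.mem_nhds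
      ⟨by simpa [hT] using hb, by simpa [hT] using hq, by simpa [hT] using ha⟩)) (hTd q hq)
  have hlin : ∀ (q Ω : ℝ) (r : HolderEven s), |q| < 1 - δ / 2 → ‖r‖ < a →
      G (0, q, Ω, r) = linearization hs0 hs1' (Ω - 1 / (2 * (1 - q ^ 2)), r) := by
    intro q Ω r hq hr
    rw [hG0 q Ω r hq hr, linearization_apply]
    module
  -- The frequency is measured from Ω₀(q), so at ε = 0 the functional is exactly linear in the
  -- unknown near 0. The trivial solutions, the partial derivative and its invertibility follow at
  -- once.
  have hGlin : ∀ q, |q| < 1 - δ / 2 → ∀ y : ℝ × noFirstMode s, ‖y.2‖ < a →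
      G (T ((0, q), y)) = linearizationEquiv hs0 hs1' y := by
    intro q hq y hy
    have h1 : G (T ((0, q), y)) = G (0, q, 1 / (2 * (1 - q ^ 2)) + y.1, (y.2 : HolderEven s)) := rfl
    rw [h1, hlin q _ (y.2 : HolderEven s) hq hy, add_sub_cancel_left]
    rfl
  have hinv : ∀ q, |q| < 1 - δ / 2 → (fderiv ℝ (fun z => G (T z)) ((0, q), 0) ∘L
      ContinuousLinearMap.inr ℝ (ℝ × ℝ) (ℝ × noFirstMode s)).IsInvertible := by
    intro q hq
    refine ⟨linearizationEquiv hs0 hs1', ?_⟩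
    have h1 := ((hGT q hq).differentiableAt (by norm_num)).hasFDerivAt
    have h2 : HasFDerivAt (fun y : ℝ × noFirstMode s => (((0 : ℝ), q), y))
        (ContinuousLinearMap.inr ℝ (ℝ × ℝ) (ℝ × noFirstMode s)) 0 := hasFDerivAt_prodMk_right _ _
    have h3 := HasFDerivAt.comp (0 : ℝ × noFirstMode s) h1 h2
    have h4 : (fun y : ℝ × noFirstMode s => linearizationEquiv hs0 hs1' y) =ᶠ[𝓝 0]
        (fun z => G (T z)) ∘ fun y => (((0 : ℝ), q), y) := by
      have h5 : ∀ᶠ y : ℝ × noFirstMode s in 𝓝 0, ‖y.2‖ < a :=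
        (isOpen_lt (by fun_prop) continuous_const).mem_nhds (by simpa using ha)
      filter_upwards [h5] with y hy
      exact (hGlin q hq y hy).symm
    exact (linearizationEquiv hs0 hs1').hasFDerivAt.unique (h3.congr_of_eventuallyEq h4)
  obtain ⟨ε₁, hε₁, y, hyC, hy0, hy⟩ := exists_branch (H := fun z => G (T z)) (c := -1 + δ)
    (d := 1 - δ) (fun q hq => hGT q (hJ q hq))
    (fun q hq => by rw [hGlin q (hJ q hq) 0 (by simpa using ha), map_zero])
    (fun q hq => hinv q (hJ q hq)) ha
  have hε₀ : ∀ ε ∈ Set.Ioo (-min b ε₁) (min b ε₁), |ε| < b ∧ ε ∈ Set.Ioo (-ε₁) ε₁ := fun ε h => by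
    have h1 := abs_lt.2 h
    exact ⟨h1.trans_le (min_le_left _ _), abs_lt.1 (h1.trans_le (min_le_right _ _))⟩
  refine ⟨min b ε₁, a, lt_min hb hε₁, ha, ?_, G, ?_, ?_, ?_, ?_, ?_⟩
  · intro ε hε q hq r hr θ
    rw [mem_ball_zero_iff] at hr
    have hg := hgood ε q r (hε₀ ε hε).1 (hJ' q hq) hr
    refine ⟨?_, fun ρ hρ => ?_⟩
    · have := hg.pos θ
      rw [map_smul, Pi.smul_apply, smul_eq_mul] at this
      linarith
    · have h1 := hg.sqrt_le θ
      rw [← radius_eq_sqrt] at h1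
      refine (norm_mul_add_le le_rfl ?_).trans_lt (hc ε q (hε₀ ε hε).1 (hJ' q hq))
      rw [norm_mul, Complex.norm_exp_ofReal_mul_I, mul_one, Complex.norm_real,
        Real.norm_of_nonneg hρ.1]
      linarith [hρ.2]
  · intro ε hε q hq hne Ω r hr θ
    rw [mem_ball_zero_iff] at hr
    have hg := hgood ε q r (hε₀ ε hε).1 (hJ' q hq) hr
    have hc' := hc ε q (hε₀ ε hε).1 (hJ' q hq)
    refine ⟨?_, ?_, hder ε q r (hε₀ ε hε).1 (hJ' q hq) hr hne Ω θ⟩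
    · rw [patch_eq_starDomain, funext (logKernel_eq ε q r θ)]
      exact integrableOn_log_norm_sub _ hg.starDomain_subset
    · rw [patch_eq_starDomain, funext (imageKernel_eq ε q r θ)]
      exact hg.integrableOn_of_continuousOn
        (continuousOn_log_imageDenom hc' ((hg.norm_curve_le θ).trans (by norm_num)))
  · refine hG.mono ?_
    rintro ⟨ε, q, Ω, r⟩ ⟨hε, hq, -, hr⟩
    exact ⟨(hε₀ ε hε).1, hJ' q hq, mem_ball_zero_iff.1 hr⟩
  · intro q hq Ω
    rw [hlin q Ω 0 (hJ' q hq) (by simpa using ha), linearization_eq_zero_iff, sub_eq_zero]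
    exact ⟨fun h => h.1, fun h => ⟨h, 0, fun θ => by simp⟩⟩
  · intro q hq
    refine ⟨linearization hs0 hs1', ?_, linearization_eq_zero_iff hs0 hs1',
      linearizationEquiv hs0 hs1', linearizationEquiv_apply hs0 hs1'⟩
    have h1 : HasFDerivAt (fun p : ℝ × HolderEven s =>
        linearization hs0 hs1' (p.1 - 1 / (2 * (1 - q ^ 2)), p.2)) (linearization hs0 hs1')
        (1 / (2 * (1 - q ^ 2)), 0) := by
      have h2 := (linearization hs0 hs1').hasFDerivAt.comp ((1 / (2 * (1 - q ^ 2)), 0) : ℝ × HolderEven s)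
        ((hasFDerivAt_id _).sub_const ((1 / (2 * (1 - q ^ 2)), 0) : ℝ × HolderEven s))
      refine (h2.congr_of_eventuallyEq (Filter.Eventually.of_forall fun p => ?_)).congr_fderiv ?_
      · simp [Prod.sub_def]
      · exact ContinuousLinearMap.comp_id _
    refine h1.congr_of_eventuallyEq ?_
    have h5 : ∀ᶠ p : ℝ × HolderEven s in 𝓝 (1 / (2 * (1 - q ^ 2)), 0), ‖p.2‖ < a :=
      (isOpen_lt (by fun_prop) continuous_const).mem_nhds (by simpa using ha)
    filter_upwards [h5] with p hp
    exact hlin q p.1 p.2 (hJ' q hq) hp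
  · have hyC' : ContDiffOn ℝ 1 y
        (Set.Ioo (-min b ε₁) (min b ε₁) ×ˢ Set.Ioo (-1 + δ) (1 - δ)) :=
      hyC.mono (Set.prod_mono (fun ε hε => (hε₀ ε hε).2) subset_rfl)
    refine ⟨fun p => 1 / (2 * (1 - p.2 ^ 2)) + (y p).1, fun p => (y p).2, ?_, hyC'.snd, ?_, ?_⟩
    · refine ContDiffOn.add (ContDiffOn.div contDiffOn_const (by fun_prop) fun p hp => ?_) hyC'.fst
      have := hq2 p.2 (hJ' p.2 hp.2)
      simpa using this
    · intro q hq
      simp [hy0 q hq]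
    · intro ε hε q hq
      obtain ⟨h1, h2⟩ := hy ε (hε₀ ε hε).2 q hq
      refine ⟨?_, h2⟩
      rw [mem_ball_zero_iff]
      exact (norm_snd_le (y (ε, q))).trans_lt h1
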